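/- Let $p,q\in\mathbb N$ be coprime, $1\le q<p$, and let $\rho\in\mathbb C$. Put $$\gamma_{p,q}=\{w^q=z^p\}\subset\mathbb C^2\subset\mathbb{CP}^2,\qquad \eta_\rho(\zeta)=\frac{(\rho-1)\zeta-(\rho-2)}{\rho\zeta-(\rho-1)},$$ where $\eta_\rho$ is an involution of $\overline{\mathbb C}=\mathbb C\cup\{\infty\}$. For $P\in\gamma_{p,q}\setminus\{(0,0)\}$ let $L_P$ be the projective tangent line to $\gamma_{p,q}$ at $P$. The $(p,q;\rho)$-billiard is the family of projective involutions $\sigma_P:L_P\to L_P$, $P\in\gamma_{p,q}\setminus\{(0,0)\}$, acting as $\eta_\rho$ in the coordinate $\zeta=z/z(P)$ on $L_P$. A rational function $R$ on $\mathbb{CP}^2$ is an integral of this billiard if $R\circ\sigma_P=R$ on $L_P$ for every $P\in\gamma_{p,q}\setminus\{(0,0)\}$. A polynomial in $(z,w)$ is $(p,q)$-quasihomogeneous if all its monomials $z^kw^m$ have the same value of $kq+mp$; a $(p,q)$-quasihomogeneous rational function is a ratio of two such polynomials. **Theorem.** The $(p,q;\rho)$-billiard admits a non-constant $(p,q)$-quasihomogeneous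 rational integral if and only if $p=2$, $q=1$ and $$\rho\in\mathcal M:=\{0,1,2,3,4\}\cup\bigcup_{k\in\mathbb N,\ k\ge3}\Big\{2+\frac2k,\ 2-\frac2k\Big\}.$$ The following list, where $N\in\mathbb N$, $N\geq1$, assigns exactly one function $R_\rho$ to every $\rho\in\mathcal M$, and $R_\rho$ is a non-constant $(2,1)$-quasihomogeneous rational integral of the $(2,1;\rho)$-billiard: - $R_0=w-z^2$, $\ R_1=\frac{w-z^2}{z}$, $\ R_2=\frac{w-z^2}{w}$, $\ R_3=\frac{w-z^2}{zw}$, $\ R_4=\frac{w-z^2}{w^2}$; - $\rho=2-\frac2{2N+1}$: $\ R_\rho=\dfrac{(w-z^2)^{2N+1}}{\prod_{j=1}^N(w-c_jz^2)^2}$, $\ c_j=-\frac{4j(2N+1-j)}{(2N+1-2j)^2}$; - $\rho=2+\frac2{2N+1}$: $\ R_\rho=\dfrac{(w-z^2)^{2N+1}}{w^2\prod_{j=1}^N(w-c_jz^2)^2}$, $\ c_j=-\frac{4j(2N+1-j)}{(2N+1-2j)^2}$; - $\rho=2-\frac1{N+1}$: $\ R_\rho=\dfrac{(w-z^2)^{N+1}}{z\prod_{j=1}^N(w-c_jz^2)}$,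 $\ c_j=-\frac{j(2N+2-j)}{(N+1-j)^2}$; - $\rho=2+\frac1{N+1}$: $\ R_\rho=\dfrac{(w-z^2)^{N+1}}{zw\prod_{j=1}^N(w-c_jz^2)}$, $\ c_j=-\frac{j(2N+2-j)}{(N+1-j)^2}$. **Addendum.** The projective transformation $(\widetilde z,\widetilde w)=\left(\frac zw,\frac1w\right)$ of $\mathbb{CP}^2$ maps $\gamma_{2,1}\setminus\{(0,0)\}$ bijectively onto itself and, for every $\rho\in\mathbb C$, transforms the $(2,1;\rho)$-billiard to the $(2,1;4-\rho)$-billiard: it sends the tangent line at each point of $\gamma_{2,1}\setminus\{(0,0)\}$ to the tangent line at the image point, and conjugates the corresponding involutions. It interchanges the integrals above: $R_\rho(\widetilde z,\widetilde w)=R_{4-\rho}(z,w)$ for every $\rho\in\mathcal M$. -/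

import Mathlib

open scoped OnePoint

noncomputable section

namespace QuasiBilliard

/-! ### The projective plane and rational functions -/

/-- The complex projective plane, with homogeneous coordinates `[Z : W : T]`. -/
abbrev CP2 : Type := Projectivization ℂ (Fin 3 → ℂ)

/-- The inclusion `(z, w) ↦ [z : w : 1]` of the affine plane. -/
def affinePoint (x : ℂ × ℂ) : CP2 :=
  Projectivization.mk ℂ ![x.1, x.2, 1] (fun h => one_ne_zero (congrFun h 2))

/-- The field `ℂ(z, w)` of rational functions on the projective plane. -/
abbrev RatFun : Type := FractionRing (MvPolynomial (Fin 2) ℂ)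

/-- The coordinate function `z`. -/
def zCoord : RatFun := algebraMap (MvPolynomial (Fin 2) ℂ) RatFun (MvPolynomial.X 0)

/-- The coordinate function `w`. -/
def wCoord : RatFun := algebraMap (MvPolynomial (Fin 2) ℂ) RatFun (MvPolynomial.X 1)

/-- The value of a polynomial in `z, w` at a point of the affine plane. -/
def evalAt (x : ℂ × ℂ) (f : MvPolynomial (Fin 2) ℂ) : ℂ := MvPolynomial.eval ![x.1, x.2] f

/-- `HasValueAt R x v`: the rational function `R` is determined at the affine point `x`, with value
`v` in the Riemann sphere. That is, `R = f / g` for polynomials `f`, `g` which do not both vanish at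
`x`, and `v = f(x) / g(x)`. The value does not depend on `f`, `g`. The points at which `R` has no
value are its indeterminacy points; there are finitely many of them. -/
def HasValueAt (R : RatFun) (x : ℂ × ℂ) (v : OnePoint ℂ) : Prop :=
  ∃ f g : MvPolynomial (Fin 2) ℂ, g ≠ 0 ∧
    R = algebraMap (MvPolynomial (Fin 2) ℂ) RatFun f /
      algebraMap (MvPolynomial (Fin 2) ℂ) RatFun g ∧
    ((evalAt x g ≠ 0 ∧ v = ((evalAt x f / evalAt x g : ℂ) : OnePoint ℂ)) ∨
      (evalAt x g = 0 ∧ evalAt x f ≠ 0 ∧ v = ∞))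

/-- The rational function `R` is not a constant. -/
def IsNonconstant (R : RatFun) : Prop := ∀ c : ℂ, R ≠ algebraMap ℂ RatFun c

/-! ### The `(p,q;ρ)`-billiard -/

/-- The punctured `(p,q)`-curve `{w ^ q = z ^ p} \ {(0,0)}`. -/
def puncturedCurve (p q : ℕ) : Set (ℂ × ℂ) := {P | P.2 ^ q = P.1 ^ p ∧ P ≠ (0, 0)}

/-- The projective line tangent to the curve `w ^ q - z ^ p = 0` at its point `P`; in affine
coordinates, `q w(P)^(q-1) (w - w(P)) = p z(P)^(p-1) (z - z(P))`. -/
def tangentLine (p q : ℕ) (P : ℂ × ℂ) : Set CP2 :=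
  {x | (q : ℂ) * P.2 ^ (q - 1) * (x.rep 1 - P.2 * x.rep 2) =
    (p : ℂ) * P.1 ^ (p - 1) * (x.rep 0 - P.1 * x.rep 2)}

/-- The coordinate `ζ = z / z(P)` with values in the Riemann sphere. -/
def zeta (P : ℂ × ℂ) (x : CP2) : OnePoint ℂ :=
  if x.rep 2 = 0 then ∞ else ((x.rep 0 / x.rep 2 / P.1 : ℂ) : OnePoint ℂ)

/-- The involution `η_ρ(ζ) = ((ρ-1) ζ - (ρ-2)) / (ρ ζ - (ρ-1))` of the Riemann sphere. -/
def eta (ρ : ℂ) : OnePoint ℂ → OnePoint ℂ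
  | ∞ => if ρ = 0 then ∞ else (((ρ - 1) / ρ : ℂ) : OnePoint ℂ)
  | OnePoint.some ζ => if ρ * ζ - (ρ - 1) = 0 then ∞ else
      ((((ρ - 1) * ζ - (ρ - 2)) / (ρ * ζ - (ρ - 1)) : ℂ) : OnePoint ℂ)

/-- The graph of the involution `σ_P : L_P → L_P` of the `(p,q;ρ)`-billiard: `y = σ_P(x)` where
`x`, `y` lie on the tangent line `L_P`, and `σ_P` acts as `η_ρ` in the coordinate `ζ` on `L_P`.
That this is the graph of an involution fixing `P` is `BilliardMap.existsUnique`, `BilliardMap.symm` and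
`BilliardMap.fixes` below. -/
def BilliardMap (p q : ℕ) (ρ : ℂ) (P : ℂ × ℂ) (x y : CP2) : Prop :=
  x ∈ tangentLine p q P ∧ y ∈ tangentLine p q P ∧ zeta P y = eta ρ (zeta P x)

/-- `R` is an integral of the `(p,q;ρ)`-billiard: for every `P` in the punctured curve,
`R ∘ σ_P = R` on `L_P`, that is, `R(x) = R(y)` whenever `y = σ_P(x)` and `R` has values at `x`, `y`.
Points at infinity need not be considered, as the rational functions `R` and `R ∘ σ_P` on the line
`L_P` coincide as soon as they coincide outside a finite set. -/
def IsBilliardIntegral (p q : ℕ) (ρ : ℂ) (R : RatFun) : Prop :=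
  ∀ P ∈ puncturedCurve p q, ∀ x y : ℂ × ℂ, BilliardMap p q ρ P (affinePoint x) (affinePoint y) →
    ∀ v v' : OnePoint ℂ, HasValueAt R x v → HasValueAt R y v' → v = v'

/-! ### Quasihomogeneity -/

/-- The polynomial `f` contains only monomials `z ^ k w ^ m` with `(k, m)` on one line parallel to
the segment from `(p, 0)` to `(0, q)`, that is, with one and the same value of `k q + m p`. -/
def IsQuasihomogeneous (p q : ℕ) (f : MvPolynomial (Fin 2) ℂ) : Prop :=
  ∃ n : ℕ, MvPolynomial.IsWeightedHomogeneous ![q, p] f n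

/-- `R` is a ratio of two `(p,q)`-quasihomogeneous polynomials. -/
def IsQuasihomogeneousRational (p q : ℕ) (R : RatFun) : Prop :=
  ∃ f g : MvPolynomial (Fin 2) ℂ, IsQuasihomogeneous p q f ∧ IsQuasihomogeneous p q g ∧ g ≠ 0 ∧
    R = algebraMap (MvPolynomial (Fin 2) ℂ) RatFun f /
      algebraMap (MvPolynomial (Fin 2) ℂ) RatFun g

/-- `R` is a non-constant `(p,q)`-quasihomogeneous rational integral of the `(p,q;ρ)`-billiard. -/
def IsQuasihomogeneousIntegral (p q : ℕ) (ρ : ℂ) (R : RatFun) : Prop :=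
  IsNonconstant R ∧ IsQuasihomogeneousRational p q R ∧ IsBilliardIntegral p q ρ R

/-- The `(p,q;ρ)`-billiard is quasihomogeneously integrable. -/
def QuasihomogeneouslyIntegrable (p q : ℕ) (ρ : ℂ) : Prop :=
  ∃ R : RatFun, IsQuasihomogeneousIntegral p q ρ R

/-! ### The residues and the integrals of the classification -/

/-- The set `{0, 1, 2, 3, 4} ∪ {2 ± 2/k : k ≥ 3}`. -/
def residues : Set ℂ :=
  {0, 1, 2, 3, 4} ∪ {ρ | ∃ k : ℕ, 3 ≤ k ∧ (ρ = 2 + 2 / (k : ℂ) ∨ ρ = 2 - 2 / (k : ℂ))}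

/-- The function `w - c z ^ 2`. -/
def conicFun (c : ℂ) : RatFun := wCoord - algebraMap ℂ RatFun c * zCoord ^ 2

/-- The coefficient `c_j = - 4 j (2N+1-j) / (2N+1-2j)^2`. -/
def cOdd (N j : ℕ) : ℂ :=
  -(4 * (j : ℂ) * (2 * (N : ℂ) + 1 - (j : ℂ))) / (2 * (N : ℂ) + 1 - 2 * (j : ℂ)) ^ 2

/-- The coefficient `c_j = - j (2N+2-j) / (N+1-j)^2`. -/
def cEven (N j : ℕ) : ℂ :=
  -((j : ℂ) * (2 * (N : ℂ) + 2 - (j : ℂ))) / ((N : ℂ) + 1 - (j : ℂ)) ^ 2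

/-- The table of the integrals: `IsTableIntegral ρ R` says that `R` is the function `R_ρ`. -/
def IsTableIntegral (ρ : ℂ) (R : RatFun) : Prop :=
  (ρ = 0 ∧ R = wCoord - zCoord ^ 2) ∨
  (ρ = 1 ∧ R = (wCoord - zCoord ^ 2) / zCoord) ∨
  (ρ = 2 ∧ R = (wCoord - zCoord ^ 2) / wCoord) ∨
  (ρ = 3 ∧ R = (wCoord - zCoord ^ 2) / (zCoord * wCoord)) ∨
  (ρ = 4 ∧ R = (wCoord - zCoord ^ 2) / wCoord ^ 2) ∨
  (∃ N : ℕ, 1 ≤ N ∧ ρ = 2 - 2 / (2 * (N : ℂ) + 1) ∧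
    R = (wCoord - zCoord ^ 2) ^ (2 * N + 1) /
      ∏ j ∈ Finset.Icc 1 N, conicFun (cOdd N j) ^ 2) ∨
  (∃ N : ℕ, 1 ≤ N ∧ ρ = 2 + 2 / (2 * (N : ℂ) + 1) ∧
    R = (wCoord - zCoord ^ 2) ^ (2 * N + 1) /
      (wCoord ^ 2 * ∏ j ∈ Finset.Icc 1 N, conicFun (cOdd N j) ^ 2)) ∨
  (∃ N : ℕ, 1 ≤ N ∧ ρ = 2 - 1 / ((N : ℂ) + 1) ∧
    R = (wCoord - zCoord ^ 2) ^ (N + 1) /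
      (zCoord * ∏ j ∈ Finset.Icc 1 N, conicFun (cEven N j))) ∨
  (∃ N : ℕ, 1 ≤ N ∧ ρ = 2 + 1 / ((N : ℂ) + 1) ∧
    R = (wCoord - zCoord ^ 2) ^ (N + 1) /
      (zCoord * wCoord * ∏ j ∈ Finset.Icc 1 N, conicFun (cEven N j)))

/-! ### The variable change `(z, w) ↦ (z / w, 1 / w)` -/

/-- The variable change on points of the affine plane with `w ≠ 0`. -/
def changeAffine (x : ℂ × ℂ) : ℂ × ℂ := (x.1 / x.2, 1 / x.2)

/-- The variable change as the projective transformation `[Z : W : T] ↦ [Z : T : W]`. -/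
def changeProj : CP2 → CP2 :=
  Projectivization.map
    (LinearEquiv.funCongrLeft ℂ ℂ (Equiv.swap (1 : Fin 3) 2) : (Fin 3 → ℂ) →ₗ[ℂ] (Fin 3 → ℂ))
    (LinearEquiv.injective _)

/-! ### The definitions agree with the geometric notions -/

theorem mem_tangentLine_mk (p q : ℕ) (P : ℂ × ℂ) (v : Fin 3 → ℂ) (hv : v ≠ 0) :
    Projectivization.mk ℂ v hv ∈ tangentLine p q P ↔
      (q : ℂ) * P.2 ^ (q - 1) * (v 1 - P.2 * v 2) =
        (p : ℂ) * P.1 ^ (p - 1) * (v 0 - P.1 * v 2) := by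
  obtain ⟨a, ha⟩ := Projectivization.exists_smul_eq_mk_rep ℂ v hv
  have ha0 : (a : ℂ) ≠ 0 := a.ne_zero
  simp only [tangentLine, Set.mem_ofPred_eq, ← ha, Pi.smul_apply, Units.smul_def, smul_eq_mul]
  constructor
  · intro h
    apply mul_left_cancel₀ ha0
    linear_combination h
  · intro h
    linear_combination (a : ℂ) * h

theorem zeta_mk (P : ℂ × ℂ) (v : Fin 3 → ℂ) (hv : v ≠ 0) :
    zeta P (Projectivization.mk ℂ v hv) =
      if v 2 = 0 then ∞ else ((v 0 / v 2 / P.1 : ℂ) : OnePoint ℂ) := by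
  obtain ⟨a, ha⟩ := Projectivization.exists_smul_eq_mk_rep ℂ v hv
  have ha0 : (a : ℂ) ≠ 0 := a.ne_zero
  simp only [zeta, ← ha, Pi.smul_apply, Units.smul_def, smul_eq_mul, mul_eq_zero, ha0, false_or,
    mul_div_mul_left _ _ ha0]

theorem eta_eta (ρ : ℂ) (ζ : OnePoint ℂ) : eta ρ (eta ρ ζ) = ζ := by
  induction ζ using OnePoint.rec with
  | infty =>
    by_cases h : ρ = 0
    · simp [eta, h]
    · have h1 : ρ * ((ρ - 1) / ρ) - (ρ - 1) = 0 := by field_simp; ring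
      simp [eta, h, h1]
  | coe ζ =>
    by_cases h : ρ * ζ - (ρ - 1) = 0
    · by_cases h0 : ρ = 0
      · simp [h0] at h
      · have h1 : (ρ - 1) / ρ = ζ := by field_simp; linear_combination -h
        simp [eta, h, h0, h1]
    · have h1 : ρ * (((ρ - 1) * ζ - (ρ - 2)) / (ρ * ζ - (ρ - 1))) - (ρ - 1) =
          1 / (ρ * ζ - (ρ - 1)) := by field_simp; ring
      have h2 : ((ρ - 1) * (((ρ - 1) * ζ - (ρ - 2)) / (ρ * ζ - (ρ - 1))) - (ρ - 2)) =
          ζ / (ρ * ζ - (ρ - 1)) := by field_simp; ring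
      simp only [eta, h, if_false, h1, h2, one_div, inv_eq_zero]
      rw [div_inv_eq_mul, div_mul_cancel₀ _ h]

theorem eta_one (ρ : ℂ) : eta ρ ((1 : ℂ) : OnePoint ℂ) = ((1 : ℂ) : OnePoint ℂ) := by
  have h : ρ * 1 - (ρ - 1) = 1 := by ring
  have h' : (ρ - 1) * 1 - (ρ - 2) = 1 := by ring
  simp only [eta, h, h', one_ne_zero, if_false, div_one]

theorem ne_zero_of_mem {p q : ℕ} (hp : p ≠ 0) (hq : q ≠ 0) {P : ℂ × ℂ}
    (hP : P ∈ puncturedCurve p q) : P.1 ≠ 0 ∧ P.2 ≠ 0 := by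
  obtain ⟨h, h0⟩ := hP
  have h1 : P.1 = 0 ↔ P.2 = 0 := by
    constructor
    · intro h1
      rw [h1, zero_pow hp] at h
      exact eq_zero_of_pow_eq_zero h
    · intro h1
      rw [h1, zero_pow hq] at h
      exact eq_zero_of_pow_eq_zero h.symm
  have h2 : P.1 ≠ 0 := fun h2 => h0 (Prod.ext h2 (h1.1 h2))
  exact ⟨h2, fun h3 => h2 (h1.2 h3)⟩

/-- On a tangent line, `ζ` is a bijection onto the Riemann sphere. -/
theorem zeta_bijOn {p q : ℕ} (hp : p ≠ 0) (hq : q ≠ 0) {P : ℂ × ℂ}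
    (hP : P ∈ puncturedCurve p q) : Set.BijOn (zeta P) (tangentLine p q P) Set.univ := by
  obtain ⟨h1, h2⟩ := ne_zero_of_mem hp hq hP
  have hA : (q : ℂ) * P.2 ^ (q - 1) ≠ 0 :=
    mul_ne_zero (Nat.cast_ne_zero.2 hq) (pow_ne_zero _ h2)
  refine ⟨fun _ _ => Set.mem_univ _, ?_, ?_⟩
  · intro x hx y hy hxy
    induction x using Projectivization.ind with
    | h v hv =>
    induction y using Projectivization.ind with
    | h u hu =>
    rw [mem_tangentLine_mk] at hx hy
    rw [zeta_mk, zeta_mk] at hxy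
    rw [Projectivization.mk_eq_mk_iff']
    by_cases hv2 : v 2 = 0
    · by_cases hu2 : u 2 = 0
      · rw [hv2] at hx
        rw [hu2] at hy
        have hu0 : u 0 ≠ 0 := by
          intro hu0
          rw [hu0] at hy
          have hu1 : u 1 = 0 := by
            apply mul_left_cancel₀ hA
            linear_combination hy
          apply hu
          ext i
          fin_cases i <;> assumption
        refine ⟨v 0 / u 0, ?_⟩
        ext i
        fin_cases i
        · simp [hu0]
        · simp only [Fin.mk_one, Pi.smul_apply, smul_eq_mul]
          rw [div_mul_eq_mul_div, div_eq_iff hu0]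
          apply mul_left_cancel₀ hA
          linear_combination v 0 * hy - u 0 * hx
        · simp [hu2, hv2]
      · simp [hv2, hu2] at hxy
    · by_cases hu2 : u 2 = 0
      · simp [hv2, hu2] at hxy
      · simp only [hv2, hu2, if_false, OnePoint.coe_eq_coe] at hxy
        field_simp at hxy
        refine ⟨v 2 / u 2, ?_⟩
        ext i
        fin_cases i
        · simp only [Fin.zero_eta, Pi.smul_apply, smul_eq_mul]
          field_simp
          linear_combination -hxy
        · simp only [Fin.mk_one, Pi.smul_apply, smul_eq_mul]
          rw [div_mul_eq_mul_div, div_eq_iff hu2]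
          apply mul_left_cancel₀ hA
          linear_combination v 2 * hy - u 2 * hx - (p : ℂ) * P.1 ^ (p - 1) * hxy
        · simp [hu2]
  · intro ζ _
    induction ζ using OnePoint.rec with
    | infty =>
      have hv : ![(q : ℂ) * P.2 ^ (q - 1), (p : ℂ) * P.1 ^ (p - 1), 0] ≠ 0 :=
        fun h => hA (congrFun h 0)
      refine ⟨Projectivization.mk ℂ _ hv, ?_, ?_⟩
      · rw [mem_tangentLine_mk]
        simp
        ring
      · rw [zeta_mk]
        simp
    | coe ζ =>
      have hv : ![P.1 * ζ, P.2 + (p : ℂ) * P.1 ^ (p - 1) / ((q : ℂ) * P.2 ^ (q - 1)) *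
          (P.1 * ζ - P.1), 1] ≠ 0 := fun h => one_ne_zero (congrFun h 2)
      refine ⟨Projectivization.mk ℂ _ hv, ?_, ?_⟩
      · rw [mem_tangentLine_mk]
        simp only [Matrix.cons_val_zero, Matrix.cons_val_one, Matrix.cons_val]
        generalize (q : ℂ) * P.2 ^ (q - 1) = A at hA
        field_simp
        ring
      · rw [zeta_mk]
        simp [h1]

theorem BilliardMap.existsUnique {p q : ℕ} (hp : p ≠ 0) (hq : q ≠ 0) (ρ : ℂ) {P : ℂ × ℂ}
    (hP : P ∈ puncturedCurve p q) {x : CP2} (hx : x ∈ tangentLine p q P) :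
    ∃! y, BilliardMap p q ρ P x y := by
  obtain ⟨-, hinj, hsurj⟩ := zeta_bijOn hp hq hP
  obtain ⟨y, hy, hxy⟩ := hsurj (Set.mem_univ (eta ρ (zeta P x)))
  exact ⟨y, ⟨hx, hy, hxy⟩, fun y' h => hinj h.2.1 hy (h.2.2.trans hxy.symm)⟩

theorem BilliardMap.symm {p q : ℕ} {ρ : ℂ} {P : ℂ × ℂ} {x y : CP2} (h : BilliardMap p q ρ P x y) :
    BilliardMap p q ρ P y x :=
  ⟨h.2.1, h.1, by rw [h.2.2, eta_eta]⟩

theorem BilliardMap.fixes {p q : ℕ} (hp : p ≠ 0) (hq : q ≠ 0) (ρ : ℂ) {P : ℂ × ℂ}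
    (hP : P ∈ puncturedCurve p q) : BilliardMap p q ρ P (affinePoint P) (affinePoint P) := by
  have h0 := ne_zero_of_mem hp hq hP
  have hL : affinePoint P ∈ tangentLine p q P := by
    rw [affinePoint, mem_tangentLine_mk]
    simp
  have hz : zeta P (affinePoint P) = ((1 : ℂ) : OnePoint ℂ) := by
    rw [affinePoint, zeta_mk]
    simp [h0.1]
  exact ⟨hL, hL, by rw [hz, eta_one]⟩

theorem changeProj_affinePoint (x : ℂ × ℂ) (hx : x.2 ≠ 0) :
    changeProj (affinePoint x) = affinePoint (changeAffine x) := by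
  rw [affinePoint, affinePoint, changeProj, Projectivization.map_mk,
    Projectivization.mk_eq_mk_iff']
  refine ⟨x.2, ?_⟩
  ext i
  fin_cases i
  · simp [changeAffine, LinearEquiv.funCongrLeft, LinearMap.funLeft, Equiv.swap_apply_def]
    field_simp
  · simp [changeAffine, LinearEquiv.funCongrLeft, LinearMap.funLeft, hx]
  · simp [changeAffine, LinearEquiv.funCongrLeft, LinearMap.funLeft]

end QuasiBilliard

end

/-! A tangent line `L_P` has an affine coordinate `x` in which `P` is at infinity, the lines
`z = 0`, `w = 0` and the line at infinity are at `0`, `n = p - q` and `-m = -q`, and `σ_P` is the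
reflection `x ↦ k - x` with `k = q (ρ - 2)` (`linePoint`). A quasihomogeneous polynomial is a
product of `z`, `w` and factors `w ^ q - c z ^ p`, and such a factor with `c ≠ 0` has simple zeros
on `L_P`, the roots of `fiberPoly m n c = (x - n) ^ m (x + m) ^ n - c x ^ p`. Their number is `p`
and their sum is `0` for `c ≠ 1`; for `c = 1` the numbers are `p - 2` and `2 (m - n) / 3`, since
two points of intersection have gone to `P`. So an integral gives an integer-valued order on `ℂ`
that is constant on the roots of each `fiberPoly m n c` with `c ≠ 0`, symmetric under `x ↦ k - x`,
and has finite support (`IsInvariantOrder`).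

For `p ≥ 3` the set of points of a given nonzero order has its centre at `k / 2`. The centres of
two such sets are compared, and a congruence modulo `p` shows that the order `M 1` along the curve
is zero (`IsInvariantOrder.map_one_eq_zero`). The same comparison then shows that the orders at `n`
and `-m` vanish (`IsInvariantOrder.ord_eq_zero`), so that the integral has quasihomogeneous degree
zero. But then it can be replaced by its difference with its value on the curve, which has a
positive order along the curve, a contradiction (`not_quasihomogeneouslyIntegrable`).

For `p = 2` the order is also symmetric under `x ↦ -x`, except at `x = ±1`. The two reflections
generate the translations by multiples of `k`. As the support is finite, for `k ≠ 0` the orbit of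
each point of the support ends at `±1`, hence `k = ±2 / j` (`IsInvariantOrder.reflection_eq`), and
these are the residues of the list.

Conversely, for the functions of the table `1 - c_j = K ^ 2 / (K - 2 j) ^ 2` with `k = ±2 / K`. In
the coordinate `X = K x` the denominator on `L_P` is essentially the product of `X + i` over an
arithmetic progression of integers `i` with difference `2`, symmetric with respect to the centre of
the reflection (`prod_progression_reflect`), and the numerator has no zeros at finite `x`.

The variable change `(z, w) ↦ (z / w, 1 / w)` acts on a tangent line to the conic as `η_2` in the
coordinates `ζ`, which conjugates `η_ρ` to `η_{4-ρ}` (`eta_two_eta`). It changes only the power of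
`w` in the denominator of a function of the table (`changeHom_tableFrac`). -/

open scoped OnePoint

noncomputable section

namespace QuasiBilliard

/-! ### An affine coordinate on the tangent lines -/

/-- The point of the tangent line at `P` with coordinate `x = q ζ / (1 - ζ)`. In this coordinate the
point `P` is at infinity, the line `z = 0` is at `0`, the line `w = 0` is at `p - q`, the line at
infinity of the plane is at `-q`, and `σ_P` is the reflection `x ↦ q (ρ - 2) - x`. -/
def linePoint (p q : ℕ) (P : ℂ × ℂ) (x : ℂ) : ℂ × ℂ :=
  (P.1 * (x / (x + q)), P.2 * ((x - (p - q)) / (x + q)))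

theorem affinePoint_mem_tangentLine {p q : ℕ} {P y : ℂ × ℂ} :
    affinePoint y ∈ tangentLine p q P ↔
      (q : ℂ) * P.2 ^ (q - 1) * (y.2 - P.2) = (p : ℂ) * P.1 ^ (p - 1) * (y.1 - P.1) := by
  rw [affinePoint, mem_tangentLine_mk]
  simp

theorem zeta_affinePoint (P y : ℂ × ℂ) :
    zeta P (affinePoint y) = ((y.1 / P.1 : ℂ) : OnePoint ℂ) := by
  rw [affinePoint, zeta_mk]
  simp

theorem linePoint_mem_tangentLine {p q : ℕ} (hp : p ≠ 0) (hq : q ≠ 0) {P : ℂ × ℂ}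
    (hP : P ∈ puncturedCurve p q) {x : ℂ} (hx : x + q ≠ 0) :
    affinePoint (linePoint p q P x) ∈ tangentLine p q P := by
  rw [affinePoint_mem_tangentLine]
  have h1 : (linePoint p q P x).2 - P.2 = P.2 * (-p / (x + q)) := by
    simp only [linePoint]
    field_simp
    ring
  have h2 : (linePoint p q P x).1 - P.1 = P.1 * (-q / (x + q)) := by
    simp only [linePoint]
    field_simp
    ring
  rw [h1, h2]
  have h3 : P.2 ^ (q - 1) * P.2 = P.1 ^ (p - 1) * P.1 := by
    rw [pow_sub_one_mul hq, pow_sub_one_mul hp, hP.1]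
  linear_combination (-(p : ℂ) * q / (x + q)) * h3

theorem eta_linePoint {q : ℕ} (ρ x : ℂ) (hx : x + q ≠ 0)
    (hy : q * (ρ - 2) - x + q ≠ 0) :
    eta ρ ((x / (x + q) : ℂ) : OnePoint ℂ) =
      (((q * (ρ - 2) - x) / (q * (ρ - 2) - x + q) : ℂ) : OnePoint ℂ) := by
  have h1 : ρ * (x / (x + q)) - (ρ - 1) = -(q * (ρ - 2) - x + q) / (x + q) := by
    field_simp
    ring
  have h2 : (ρ - 1) * (x / (x + q)) - (ρ - 2) = -(q * (ρ - 2) - x) / (x + q) := by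
    field_simp
    ring
  have h3 : -(q * (ρ - 2) - x + q) / (x + q) ≠ 0 := div_ne_zero (neg_ne_zero.2 hy) hx
  simp only [eta, h1, h2, if_neg h3]
  rw [div_div_div_cancel_right₀ hx, neg_div_neg_eq]

theorem billiardMap_linePoint {p q : ℕ} (hp : p ≠ 0) (hq : q ≠ 0) (ρ : ℂ) {P : ℂ × ℂ}
    (hP : P ∈ puncturedCurve p q) {x : ℂ} (hx : x + q ≠ 0) (hy : q * (ρ - 2) - x + q ≠ 0) :
    BilliardMap p q ρ P (affinePoint (linePoint p q P x))
      (affinePoint (linePoint p q P (q * (ρ - 2) - x))) := by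
  have h0 := (ne_zero_of_mem hp hq hP).1
  refine ⟨linePoint_mem_tangentLine hp hq hP hx, linePoint_mem_tangentLine hp hq hP hy, ?_⟩
  have h : ∀ u : ℂ, (linePoint p q P u).1 / P.1 = u / (u + q) := fun u => by
    simp only [linePoint]
    field_simp
  rw [zeta_affinePoint, zeta_affinePoint, h, h, eta_linePoint ρ x hx hy]

/-- An affine point of a tangent line is the tangency point or has a finite coordinate. -/
theorem eq_or_eq_linePoint {p q : ℕ} (hp : p ≠ 0) (hq : q ≠ 0) {P : ℂ × ℂ}
    (hP : P ∈ puncturedCurve p q) {y : ℂ × ℂ} (hy : affinePoint y ∈ tangentLine p q P) :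
    y = P ∨ ∃ x : ℂ, x + q ≠ 0 ∧ y = linePoint p q P x := by
  obtain ⟨h1, h2⟩ := ne_zero_of_mem hp hq hP
  have hq' : (q : ℂ) ≠ 0 := Nat.cast_ne_zero.2 hq
  rw [affinePoint_mem_tangentLine] at hy
  have hpow : P.2 ^ (q - 1) * P.2 = P.1 ^ (p - 1) * P.1 := by
    rw [pow_sub_one_mul hq, pow_sub_one_mul hp, hP.1]
  have hA : P.1 ^ (p - 1) ≠ 0 := pow_ne_zero _ h1
  -- the equation of the line in the coordinates `z / z(P)`, `w / w(P)`
  have hline : (q : ℂ) * (y.2 / P.2 - 1) = p * (y.1 / P.1 - 1) := by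
    field_simp
    apply mul_left_cancel₀ hA
    linear_combination P.2 * hy - (q : ℂ) * (y.2 - P.2) * hpow
  by_cases h : y.1 = P.1
  · left
    refine Prod.ext h ?_
    rw [h, div_self h1, sub_self, mul_zero, mul_eq_zero, or_iff_right hq', sub_eq_zero,
      div_eq_one_iff_eq h2] at hline
    exact hline
  · right
    have hd : P.1 - y.1 ≠ 0 := sub_ne_zero.2 (Ne.symm h)
    have hs : q * y.1 / (P.1 - y.1) + q = q * P.1 / (P.1 - y.1) := by
      field_simp
      ring
    refine ⟨q * y.1 / (P.1 - y.1), ?_, ?_⟩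
    · rw [hs]
      exact div_ne_zero (mul_ne_zero hq' h1) hd
    · have e2 : y.2 = P.2 * (1 + p / q * (y.1 / P.1 - 1)) := by
        field_simp
        field_simp at hline
        linear_combination hline
      refine Prod.ext ?_ ?_
      · simp only [linePoint, hs]
        field_simp
      · simp only [linePoint, hs]
        rw [e2]
        field_simp
        ring

/-- The pairs of affine points interchanged by `σ_P`, apart from the fixed point `P`, are the pairs
of points with the coordinates `x` and `q (ρ - 2) - x`. -/
theorem eq_linePoint_of_billiardMap {p q : ℕ} (hp : p ≠ 0) (hq : q ≠ 0) {ρ : ℂ} {P : ℂ × ℂ}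
    (hP : P ∈ puncturedCurve p q) {y y' : ℂ × ℂ}
    (h : BilliardMap p q ρ P (affinePoint y) (affinePoint y')) :
    y = P ∧ y' = P ∨ ∃ x : ℂ, x + q ≠ 0 ∧ q * (ρ - 2) - x + q ≠ 0 ∧ y = linePoint p q P x ∧
      y' = linePoint p q P (q * (ρ - 2) - x) := by
  have hinj : ∀ u v : ℂ × ℂ, affinePoint u = affinePoint v → u = v := by
    intro u v huv
    rw [affinePoint, affinePoint, Projectivization.mk_eq_mk_iff'] at huv
    obtain ⟨a, ha⟩ := huv
    have h2 := congrFun ha 2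
    have h0 := congrFun ha 0
    have h1 := congrFun ha 1
    simp at h0 h1 h2
    subst h2
    exact Prod.ext (by simpa using h0.symm) (by simpa using h1.symm)
  obtain ⟨y0, -, huniq⟩ := BilliardMap.existsUnique hp hq ρ hP h.1
  rcases eq_or_eq_linePoint hp hq hP h.1 with rfl | ⟨x, hx, rfl⟩
  · left
    refine ⟨rfl, hinj _ _ ?_⟩
    rw [huniq _ h, huniq _ (BilliardMap.fixes hp hq ρ hP)]
  · by_cases hy : q * (ρ - 2) - x + q = 0
    · -- the image is the point at infinity, so it is not an affine point
      exfalso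
      have h3 := h.2.2
      have h0 := (ne_zero_of_mem hp hq hP).1
      rw [zeta_affinePoint, zeta_affinePoint] at h3
      have h1 : ρ * ((linePoint p q P x).1 / P.1) - (ρ - 1) = 0 := by
        simp only [linePoint]
        field_simp
        linear_combination -hy
      simp [eta, h1] at h3
    · right
      refine ⟨x, hx, hy, rfl, hinj _ _ ?_⟩
      rw [huniq _ h, huniq _ (billiardMap_linePoint hp hq ρ hP hx hy)]

/-! ### Values of rational functions -/

theorem mul_eq_mul_of_div_eq_div {f g f' g' : MvPolynomial (Fin 2) ℂ} (hg : g ≠ 0) (hg' : g' ≠ 0)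
    (h : algebraMap (MvPolynomial (Fin 2) ℂ) RatFun f / algebraMap _ RatFun g =
      algebraMap _ RatFun f' / algebraMap _ RatFun g') : f * g' = f' * g := by
  have hinj := IsFractionRing.injective (MvPolynomial (Fin 2) ℂ) RatFun
  have h1 : algebraMap (MvPolynomial (Fin 2) ℂ) RatFun g ≠ 0 :=
    (map_ne_zero_iff _ hinj).2 hg
  have h2 : algebraMap (MvPolynomial (Fin 2) ℂ) RatFun g' ≠ 0 :=
    (map_ne_zero_iff _ hinj).2 hg'
  rw [div_eq_div_iff h1 h2, ← map_mul, ← map_mul] at h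
  exact hinj h

/-- A function which satisfies the equation of invariance at generic points of a curve satisfies it
at every pair of points of the curve at which it has values: if `R = F / G` and
`F (a u) G (b u) = F (b u) G (a u)` with `G (a u) ≠ 0`, `G (b u) ≠ 0` for `u ≠ x` near `x`, then the
values of `R` at `a x` and at `b x` are equal. The representations of `R` that give the values may
differ from `F / G`. -/
theorem HasValueAt.eq_of_eventually {F G : MvPolynomial (Fin 2) ℂ} (hG : G ≠ 0) {a b : ℂ → ℂ × ℂ}
    {x : ℂ} (ha : ContinuousAt a x) (hb : ContinuousAt b x)
    (h : ∀ᶠ u in nhdsWithin x {x}ᶜ, evalAt (a u) G ≠ 0 ∧ evalAt (b u) G ≠ 0 ∧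
      evalAt (a u) F * evalAt (b u) G = evalAt (b u) F * evalAt (a u) G)
    {v v' : OnePoint ℂ}
    (hv : HasValueAt (algebraMap (MvPolynomial (Fin 2) ℂ) RatFun F / algebraMap _ RatFun G) (a x) v)
    (hv' : HasValueAt (algebraMap (MvPolynomial (Fin 2) ℂ) RatFun F / algebraMap _ RatFun G)
      (b x) v') : v = v' := by
  obtain ⟨f, g, hg, hfg, hv⟩ := hv
  obtain ⟨f', g', hg', hfg', hv'⟩ := hv'
  have e1 := mul_eq_mul_of_div_eq_div hG hg hfg
  have e2 := mul_eq_mul_of_div_eq_div hG hg' hfg'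
  have hcont : ∀ (c : ℂ → ℂ × ℂ), ContinuousAt c x → ∀ f : MvPolynomial (Fin 2) ℂ,
      ContinuousAt (fun u => evalAt (c u) f) x := by
    intro c hc f
    have h1 : Continuous fun y : ℂ × ℂ => evalAt y f := by
      refine (MvPolynomial.continuous_eval f).comp (continuous_pi fun i => ?_)
      fin_cases i
      · exact continuous_fst
      · exact continuous_snd
    exact ContinuousAt.comp (f := c) h1.continuousAt hc
  have key : evalAt (a x) f * evalAt (b x) g' - evalAt (b x) f' * evalAt (a x) g = 0 := by
    have hlim := (((hcont a ha f).mul (hcont b hb g')).sub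
      ((hcont b hb f').mul (hcont a ha g))).tendsto.mono_left
        (nhdsWithin_le_nhds (s := {x}ᶜ))
    refine tendsto_nhds_unique_of_eventuallyEq hlim tendsto_const_nhds ?_
    filter_upwards [h] with u hu
    obtain ⟨h1, h2, h3⟩ := hu
    have e1' : evalAt (a u) F * evalAt (a u) g = evalAt (a u) f * evalAt (a u) G := by
      simpa [evalAt] using congrArg (evalAt (a u)) e1
    have e2' : evalAt (b u) F * evalAt (b u) g' = evalAt (b u) f' * evalAt (b u) G := by
      simpa [evalAt] using congrArg (evalAt (b u)) e2
    simp only [Pi.sub_apply, Pi.mul_apply]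
    apply mul_left_cancel₀ (mul_ne_zero h1 h2)
    linear_combination -evalAt (b u) G * evalAt (b u) g' * e1' +
      evalAt (a u) G * evalAt (a u) g * e2' + evalAt (a u) g * evalAt (b u) g' * h3
  rcases hv with ⟨h1, rfl⟩ | ⟨h1, h2, rfl⟩ <;> rcases hv' with ⟨h3, rfl⟩ | ⟨h3, h4, rfl⟩
  · rw [OnePoint.coe_eq_coe, div_eq_div_iff h1 h3]
    linear_combination key
  · simp [h1, h3, h4] at key
  · simp [h1, h2, h3] at key
  · rfl

theorem HasValueAt.unique {R : RatFun} {x : ℂ × ℂ} {v v' : OnePoint ℂ} (hv : HasValueAt R x v)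
    (hv' : HasValueAt R x v') : v = v' := by
  obtain ⟨f, g, hg, hfg, hv⟩ := hv
  obtain ⟨f', g', hg', hfg', hv'⟩ := hv'
  have e := congrArg (evalAt x) (mul_eq_mul_of_div_eq_div hg hg' (hfg.symm.trans hfg'))
  have key : evalAt x f * evalAt x g' = evalAt x f' * evalAt x g := by simpa [evalAt] using e
  rcases hv with ⟨h1, rfl⟩ | ⟨h1, h2, rfl⟩ <;> rcases hv' with ⟨h3, rfl⟩ | ⟨h3, h4, rfl⟩
  · rw [OnePoint.coe_eq_coe, div_eq_div_iff h1 h3]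
    exact key
  · simp [h1, h3, h4] at key
  · simp [h1, h2, h3] at key
  · rfl

theorem hasValueAt_div {f g : MvPolynomial (Fin 2) ℂ} {x : ℂ × ℂ} (hx : evalAt x g ≠ 0) :
    HasValueAt (algebraMap (MvPolynomial (Fin 2) ℂ) RatFun f / algebraMap _ RatFun g) x
      ((evalAt x f / evalAt x g : ℂ) : OnePoint ℂ) := by
  refine ⟨f, g, ?_, rfl, Or.inl ⟨hx, rfl⟩⟩
  rintro rfl
  simp [evalAt] at hx

/-- A criterion for integrals in the coordinate of `linePoint`. -/
theorem isBilliardIntegral_of_linePoint {p q : ℕ} (hp : p ≠ 0) (hq : q ≠ 0) {ρ : ℂ}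
    {F G : MvPolynomial (Fin 2) ℂ} (hG : G ≠ 0)
    (hfin : ∀ P ∈ puncturedCurve p q,
      {x : ℂ | x + q ≠ 0 ∧ evalAt (linePoint p q P x) G = 0}.Finite)
    (hinv : ∀ P ∈ puncturedCurve p q, ∀ x : ℂ, x + q ≠ 0 → q * (ρ - 2) - x + q ≠ 0 →
      evalAt (linePoint p q P x) G ≠ 0 → evalAt (linePoint p q P (q * (ρ - 2) - x)) G ≠ 0 →
      evalAt (linePoint p q P x) F * evalAt (linePoint p q P (q * (ρ - 2) - x)) G =
        evalAt (linePoint p q P (q * (ρ - 2) - x)) F * evalAt (linePoint p q P x) G) :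
    IsBilliardIntegral p q ρ
      (algebraMap (MvPolynomial (Fin 2) ℂ) RatFun F / algebraMap _ RatFun G) := by
  intro P hP y y' hyy' v v' hv hv'
  rcases eq_linePoint_of_billiardMap hp hq hP hyy' with ⟨rfl, rfl⟩ | ⟨x, hx, hx', rfl, rfl⟩
  · exact hv.unique hv'
  have hc : ∀ u : ℂ, u + q ≠ 0 → ContinuousAt (linePoint p q P) u := by
    intro u hu
    unfold linePoint
    fun_prop (disch := exact hu)
  refine HasValueAt.eq_of_eventually (a := linePoint p q P)
    (b := fun u => linePoint p q P (q * (ρ - 2) - u)) hG (hc x hx) ?_ ?_ hv hv'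
  · exact ContinuousAt.comp (f := fun u => q * (ρ - 2) - u) (hc _ hx') (by fun_prop)
  · have hne : ∀ u : ℂ, u + q ≠ 0 → ∀ᶠ y : ℂ in nhds u, y + q ≠ 0 := fun u hu =>
      ContinuousAt.eventually_ne (by fun_prop) hu
    have hrefl : Filter.Tendsto (fun u : ℂ => q * (ρ - 2) - u) (nhdsWithin x {x}ᶜ)
        (nhdsWithin (q * (ρ - 2) - x) {q * (ρ - 2) - x}ᶜ) := by
      refine tendsto_nhdsWithin_iff.2 ⟨?_, ?_⟩
      · exact (Continuous.tendsto (by fun_prop) x).mono_left nhdsWithin_le_nhds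
      · filter_upwards [self_mem_nhdsWithin] with u hu
        simpa using hu
    have hgen : ∀ u : ℂ, u + q ≠ 0 → ∀ᶠ y : ℂ in nhdsWithin u {u}ᶜ,
        y + q ≠ 0 ∧ evalAt (linePoint p q P y) G ≠ 0 := by
      intro u hu
      filter_upwards [nhdsWithin_le_nhds (hne u hu),
        (hfin P hP).subset Set.sdiff_subset |>.isClosed.isOpen_compl.mem_nhds
          (show u ∈ ({x : ℂ | x + q ≠ 0 ∧ evalAt (linePoint p q P x) G = 0} \ {u})ᶜ by simp)
          |> fun h => nhdsWithin_le_nhds h, self_mem_nhdsWithin] with y h1 h2 h3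
      refine ⟨h1, fun h4 => h2 ⟨⟨h1, h4⟩, h3⟩⟩
    filter_upwards [hgen x hx, hrefl.eventually (hgen _ hx')] with u h1 h2
    exact ⟨h1.2, h2.2, hinv P hP u h1.1 h2.1 h1.2 h2.2⟩

/-- The equation of invariance of an integral on the tangent line at `(1, 1)`. -/
theorem IsBilliardIntegral.eval_linePoint {p q : ℕ} (hp : p ≠ 0) (hq : q ≠ 0) {ρ : ℂ}
    {f g : MvPolynomial (Fin 2) ℂ}
    (h : IsBilliardIntegral p q ρ
      (algebraMap (MvPolynomial (Fin 2) ℂ) RatFun f / algebraMap _ RatFun g))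
    {x : ℂ} (hx : x + q ≠ 0) (hx' : q * (ρ - 2) - x + q ≠ 0)
    (hg : evalAt (linePoint p q (1, 1) x) g ≠ 0)
    (hg' : evalAt (linePoint p q (1, 1) (q * (ρ - 2) - x)) g ≠ 0) :
    evalAt (linePoint p q (1, 1) x) f * evalAt (linePoint p q (1, 1) (q * (ρ - 2) - x)) g =
      evalAt (linePoint p q (1, 1) (q * (ρ - 2) - x)) f * evalAt (linePoint p q (1, 1) x) g := by
  have hP : ((1, 1) : ℂ × ℂ) ∈ puncturedCurve p q := by simp [puncturedCurve]
  have h1 := h _ hP _ _ (billiardMap_linePoint hp hq ρ hP hx hx') _ _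
    (hasValueAt_div hg) (hasValueAt_div hg')
  rw [OnePoint.coe_eq_coe, div_eq_div_iff hg hg'] at h1
  exact h1

/-! ### Factorization of quasihomogeneous polynomials -/

open MvPolynomial in
/-- The polynomial `A z ^ a w ^ b ∏ (w ^ q - c z ^ p)`, where `c` runs over the multiset `S`. -/
def quasiProd (p q : ℕ) (A : ℂ) (a b : ℕ) (S : Multiset ℂ) : MvPolynomial (Fin 2) ℂ :=
  C A * X 0 ^ a * X 1 ^ b * (S.map fun c => X 1 ^ q - C c * X 0 ^ p).prod

theorem evalAt_quasiProd (p q : ℕ) (A : ℂ) (a b : ℕ) (S : Multiset ℂ) (x : ℂ × ℂ) :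
    evalAt x (quasiProd p q A a b S) =
      A * x.1 ^ a * x.2 ^ b * (S.map fun c => x.2 ^ q - c * x.1 ^ p).prod := by
  simp [evalAt, quasiProd, map_multiset_prod, Multiset.map_map]

theorem quasiProd_isWeightedHomogeneous (p q : ℕ) (A : ℂ) (a b : ℕ) (S : Multiset ℂ) :
    MvPolynomial.IsWeightedHomogeneous ![q, p] (quasiProd p q A a b S)
      (q * a + p * b + p * q * S.card) := by
  have hX0 : MvPolynomial.IsWeightedHomogeneous ![q, p] (MvPolynomial.X 0 : MvPolynomial _ ℂ) q :=
    MvPolynomial.isWeightedHomogeneous_X ℂ ![q, p] 0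
  have hX1 : MvPolynomial.IsWeightedHomogeneous ![q, p] (MvPolynomial.X 1 : MvPolynomial _ ℂ) p :=
    MvPolynomial.isWeightedHomogeneous_X ℂ ![q, p] 1
  have hS : MvPolynomial.IsWeightedHomogeneous ![q, p]
      (S.map fun c => (MvPolynomial.X 1 ^ q - MvPolynomial.C c * MvPolynomial.X 0 ^ p :
        MvPolynomial (Fin 2) ℂ)).prod (p * q * S.card) := by
    induction S using Multiset.induction_on with
    | empty => simpa using MvPolynomial.isWeightedHomogeneous_one ℂ ![q, p]
    | cons c S ih =>
      rw [Multiset.map_cons, Multiset.prod_cons, Multiset.card_cons,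
        show p * q * (S.card + 1) = p * q + p * q * S.card by ring]
      refine MvPolynomial.IsWeightedHomogeneous.mul ?_ ih
      refine MvPolynomial.IsWeightedHomogeneous.sub ?_ ?_
      · simpa [mul_comm] using hX1.pow q
      · simpa [mul_comm] using (hX0.pow p).C_mul c
  have h := (((hX0.pow a).C_mul A).mul (hX1.pow b)).mul hS
  simpa [quasiProd, mul_comm] using h

theorem eq_of_evalAt_eq {f g : MvPolynomial (Fin 2) ℂ}
    (h : ∀ x : ℂ × ℂ, x.1 ≠ 0 → evalAt x f = evalAt x g) : f = g := by
  have hX : (MvPolynomial.X 0 : MvPolynomial (Fin 2) ℂ) ≠ 0 := MvPolynomial.X_ne_zero 0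
  apply mul_left_cancel₀ hX
  apply MvPolynomial.funext
  intro x
  by_cases hx : x 0 = 0
  · simp [hx]
  · have h1 := h (x 0, x 1) hx
    have h2 : (![x 0, x 1] : Fin 2 → ℂ) = x := by
      ext i
      fin_cases i <;> rfl
    simp only [evalAt, h2] at h1
    simp [h1]

/-- Over `ℂ` a quasihomogeneous polynomial is a product of `z`, `w` and polynomials
`w ^ q - c z ^ p` with `c ≠ 0`. -/
theorem exists_eq_quasiProd {p q : ℕ} (hq : q ≠ 0) (hpq : p.Coprime q)
    {f : MvPolynomial (Fin 2) ℂ} (hf : f ≠ 0) (h : IsQuasihomogeneous p q f) :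
    ∃ (A : ℂ) (a b : ℕ) (S : Multiset ℂ), A ≠ 0 ∧ (0 : ℂ) ∉ S ∧ f = quasiProd p q A a b S := by
  obtain ⟨N, hN⟩ := h
  have hw : ∀ d ∈ f.support, q * d 0 + p * d 1 = N := by
    intro d hd
    have h1 := hN (MvPolynomial.mem_support_iff.1 hd)
    simpa [Finsupp.weight_apply, Finsupp.sum_fintype, mul_comm] using h1
  -- the monomial with the least exponent of `w`
  obtain ⟨e, he, hmin⟩ := Finset.exists_min_image f.support (fun d => d 1)
    (MvPolynomial.support_nonempty.2 hf)
  have hdiv : ∀ d ∈ f.support, d 1 = e 1 + q * ((d 1 - e 1) / q) ∧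
      d 0 + p * ((d 1 - e 1) / q) = e 0 := by
    intro d hd
    obtain ⟨u, hu⟩ := Nat.exists_eq_add_of_le (hmin d hd)
    have h1 : q * d 0 + p * u = q * e 0 := by
      have h2 := hw d hd
      have h3 := hw e he
      rw [hu] at h2
      linarith
    have h2 : q ∣ p * u := (Nat.dvd_add_right (Dvd.intro _ rfl)).1 (h1 ▸ Dvd.intro _ rfl)
    obtain ⟨t, rfl⟩ := (hpq.symm.dvd_of_dvd_mul_left h2)
    have h3 : (d 1 - e 1) / q = t := by
      rw [hu, Nat.add_sub_cancel_left, Nat.mul_div_cancel_left _ (Nat.pos_of_ne_zero hq)]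
    rw [h3]
    refine ⟨hu, Nat.eq_of_mul_eq_mul_left (Nat.pos_of_ne_zero hq) ?_⟩
    linarith
  set H : Polynomial ℂ := ∑ d ∈ f.support,
    Polynomial.C (f.coeff d) * Polynomial.X ^ ((d 1 - e 1) / q) with hH
  have hcoeff : ∀ n, H.coeff n = ∑ d ∈ f.support,
      if n = (d 1 - e 1) / q then f.coeff d else 0 := by
    intro n
    simp [hH, Polynomial.coeff_X_pow]
  have hH0 : H.coeff 0 ≠ 0 := by
    rw [hcoeff, Finset.sum_eq_single e]
    · simpa using MvPolynomial.mem_support_iff.1 he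
    · intro d hd hde
      refine if_neg fun h0 => hde ?_
      have h1 := hdiv d hd
      rw [← h0] at h1
      ext i
      fin_cases i
      · simpa using h1.2
      · simpa using h1.1
    · exact fun h => absurd he h
  have hHne : H ≠ 0 := fun h => hH0 (by rw [h, Polynomial.coeff_zero])
  have hle : p * H.natDegree ≤ e 0 := by
    have h1 : H.coeff H.natDegree ≠ 0 := Polynomial.leadingCoeff_ne_zero.2 hHne
    rw [hcoeff] at h1
    obtain ⟨d, hd, hd'⟩ := Finset.exists_ne_zero_of_sum_ne_zero h1
    have h2 : H.natDegree = (d 1 - e 1) / q := by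
      by_contra h2
      exact hd' (if_neg h2)
    rw [h2]
    exact Nat.le.intro (by rw [add_comm]; exact (hdiv d hd).2)
  refine ⟨H.leadingCoeff, e 0 - p * H.natDegree, e 1, H.roots,
    Polynomial.leadingCoeff_ne_zero.2 hHne, ?_, ?_⟩
  · rw [Polynomial.mem_roots hHne, Polynomial.IsRoot, ← Polynomial.coeff_zero_eq_eval_zero]
    exact hH0
  · apply eq_of_evalAt_eq
    intro x hx
    have hsplit := IsAlgClosed.splits H
    have hcard : H.roots.card = H.natDegree := hsplit.natDegree_eq_card_roots.symm
    have hxp : x.1 ^ p ≠ 0 := pow_ne_zero _ hx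
    have h1 : evalAt x f = x.1 ^ e 0 * x.2 ^ e 1 * H.eval (x.2 ^ q / x.1 ^ p) := by
      rw [evalAt, MvPolynomial.eval_eq', hH, Polynomial.eval_finsetSum, Finset.mul_sum]
      refine Finset.sum_congr rfl fun d hd => ?_
      obtain ⟨h1, h2⟩ := hdiv d hd
      generalize (d 1 - e 1) / q = t at h1 h2 ⊢
      simp only [Fin.prod_univ_two, Matrix.cons_val_zero, Matrix.cons_val_one,
        Polynomial.eval_mul, Polynomial.eval_C, Polynomial.eval_pow, Polynomial.eval_X]
      rw [h1, ← h2, pow_add, pow_add, pow_mul, pow_mul, div_pow]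
      field_simp
    have h2 : H.eval (x.2 ^ q / x.1 ^ p) * (x.1 ^ p) ^ H.natDegree =
        H.leadingCoeff * (H.roots.map fun c => x.2 ^ q - c * x.1 ^ p).prod := by
      have h3 : H.eval (x.2 ^ q / x.1 ^ p) =
          H.leadingCoeff * (H.roots.map fun c => x.2 ^ q / x.1 ^ p - c).prod := by
        conv_lhs => rw [hsplit.eq_prod_roots]
        simp [Polynomial.eval_multiset_prod, Multiset.map_map]
      rw [h3, mul_assoc, ← hcard, ← Multiset.prod_replicate H.roots.card (x.1 ^ p),
        ← Multiset.map_const', ← Multiset.prod_map_mul]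
      congr 3
      funext c
      field_simp
    rw [evalAt_quasiProd, h1]
    obtain ⟨r, hr⟩ := Nat.exists_eq_add_of_le hle
    rw [hr, Nat.add_sub_cancel_left, pow_add, pow_mul]
    linear_combination x.1 ^ r * x.2 ^ e 1 * h2

/-! ### Intersections of the tangent line with the curves of the pencil -/

open Polynomial in
/-- The polynomial whose roots are the coordinates of the points of intersection of a tangent line
with the curve `w ^ q = c z ^ p`, where `m = q` and `n = p - q`. -/
def fiberPoly (m n : ℕ) (c : ℂ) : ℂ[X] :=
  (X - C (n : ℂ)) ^ m * (X + C (m : ℂ)) ^ n - C c * X ^ (m + n)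

theorem eval_fiberPoly (m n : ℕ) (c x : ℂ) :
    (fiberPoly m n c).eval x = (x - n) ^ m * (x + m) ^ n - c * x ^ (m + n) := by
  simp [fiberPoly]

open Polynomial in
/-- The Wronskian of the two generators of the pencil vanishes at the points `n` and `-m` only. -/
theorem fiberPoly_wronskian (m n : ℕ) (c : ℂ) :
    X * derivative (fiberPoly (m + 1) (n + 1) c) -
        C ((m + 1 + (n + 1) : ℕ) : ℂ) * fiberPoly (m + 1) (n + 1) c =
      C (((m + 1 + (n + 1) : ℕ) : ℂ) * (m + 1 : ℕ) * (n + 1 : ℕ)) *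
        ((X - C ((n + 1 : ℕ) : ℂ)) ^ m * (X + C ((m + 1 : ℕ) : ℂ)) ^ n) := by
  have h : (m + 1 + (n + 1)) - 1 = m + n + 1 := by omega
  simp only [fiberPoly, derivative_sub, derivative_mul, derivative_pow, derivative_X, derivative_C,
    derivative_add, Nat.add_sub_cancel, h]
  simp only [C_mul, map_natCast]
  push_cast
  ring

theorem nextCoeff_wronskian (m n : ℕ) (a b : ℂ) :
    (((Polynomial.X - Polynomial.C a) ^ m * (Polynomial.X + Polynomial.C b) ^ n :
      Polynomial ℂ)).nextCoeff = n * b - m * a := by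
  rw [Polynomial.Monic.nextCoeff_mul ((Polynomial.monic_X_sub_C a).pow m)
    ((Polynomial.monic_X_add_C b).pow n), Polynomial.Monic.nextCoeff_pow
    (Polynomial.monic_X_sub_C a), Polynomial.Monic.nextCoeff_pow (Polynomial.monic_X_add_C b),
    Polynomial.nextCoeff_X_sub_C, Polynomial.nextCoeff_X_add_C]
  simp only [nsmul_eq_mul]
  ring

theorem monic_wronskian (m n : ℕ) (a b : ℂ) :
    ((Polynomial.X - Polynomial.C a) ^ m * (Polynomial.X + Polynomial.C b) ^ n :
      Polynomial ℂ).Monic :=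
  ((Polynomial.monic_X_sub_C a).pow m).mul ((Polynomial.monic_X_add_C b).pow n)

theorem natDegree_wronskian (m n : ℕ) (a b : ℂ) :
    ((Polynomial.X - Polynomial.C a) ^ m * (Polynomial.X + Polynomial.C b) ^ n :
      Polynomial ℂ).natDegree = m + n := by
  rw [((Polynomial.monic_X_sub_C a).pow m).natDegree_mul ((Polynomial.monic_X_add_C b).pow n)]
  simp [Polynomial.natDegree_pow]

open Polynomial in
theorem coeff_fiberPoly (m n : ℕ) (c : ℂ) (j : ℕ) :
    ((j : ℂ) - (m + 1 + (n + 1) : ℕ)) * (fiberPoly (m + 1) (n + 1) c).coeff j =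
      ((m + 1 + (n + 1) : ℕ) : ℂ) * (m + 1 : ℕ) * (n + 1 : ℕ) *
        ((X - C ((n + 1 : ℕ) : ℂ)) ^ m * (X + C ((m + 1 : ℕ) : ℂ)) ^ n : ℂ[X]).coeff j := by
  have h := congrArg (fun f => Polynomial.coeff f j) (fiberPoly_wronskian m n c)
  simp only [coeff_sub, coeff_C_mul] at h
  rw [← h, sub_mul]
  congr 1
  cases j with
  | zero => simp
  | succ j =>
    rw [coeff_X_mul, coeff_derivative]
    push_cast
    ring

theorem coeff_fiberPoly_top (m n : ℕ) (c : ℂ) : (fiberPoly m n c).coeff (m + n) = 1 - c := by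
  have h1 : ((Polynomial.X - Polynomial.C (n : ℂ)) ^ m * (Polynomial.X + Polynomial.C (m : ℂ)) ^ n :
      Polynomial ℂ).coeff (m + n) = 1 := by
    have h2 := (monic_wronskian m n n m).coeff_natDegree
    rwa [natDegree_wronskian] at h2
  rw [fiberPoly, Polynomial.coeff_sub, h1, Polynomial.coeff_C_mul_X_pow]
  simp

theorem natDegree_fiberPoly_le (m n : ℕ) (c : ℂ) : (fiberPoly m n c).natDegree ≤ m + n := by
  rw [fiberPoly]
  refine (Polynomial.natDegree_sub_le _ _).trans (max_le (natDegree_wronskian _ _ _ _).le ?_)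
  exact Polynomial.natDegree_C_mul_X_pow_le _ _

/-- Coefficients of `fiberPoly` below the leading one do not depend on `c`. The first vanishes. -/
theorem coeff_fiberPoly_sub_one (m n : ℕ) (c : ℂ) :
    (fiberPoly (m + 1) (n + 1) c).coeff (m + n + 1) = 0 := by
  have h := coeff_fiberPoly m n c (m + n + 1)
  rw [Polynomial.coeff_eq_zero_of_natDegree_lt (p := _ * _)
    (by rw [natDegree_wronskian]; omega), mul_zero, mul_eq_zero] at h
  refine h.resolve_left fun h1 => ?_
  push_cast at h1
  have h2 : (-1 : ℂ) = 0 := by linear_combination h1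
  norm_num at h2

theorem coeff_fiberPoly_sub_two (m n : ℕ) (c : ℂ) :
    (fiberPoly (m + 1) (n + 1) c).coeff (m + n) =
      -((m + 1 + (n + 1) : ℕ) : ℂ) * (m + 1 : ℕ) * (n + 1 : ℕ) / 2 := by
  have h := coeff_fiberPoly m n c (m + n)
  have h2 := (monic_wronskian m n ((n + 1 : ℕ) : ℂ) ((m + 1 : ℕ) : ℂ)).coeff_natDegree
  rw [natDegree_wronskian] at h2
  rw [h2] at h
  push_cast at h ⊢
  linear_combination (-1 / 2 : ℂ) * h

theorem coeff_fiberPoly_sub_three (m n : ℕ) (c : ℂ) (h0 : 0 < m + n) :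
    (fiberPoly (m + 1) (n + 1) c).coeff (m + n - 1) =
      -((m + 1 + (n + 1) : ℕ) : ℂ) * (m + 1 : ℕ) * (n + 1 : ℕ) * ((n : ℂ) - m) / 3 := by
  have h := coeff_fiberPoly m n c (m + n - 1)
  have h2 := nextCoeff_wronskian m n ((n + 1 : ℕ) : ℂ) ((m + 1 : ℕ) : ℂ)
  rw [Polynomial.nextCoeff_of_natDegree_pos (by rw [natDegree_wronskian]; exact h0),
    natDegree_wronskian] at h2
  rw [h2, Nat.cast_sub (by omega)] at h
  push_cast at h ⊢
  linear_combination (-1 / 3 : ℂ) * h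

theorem fiberPoly_ne_zero (m n : ℕ) (hm : m ≠ 0) (hn : n ≠ 0) (c : ℂ) : fiberPoly m n c ≠ 0 := by
  intro h
  have h1 := eval_fiberPoly m n c 0
  simp [h, hm, hn] at h1

theorem fiberPoly_root_ne {m n : ℕ} (hm : m ≠ 0) (hn : n ≠ 0) {c : ℂ} (hc : c ≠ 0) {x : ℂ}
    (hx : x ∈ (fiberPoly m n c).roots) : x ≠ 0 ∧ x ≠ n ∧ x ≠ -m := by
  have h := Polynomial.isRoot_of_mem_roots hx
  rw [Polynomial.IsRoot, eval_fiberPoly] at h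
  refine ⟨?_, ?_, ?_⟩ <;> rintro rfl <;> simp [hm, hn, hc] at h

theorem nodup_roots_fiberPoly {m n : ℕ} (hm : m ≠ 0) (hn : n ≠ 0) {c : ℂ} (hc : c ≠ 0) :
    (fiberPoly m n c).roots.Nodup := by
  rw [Multiset.nodup_iff_count_le_one]
  intro x
  rw [Polynomial.count_roots]
  by_contra! h
  rw [Polynomial.one_lt_rootMultiplicity_iff_isRoot (fiberPoly_ne_zero m n hm hn c)] at h
  obtain ⟨-, h2, h3⟩ := fiberPoly_root_ne hm hn hc
    ((Polynomial.mem_roots (fiberPoly_ne_zero m n hm hn c)).2 h.1)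
  obtain ⟨m, rfl⟩ := Nat.exists_eq_succ_of_ne_zero hm
  obtain ⟨n, rfl⟩ := Nat.exists_eq_succ_of_ne_zero hn
  have h4 := congrArg (Polynomial.eval x) (fiberPoly_wronskian m n c)
  have h5 : (fiberPoly (m + 1) (n + 1) c).eval x = 0 := h.1
  have h6 : (Polynomial.derivative (fiberPoly (m + 1) (n + 1) c)).eval x = 0 := h.2
  rw [Polynomial.eval_sub, Polynomial.eval_mul, Polynomial.eval_mul, h5, h6] at h4
  simp only [mul_zero, sub_zero, Polynomial.eval_mul, Polynomial.eval_pow, Polynomial.eval_sub,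
    Polynomial.eval_add, Polynomial.eval_X, Polynomial.eval_C] at h4
  have h7 : x + ((m + 1 : ℕ) : ℂ) ≠ 0 := fun h => h3 (eq_neg_of_add_eq_zero_left h)
  have h8 : x - ((n + 1 : ℕ) : ℂ) ≠ 0 := sub_ne_zero.2 h2
  refine absurd h4.symm (mul_ne_zero (mul_ne_zero (mul_ne_zero ?_ ?_) ?_)
    (mul_ne_zero (pow_ne_zero _ h8) (pow_ne_zero _ h7))) <;>
  exact Nat.cast_ne_zero.2 (by omega)

/-- For `c ≠ 1` a tangent line intersects `w ^ q = c z ^ p` at `p` points with zero sum of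
coordinates. -/
theorem roots_fiberPoly {m n : ℕ} (hm : m ≠ 0) (hn : n ≠ 0) {c : ℂ} (hc : c ≠ 1) :
    (fiberPoly m n c).roots.card = m + n ∧ (fiberPoly m n c).roots.sum = 0 := by
  have hd : (fiberPoly m n c).natDegree = m + n :=
    Polynomial.natDegree_eq_of_le_of_coeff_ne_zero (natDegree_fiberPoly_le m n c)
      (by rw [coeff_fiberPoly_top]; exact sub_ne_zero.2 hc.symm)
  have hs := IsAlgClosed.splits (fiberPoly m n c)
  refine ⟨by rw [← hs.natDegree_eq_card_roots, hd], ?_⟩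
  have h := hs.nextCoeff_eq_neg_sum_roots_mul_leadingCoeff
  have hl : (fiberPoly m n c).leadingCoeff ≠ 0 :=
    Polynomial.leadingCoeff_ne_zero.2 (fiberPoly_ne_zero m n hm hn c)
  obtain ⟨m, rfl⟩ := Nat.exists_eq_succ_of_ne_zero hm
  obtain ⟨n, rfl⟩ := Nat.exists_eq_succ_of_ne_zero hn
  rw [Polynomial.nextCoeff_of_natDegree_pos (by omega), hd,
    show m.succ + n.succ - 1 = m + n + 1 by omega, coeff_fiberPoly_sub_one] at h
  simpa [hl] using h

/-- A tangent line of the curve `w ^ q = z ^ p` meets it at `p - 2` further points, with the sum of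
coordinates `2 (m - n) / 3`. -/
theorem roots_fiberPoly_one {m n : ℕ} (hm : m ≠ 0) (hn : n ≠ 0) :
    (fiberPoly m n 1).roots.card = m + n - 2 ∧
      (fiberPoly m n 1).roots.sum = 2 / 3 * ((m : ℂ) - n) := by
  obtain ⟨m, rfl⟩ := Nat.exists_eq_succ_of_ne_zero hm
  obtain ⟨n, rfl⟩ := Nat.exists_eq_succ_of_ne_zero hn
  have hK : ((m + 1 + (n + 1) : ℕ) : ℂ) * (m + 1 : ℕ) * (n + 1 : ℕ) ≠ 0 :=
    mul_ne_zero (mul_ne_zero (Nat.cast_ne_zero.2 (by omega)) (Nat.cast_ne_zero.2 (by omega)))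
      (Nat.cast_ne_zero.2 (by omega))
  have hd : (fiberPoly (m + 1) (n + 1) 1).natDegree = m + n := by
    refine Polynomial.natDegree_eq_of_le_of_coeff_ne_zero ?_ ?_
    · rw [Polynomial.natDegree_le_iff_coeff_eq_zero]
      intro N hN
      rcases Nat.lt_or_ge (m + 1 + (n + 1)) N with h | h
      · exact Polynomial.coeff_eq_zero_of_natDegree_lt
          ((natDegree_fiberPoly_le (m + 1) (n + 1) 1).trans_lt h)
      · obtain rfl | rfl : N = m + 1 + (n + 1) ∨ N = m + n + 1 := by omega
        · rw [coeff_fiberPoly_top, sub_self]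
        · exact coeff_fiberPoly_sub_one m n 1
    · rw [coeff_fiberPoly_sub_two]
      intro h
      apply hK
      linear_combination -2 * h
  have hs := IsAlgClosed.splits (fiberPoly (m + 1) (n + 1) 1)
  have hcard := hs.natDegree_eq_card_roots
  refine ⟨by rw [← hcard, hd]; omega, ?_⟩
  rcases Nat.eq_zero_or_pos (m + n) with h0 | h0
  · have h1 : (fiberPoly (m + 1) (n + 1) 1).roots = 0 := by
      rw [← Multiset.card_eq_zero, ← hcard, hd, h0]
    obtain ⟨rfl, rfl⟩ : m = 0 ∧ n = 0 := by omega
    simp [h1]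
  · have h := hs.nextCoeff_eq_neg_sum_roots_mul_leadingCoeff
    rw [Polynomial.nextCoeff_of_natDegree_pos (by omega), Polynomial.leadingCoeff, hd,
      coeff_fiberPoly_sub_three m n 1 h0, coeff_fiberPoly_sub_two] at h
    apply mul_left_cancel₀ hK
    push_cast at h ⊢
    linear_combination -2 * h

/-- Every point of a tangent line outside of three special points lies on one curve of the
pencil. -/
theorem mem_roots_fiberPoly {m n : ℕ} (hm : m ≠ 0) (hn : n ≠ 0) {c x : ℂ} (hx : x ≠ 0) :
    x ∈ (fiberPoly m n c).roots ↔ c = (x - n) ^ m * (x + m) ^ n / x ^ (m + n) := by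
  rw [Polynomial.mem_roots (fiberPoly_ne_zero m n hm hn c), Polynomial.IsRoot, eval_fiberPoly,
    eq_div_iff (pow_ne_zero _ hx), sub_eq_zero, eq_comm]

/-! ### Orders of an integral along a tangent line -/

/-- The orders `ord x` at the points `x ∈ ℂ` of a rational function on a tangent line, when the
function is the restriction of `z ^ a w ^ b ∏ (w ^ q - c z ^ p) ^ (M c)` and is invariant under the
reflection `x ↦ k - x`. The exponents `a`, `b` are `ord 0` and `ord n`, and `degree` says that the
order at infinity is `2 M 1`. -/
structure IsInvariantOrder (m n : ℕ) (k : ℂ) (M : ℂ →₀ ℤ) (ord : ℂ → ℤ) : Prop where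
  map_zero : M 0 = 0
  fiber : ∀ c ≠ 0, ∀ x ∈ (fiberPoly m n c).roots, ord x = M c
  reflect : ∀ x, ord (k - x) = ord x
  degree : ord 0 + ord n + ord (-m) + (m + n) * (M.sum fun _ v => v) = 0

/-- The finite set of the points of order `v ≠ 0`. -/
def levelSet (m n : ℕ) (M : ℂ →₀ ℤ) (ord : ℂ → ℤ) (v : ℤ) : Finset ℂ :=
  ({0, (n : ℂ), -(m : ℂ)} : Finset ℂ).filter (fun x => ord x = v) ∪
    (M.support.filter fun c => M c = v).biUnion fun c => (fiberPoly m n c).roots.toFinset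

section

variable {m n : ℕ} {k : ℂ} {M : ℂ →₀ ℤ} {ord : ℂ → ℤ}

theorem IsInvariantOrder.mem_levelSet (h : IsInvariantOrder m n k M ord) (hm : m ≠ 0) (hn : n ≠ 0)
    {v : ℤ} (hv : v ≠ 0) (x : ℂ) : x ∈ levelSet m n M ord v ↔ ord x = v := by
  simp only [levelSet, Finset.mem_union, Finset.mem_filter, Finset.mem_insert,
    Finset.mem_singleton, Finset.mem_biUnion, Finsupp.mem_support_iff, Multiset.mem_toFinset]
  constructor
  · rintro (⟨-, h1⟩ | ⟨c, ⟨h1, h2⟩, h3⟩)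
    · exact h1
    · rw [h.fiber c (fun h0 => h1 (h0 ▸ h.map_zero)) x h3, h2]
  · intro hx
    by_cases hs : x = 0 ∨ x = n ∨ x = -m
    · exact Or.inl ⟨hs, hx⟩
    · right
      push Not at hs
      have hc : (x - n) ^ m * (x + m) ^ n / x ^ (m + n) ≠ 0 := by
        refine div_ne_zero (mul_ne_zero (pow_ne_zero _ (sub_ne_zero.2 hs.2.1))
          (pow_ne_zero _ fun h0 => hs.2.2 (eq_neg_of_add_eq_zero_left h0))) (pow_ne_zero _ hs.1)
      have hr := (mem_roots_fiberPoly hm hn hs.1).2 rfl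
      have hM := h.fiber _ hc x hr
      exact ⟨_, ⟨by rw [← hM, hx]; exact hv, by rw [← hM, hx]⟩, hr⟩

theorem IsInvariantOrder.ne_zero_of_mem (h : IsInvariantOrder m n k M ord) {c : ℂ}
    (hc : c ∈ M.support) : c ≠ 0 :=
  fun h0 => (Finsupp.mem_support_iff.1 hc) (h0 ▸ h.map_zero)

theorem IsInvariantOrder.sum_levelSet (h : IsInvariantOrder m n k M ord) (hm : m ≠ 0) (hn : n ≠ 0)
    (v : ℤ) (f : ℂ → ℂ) :
    ∑ x ∈ levelSet m n M ord v, f x =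
      (if ord 0 = v then f 0 else 0) + (if ord n = v then f n else 0) +
      (if ord (-m) = v then f (-m) else 0) +
      ∑ c ∈ M.support.filter (fun c => M c = v), ((fiberPoly m n c).roots.map f).sum := by
  have hn' : (n : ℂ) ≠ 0 := Nat.cast_ne_zero.2 hn
  have hmn : (n : ℂ) ≠ -m := by
    intro h1
    have h2 : ((n + m : ℕ) : ℂ) = 0 := by
      push_cast
      linear_combination h1
    rw [Nat.cast_eq_zero] at h2
    omega
  rw [levelSet, Finset.sum_union, Finset.sum_biUnion, Finset.sum_filter, Finset.sum_insert,
    Finset.sum_insert, Finset.sum_singleton]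
  · congr 1
    · ring
    · refine Finset.sum_congr rfl fun c hc => ?_
      have hc0 := h.ne_zero_of_mem (Finset.mem_filter.1 hc).1
      rw [Finset.sum, Multiset.toFinset_val, (nodup_roots_fiberPoly hm hn hc0).dedup]
  · simpa using hmn
  · simpa using ⟨hn'.symm, hm⟩
  · intro c hc c' hc' hcc
    rw [Function.onFun, Finset.disjoint_left]
    intro x hx hx'
    rw [Multiset.mem_toFinset] at hx hx'
    have hx0 := (fiberPoly_root_ne hm hn
      (h.ne_zero_of_mem (Finset.mem_filter.1 (Finset.mem_coe.1 hc)).1) hx).1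
    rw [mem_roots_fiberPoly hm hn hx0] at hx hx'
    exact hcc (hx.trans hx'.symm)
  · rw [Finset.disjoint_left]
    intro x hx hx'
    simp only [Finset.mem_filter, Finset.mem_insert, Finset.mem_singleton] at hx
    obtain ⟨c, hc, hx'⟩ := Finset.mem_biUnion.1 hx'
    have h1 := fiberPoly_root_ne hm hn
      (h.ne_zero_of_mem (Finset.mem_filter.1 hc).1) (Multiset.mem_toFinset.1 hx')
    rcases hx.1 with h2 | h2 | h2
    · exact h1.1 h2
    · exact h1.2.1 h2
    · exact h1.2.2 h2

theorem IsInvariantOrder.card_levelSet (h : IsInvariantOrder m n k M ord) (hm : m ≠ 0)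
    (hn : n ≠ 0) {v : ℤ} (hv : v ≠ 0) :
    ((levelSet m n M ord v).card : ℤ) =
      (if ord 0 = v then 1 else 0) + (if ord n = v then 1 else 0) +
      (if ord (-m) = v then 1 else 0) +
      (m + n) * ((M.support.filter fun c => M c = v).card : ℤ) - (if M 1 = v then 2 else 0) := by
  have h1 := h.sum_levelSet hm hn v fun _ => 1
  have h2 : ∀ c : ℂ, (((fiberPoly m n c).roots.map fun _ => (1 : ℂ)).sum) =
      (m + n) - if c = 1 then 2 else 0 := by
    intro c
    rw [Multiset.map_const', Multiset.sum_replicate, nsmul_eq_mul, mul_one]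
    split_ifs with hc
    · rw [hc, (roots_fiberPoly_one hm hn).1, Nat.cast_sub (by omega)]
      push_cast
      ring
    · rw [(roots_fiberPoly hm hn hc).1]
      push_cast
      ring
  have h3 : (∑ c ∈ M.support.filter (fun c => M c = v), if c = 1 then (2 : ℂ) else 0) =
      if M 1 = v then 2 else 0 := by
    rw [Finset.sum_ite_eq']
    congr 1
    simp only [Finset.mem_filter, Finsupp.mem_support_iff, eq_iff_iff]
    exact ⟨fun h => h.2, fun h => ⟨by rw [h]; exact hv, h⟩⟩
  simp only [h2, Finset.sum_sub_distrib, h3, Finset.sum_const, nsmul_eq_mul, mul_one] at h1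
  have h4 : ((levelSet m n M ord v).card : ℂ) = ((((if ord 0 = v then 1 else 0) +
      (if ord n = v then 1 else 0) + (if ord (-m) = v then 1 else 0) +
      (m + n) * ((M.support.filter fun c => M c = v).card : ℤ) -
        (if M 1 = v then 2 else 0) : ℤ)) : ℂ) := by
    rw [h1]
    push_cast
    ring
  exact_mod_cast h4

/-- The centre of symmetry of a set of points of equal order is `k / 2`. -/
theorem IsInvariantOrder.mul_card_levelSet (h : IsInvariantOrder m n k M ord) (hm : m ≠ 0)
    (hn : n ≠ 0) {v : ℤ} (hv : v ≠ 0) :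
    3 * k * ((levelSet m n M ord v).card : ℂ) =
      2 * (((3 * ((if ord n = v then 1 else 0) * (n : ℤ) -
          (if ord (-m) = v then 1 else 0) * (m : ℤ)) +
        (if M 1 = v then 2 * ((m : ℤ) - n) else 0) : ℤ)) : ℂ) := by
  have h1 := h.sum_levelSet hm hn v id
  have h2 : ∀ c : ℂ, (((fiberPoly m n c).roots.map id).sum) =
      if c = 1 then 2 / 3 * ((m : ℂ) - n) else 0 := by
    intro c
    rw [Multiset.map_id]
    split_ifs with hc
    · rw [hc, (roots_fiberPoly_one hm hn).2]
    · rw [(roots_fiberPoly hm hn hc).2]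
  have h3 : (∑ c ∈ M.support.filter (fun c => M c = v),
      if c = 1 then 2 / 3 * ((m : ℂ) - n) else 0) =
      if M 1 = v then 2 / 3 * ((m : ℂ) - n) else 0 := by
    rw [Finset.sum_ite_eq']
    congr 1
    simp only [Finset.mem_filter, Finsupp.mem_support_iff, eq_iff_iff]
    exact ⟨fun h => h.2, fun h => ⟨by rw [h]; exact hv, h⟩⟩
  rw [Finset.sum_congr rfl fun c _ => h2 c, h3] at h1
  simp only [id] at h1
  have h4 : ∑ x ∈ levelSet m n M ord v, x = ∑ x ∈ levelSet m n M ord v, (k - x) := by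
    refine Finset.sum_bij' (fun x _ => k - x) (fun x _ => k - x) ?_ ?_ ?_ ?_ ?_
    · intro x hx
      rw [h.mem_levelSet hm hn hv] at hx ⊢
      rw [h.reflect, hx]
    · intro x hx
      rw [h.mem_levelSet hm hn hv] at hx ⊢
      rw [h.reflect, hx]
    all_goals
      intro x _
      ring
  rw [Finset.sum_sub_distrib, Finset.sum_const, nsmul_eq_mul] at h4
  have h5 : 3 * k * ((levelSet m n M ord v).card : ℂ) =
      6 * ∑ x ∈ levelSet m n M ord v, x := by linear_combination -3 * h4
  rw [h5, h1]
  push_cast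
  split_ifs <;> ring

/-- The order cannot take a single nonzero value `v`, if `M 1` is `0` or `v`. -/
theorem IsInvariantOrder.exists_ord_ne (h : IsInvariantOrder m n k M ord) (hm : m ≠ 0) (hn : n ≠ 0)
    {v : ℤ} (hv : v ≠ 0) (h1 : M 1 = 0 ∨ M 1 = v) {x : ℂ} (hx : ord x = v) :
    ∃ y, ord y ≠ 0 ∧ ord y ≠ v := by
  by_contra! hall
  have hcard := h.card_levelSet hm hn hv
  have hpos : 0 < (levelSet m n M ord v).card :=
    Finset.card_pos.2 ⟨x, (h.mem_levelSet hm hn hv x).2 hx⟩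
  have hM : ∀ c ∈ M.support, M c = v := by
    intro c hc
    by_cases hc1 : c = 1
    · rw [hc1] at hc ⊢
      exact h1.resolve_left (Finsupp.mem_support_iff.1 hc)
    · have h2 : 0 < (fiberPoly m n c).roots.card := by
        rw [(roots_fiberPoly hm hn hc1).1]
        omega
      obtain ⟨y, hy⟩ := Multiset.card_pos_iff_exists_mem.1 h2
      rw [← h.fiber c (h.ne_zero_of_mem hc) y hy]
      refine hall y ?_
      rw [h.fiber c (h.ne_zero_of_mem hc) y hy]
      exact Finsupp.mem_support_iff.1 hc
  have hord : ∀ y, ord y = v * if ord y = v then 1 else 0 := by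
    intro y
    split_ifs with hy
    · rw [hy, mul_one]
    · rw [mul_zero]
      by_contra h0
      exact hy (hall y h0)
  have hsum : (M.sum fun _ v => v) = v * (M.support.filter fun c => M c = v).card := by
    rw [Finset.filter_true_of_mem hM, Finsupp.sum, Finset.sum_congr rfl hM, Finset.sum_const,
      nsmul_eq_mul, mul_comm]
  have hdeg := h.degree
  rw [hsum, hord 0, hord n, hord (-m)] at hdeg
  have h2 : v * ((levelSet m n M ord v).card + if M 1 = v then 2 else 0) = 0 := by
    rw [hcard]
    linear_combination hdeg
  rcases mul_eq_zero.1 h2 with h3 | h3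
  · exact hv h3
  · split_ifs at h3 <;> omega

end

theorem ite_eq_zero_or_one (P : Prop) [Decidable P] :
    (if P then (1 : ℤ) else 0) = 0 ∨ (if P then (1 : ℤ) else 0) = 1 := by
  split_ifs <;> simp

theorem ite_add_ite_le_one {a b : ℤ} (hab : a ≠ b) (u : ℤ) :
    (if u = a then (1 : ℤ) else 0) + (if u = b then 1 else 0) ≤ 1 := by
  split_ifs <;> omega

/-- The arithmetic that excludes the level of the curve `w ^ q = z ^ p` itself. The sums of
coordinates on two levels are compared; `b₀`, `b₁`, `b₂` (`d₀`, `d₁`, `d₂`) tell which of the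
special points `0`, `n`, `-m` lie on the one (on the other) level. -/
theorem centroid_contradiction {m n : ℤ} (hm : 0 < m) (hn : 0 < n) (hmn : IsCoprime m n)
    (h3 : 3 ≤ m + n) {s t N N' b₀ b₁ b₂ d₀ d₁ d₂ : ℤ} (hb₀ : b₀ = 0 ∨ b₀ = 1)
    (hb₁ : b₁ = 0 ∨ b₁ = 1) (hb₂ : b₂ = 0 ∨ b₂ = 1) (hd₀ : d₀ = 0 ∨ d₀ = 1)
    (hd₁ : d₁ = 0 ∨ d₁ = 1) (hd₂ : d₂ = 0 ∨ d₂ = 1) (h₀ : b₀ + d₀ ≤ 1) (h₁ : b₁ + d₁ ≤ 1)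
    (h₂ : b₂ + d₂ ≤ 1) (hN : N = d₀ + d₁ + d₂ + (m + n) * s - 2)
    (hN' : N' = b₀ + b₁ + b₂ + (m + n) * t) (hNpos : 0 < N) (hNpos' : 0 < N')
    (h : N * (3 * (b₁ * n - b₂ * m)) = N' * (3 * (d₁ * n - d₂ * m) + 2 * (m - n))) : False := by
  have hne : m - n ≠ 0 := by
    intro h0
    obtain rfl : m = n := by omega
    rcases Int.isUnit_iff.1 (isCoprime_self.1 hmn) with h1 | h1 <;> omega
  have hpn : IsCoprime (m + n) n := by simpa using hmn.add_mul_right_left 1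
  have hpm : IsCoprime (m + n) m := by
    have := hmn.symm.add_mul_right_left 1
    rwa [one_mul, add_comm] at this
  have hsmall : ∀ u : ℤ, (m + n) ∣ u → u ≠ 0 → -2 ≤ u → u ≤ 2 → False := by
    intro u hu h0 h1 h2
    have h4 := Int.le_of_dvd (abs_pos.2 h0) ((dvd_abs _ _).2 hu)
    have h5 : |u| ≤ 2 := abs_le.2 ⟨h1, h2⟩
    omega
  have hmod : ¬ (m + n) ∣ 3 * (d₀ - 2) + 4 * (1 + b₀) := by
    intro hdvd
    clear h hN hN' hpn hpm
    refine hsmall _ hdvd ?_ ?_ ?_ <;> rcases hb₀ with rfl | rfl <;>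
      rcases hd₀ with rfl | rfl <;> omega
  have hzero : 3 * (d₁ * n - d₂ * m) + 2 * (m - n) ≠ 0 := by
    clear h hN hN'
    rcases hd₁ with rfl | rfl <;> rcases hd₂ with rfl | rfl <;> omega
  rcases hb₁ with rfl | rfl <;> rcases hb₂ with rfl | rfl
  · rw [zero_mul, zero_mul, sub_zero, mul_zero, mul_zero] at h
    exact mul_ne_zero hNpos'.ne' hzero h.symm
  · obtain rfl : d₂ = 0 := by omega
    rcases hd₁ with rfl | rfl
    · -- the equation is a congruence modulo `m + n`
      refine hmod (hpm.dvd_of_dvd_mul_left ⟨2 * (1 + b₀ + (m + n) * t) - 4 * t * m - 3 * m * s, ?_⟩)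
      rw [hN, hN'] at h
      linear_combination -h
    · have h4 : 0 < N * m := mul_pos hNpos hm
      have h5 : 0 < N' * (2 * m + n) := mul_pos hNpos' (by omega)
      linarith
  · obtain rfl : d₁ = 0 := by omega
    rcases hd₂ with rfl | rfl
    · refine hmod (hpn.dvd_of_dvd_mul_left ⟨2 * (1 + b₀ + (m + n) * t) - 4 * t * n - 3 * n * s, ?_⟩)
      rw [hN, hN'] at h
      linear_combination h
    · have h4 : 0 < N * n := mul_pos hNpos hn
      have h5 : 0 < N' * (2 * n + m) := mul_pos hNpos' (by omega)
      linarith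
  · obtain rfl : d₁ = 0 := by omega
    obtain rfl : d₂ = 0 := by omega
    have h4 : (m - n) * (3 * N + 2 * N') = 0 := by linear_combination -h
    rcases mul_eq_zero.1 h4 with h5 | h5
    · exact hne h5
    · omega

/-- Two disjoint levels cannot have proportional sums of coordinates, if one of them contains `n` or
`-m` and both have no points on the curve `w ^ q = z ^ p`. -/
theorem centroid_contradiction' {m n : ℤ} (hm : 0 < m) (hn : 0 < n) (hmn : m ≠ n)
    {N N' b₁ b₂ d₁ d₂ : ℤ}
    (hb₁ : b₁ = 0 ∨ b₁ = 1) (hb₂ : b₂ = 0 ∨ b₂ = 1)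
    (hd₁ : d₁ = 0 ∨ d₁ = 1) (hd₂ : d₂ = 0 ∨ d₂ = 1) (h₁ : b₁ + d₁ ≤ 1)
    (h₂ : b₂ + d₂ ≤ 1) (hd : d₁ = 1 ∨ d₂ = 1) (hNpos : 0 < N) (hNpos' : 0 < N')
    (h : N * (b₁ * n - b₂ * m) = N' * (d₁ * n - d₂ * m)) : False := by
  have h3 : 0 < N * n := mul_pos hNpos hn
  have h4 : 0 < N * m := mul_pos hNpos hm
  have h5 : 0 < N' * n := mul_pos hNpos' hn
  have h6 : 0 < N' * m := mul_pos hNpos' hm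
  have h7 : N' * (n - m) ≠ 0 := mul_ne_zero hNpos'.ne' (sub_ne_zero.2 hmn.symm)
  rcases hb₁ with rfl | rfl <;> rcases hb₂ with rfl | rfl <;> rcases hd₁ with rfl | rfl <;>
    rcases hd₂ with rfl | rfl <;> first | (simp at hd; done) | linarith | exact h7 (by linarith)

section

variable {m n : ℕ} {k : ℂ} {M : ℂ →₀ ℤ} {ord : ℂ → ℤ}

theorem IsInvariantOrder.card_mul_eq (h : IsInvariantOrder m n k M ord) (hm : m ≠ 0)
    (hn : n ≠ 0) {v u : ℤ} (hv : v ≠ 0) (hu : u ≠ 0) :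
    ((levelSet m n M ord v).card : ℤ) *
        (3 * ((if ord n = u then 1 else 0) * (n : ℤ) - (if ord (-m) = u then 1 else 0) * (m : ℤ)) +
          (if M 1 = u then 2 * ((m : ℤ) - n) else 0)) =
      ((levelSet m n M ord u).card : ℤ) *
        (3 * ((if ord n = v then 1 else 0) * (n : ℤ) - (if ord (-m) = v then 1 else 0) * (m : ℤ)) +
          (if M 1 = v then 2 * ((m : ℤ) - n) else 0)) := by
  have h1 := h.mul_card_levelSet hm hn hv
  have h2 := h.mul_card_levelSet hm hn hu
  generalize (3 * ((if ord n = v then 1 else 0) * (n : ℤ) -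
          (if ord (-m) = v then 1 else 0) * (m : ℤ)) +
          (if M 1 = v then 2 * ((m : ℤ) - n) else 0)) = A at *
  generalize (3 * ((if ord n = u then 1 else 0) * (n : ℤ) -
          (if ord (-m) = u then 1 else 0) * (m : ℤ)) +
          (if M 1 = u then 2 * ((m : ℤ) - n) else 0)) = B at *
  generalize (levelSet m n M ord v).card = a at *
  generalize (levelSet m n M ord u).card = b at *
  have h3 : (((a : ℤ) * B : ℤ) : ℂ) = ((b : ℤ) * A : ℤ) := by
    push_cast
    linear_combination (b / 2 : ℂ) * h1 - (a / 2 : ℂ) * h2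
  exact_mod_cast h3

/-- An invariant function has order zero along the curve `w ^ q = z ^ p` if `p ≥ 3`: otherwise
`M 1` and some other nonzero value are taken, and the centres of symmetry of the two levels are
different. -/
theorem IsInvariantOrder.map_one_eq_zero (h : IsInvariantOrder m n k M ord) (hm : m ≠ 0)
    (hn : n ≠ 0) (hmn : m.Coprime n) (h3 : 3 ≤ m + n) : M 1 = 0 := by
  by_contra h1
  have hcard : ∀ {x : ℂ} {v : ℤ}, v ≠ 0 → ord x = v → 0 < ((levelSet m n M ord v).card : ℤ) := by
    intro x v hv hx
    exact_mod_cast Finset.card_pos.2 ⟨x, (h.mem_levelSet hm hn hv x).2 hx⟩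
  have h4 : 0 < (fiberPoly m n 1).roots.card := by
    rw [(roots_fiberPoly_one hm hn).1]
    omega
  obtain ⟨x, hx⟩ := Multiset.card_pos_iff_exists_mem.1 h4
  have hx1 := h.fiber 1 one_ne_zero x hx
  obtain ⟨y, hy0, hy1⟩ := h.exists_ord_ne hm hn h1 (Or.inr rfl) hx1
  have e1 := h.card_levelSet hm hn h1
  have e2 := h.card_levelSet hm hn hy0
  have e3 := h.card_mul_eq hm hn h1 hy0
  rw [if_pos rfl] at e1
  rw [if_neg (Ne.symm hy1), sub_zero] at e2
  rw [if_neg (Ne.symm hy1), if_pos rfl, add_zero] at e3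
  have hm' : (0 : ℤ) < m := Int.natCast_pos.2 (Nat.pos_of_ne_zero hm)
  have hn' : (0 : ℤ) < n := Int.natCast_pos.2 (Nat.pos_of_ne_zero hn)
  exact centroid_contradiction hm' hn' (Nat.isCoprime_iff_coprime.2 hmn) (by exact_mod_cast h3)
    (ite_eq_zero_or_one _) (ite_eq_zero_or_one _) (ite_eq_zero_or_one _)
    (ite_eq_zero_or_one _) (ite_eq_zero_or_one _) (ite_eq_zero_or_one _)
    (ite_add_ite_le_one hy1 _) (ite_add_ite_le_one hy1 _) (ite_add_ite_le_one hy1 _) e1 e2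
    (hcard h1 hx1) (hcard hy0 rfl) e3

/-- If the order along the curve is zero, the points `n` and `-m` have order zero: the sum of
coordinates on a level can be nonzero only because of them, and all the levels have one and the
same centre. -/
theorem IsInvariantOrder.ord_eq_zero (h : IsInvariantOrder m n k M ord) (hm : m ≠ 0)
    (hn : n ≠ 0) (hmn : m ≠ n) (h1 : M 1 = 0) : ord n = 0 ∧ ord (-m) = 0 := by
  have hcard : ∀ {x : ℂ} {v : ℤ}, v ≠ 0 → ord x = v → 0 < ((levelSet m n M ord v).card : ℤ) := by
    intro x v hv hx
    exact_mod_cast Finset.card_pos.2 ⟨x, (h.mem_levelSet hm hn hv x).2 hx⟩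
  have key : ∀ x : ℂ, x = n ∨ x = -m → ord x = 0 := by
    intro x hx
    by_contra hx0
    obtain ⟨y, hy0, hy1⟩ := h.exists_ord_ne hm hn hx0 (Or.inl h1) rfl
    have e3 := h.card_mul_eq hm hn hx0 hy0
    rw [h1, if_neg (Ne.symm hx0), if_neg (Ne.symm hy0), add_zero, add_zero, mul_left_comm,
      mul_left_comm (_ : ℤ) 3] at e3
    have hm' : (0 : ℤ) < m := Int.natCast_pos.2 (Nat.pos_of_ne_zero hm)
    have hn' : (0 : ℤ) < n := Int.natCast_pos.2 (Nat.pos_of_ne_zero hn)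
    refine centroid_contradiction' hm' hn' (by exact_mod_cast hmn)
      (ite_eq_zero_or_one _) (ite_eq_zero_or_one _) (ite_eq_zero_or_one _) (ite_eq_zero_or_one _)
      (ite_add_ite_le_one hy1 _) (ite_add_ite_le_one hy1 _) ?_ (hcard hx0 rfl) (hcard hy0 rfl)
      (mul_left_cancel₀ three_ne_zero e3)
    rcases hx with rfl | rfl
    · left
      simp
    · right
      simp
  exact ⟨key _ (Or.inl rfl), key _ (Or.inr rfl)⟩

end

/-! ### From invariant functions to invariant orders -/

/-- The function `f / g` on the tangent line at `(1, 1)` of the `(m + n, m)`-curve is invariant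
under the reflection `x ↦ k - x`. -/
def IsLineInvariant (m n : ℕ) (k : ℂ) (f g : MvPolynomial (Fin 2) ℂ) : Prop :=
  ∀ x : ℂ, x + m ≠ 0 → k - x + m ≠ 0 →
    evalAt (linePoint (m + n) m (1, 1) x) g ≠ 0 →
    evalAt (linePoint (m + n) m (1, 1) (k - x)) g ≠ 0 →
    evalAt (linePoint (m + n) m (1, 1) x) f * evalAt (linePoint (m + n) m (1, 1) (k - x)) g =
      evalAt (linePoint (m + n) m (1, 1) (k - x)) f * evalAt (linePoint (m + n) m (1, 1) x) g

open Polynomial in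
/-- The restriction of `quasiProd` to the tangent line at `(1, 1)`, with the denominator
`(x + m) ^ (a + b + (m + n) |S| + e)` cleared. -/
def linePoly (m n : ℕ) (A : ℂ) (a b e : ℕ) (S : Multiset ℂ) : ℂ[X] :=
  C A * X ^ a * (X - C (n : ℂ)) ^ b * (X - C (-(m : ℂ))) ^ e * (S.map (fiberPoly m n)).prod

theorem eval_linePoly (m n : ℕ) (A : ℂ) (a b e : ℕ) (S : Multiset ℂ) {x : ℂ} (hx : x + m ≠ 0) :
    (linePoly m n A a b e S).eval x = (x + m) ^ (a + b + (m + n) * S.card + e) *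
      evalAt (linePoint (m + n) m (1, 1) x) (quasiProd (m + n) m A a b S) := by
  have hS : (S.map fun c => (fiberPoly m n c).eval x).prod = ((x + m) ^ (m + n)) ^ S.card *
      (S.map fun c => ((x - n) / (x + m)) ^ m - c * (x / (x + m)) ^ (m + n)).prod := by
    rw [← Multiset.prod_replicate S.card ((x + m) ^ (m + n)), ← Multiset.map_const',
      ← Multiset.prod_map_mul]
    congr 2
    funext c
    rw [eval_fiberPoly, div_pow, div_pow, mul_sub, pow_add (x + m)]
    field_simp
  have h1 : linePoint (m + n) m (1, 1) x = (x / (x + m), (x - n) / (x + m)) := by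
    simp [linePoint]
  rw [h1, evalAt_quasiProd]
  dsimp only
  simp only [linePoly, Polynomial.eval_mul, Polynomial.eval_pow, Polynomial.eval_X,
    Polynomial.eval_C, Polynomial.eval_sub, Polynomial.eval_multiset_prod, Multiset.map_map,
    Function.comp_def, sub_neg_eq_add]
  rw [hS]
  generalize (S.map fun c => ((x - n) / (x + m)) ^ m - c * (x / (x + m)) ^ (m + n)).prod = u
  rw [div_pow, div_pow, pow_add (x + m), pow_add (x + m), pow_add (x + m), pow_mul]
  field_simp
  ring

section

variable {m n : ℕ}

theorem linePoly_ne_zero (hm : m ≠ 0) (hn : n ≠ 0) {A : ℂ} (hA : A ≠ 0) (a b e : ℕ)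
    (S : Multiset ℂ) : linePoly m n A a b e S ≠ 0 := by
  refine mul_ne_zero (mul_ne_zero (mul_ne_zero (mul_ne_zero ?_ ?_) ?_) ?_) ?_
  · exact Polynomial.C_ne_zero.2 hA
  · exact pow_ne_zero _ Polynomial.X_ne_zero
  · exact pow_ne_zero _ (Polynomial.X_sub_C_ne_zero _)
  · exact pow_ne_zero _ (Polynomial.X_sub_C_ne_zero _)
  · refine Multiset.prod_ne_zero fun h => ?_
    obtain ⟨c, -, hc⟩ := Multiset.mem_map.1 h
    exact fiberPoly_ne_zero m n hm hn c hc

theorem rootMultiplicity_linePoly (hm : m ≠ 0) (hn : n ≠ 0) {A : ℂ} (hA : A ≠ 0) (a b e : ℕ)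
    (S : Multiset ℂ) (x : ℂ) :
    (linePoly m n A a b e S).rootMultiplicity x =
      (if x = 0 then a else 0) + (if x = n then b else 0) + (if x = -m then e else 0) +
        (S.map fun c => (fiberPoly m n c).roots.count x).sum := by
  have h0 := linePoly_ne_zero hm hn hA a b e S
  have hX : (Polynomial.X : Polynomial ℂ) = Polynomial.X - Polynomial.C 0 := by simp
  have hS : (0 : Polynomial ℂ) ∉ S.map (fiberPoly m n) := by
    intro h
    obtain ⟨c, -, hc⟩ := Multiset.mem_map.1 h
    exact fiberPoly_ne_zero m n hm hn c hc
  have hone : ∀ u : ℂ, ∀ d : ℕ, d * ({u} : Multiset ℂ).count x = if x = u then d else 0 := by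
    intro u d
    rw [Multiset.count_singleton]
    split_ifs <;> simp
  rw [← Polynomial.count_roots]
  unfold linePoly at h0 ⊢
  rw [Polynomial.roots_mul h0, Polynomial.roots_mul (left_ne_zero_of_mul h0),
    Polynomial.roots_mul (left_ne_zero_of_mul (left_ne_zero_of_mul h0)),
    Polynomial.roots_C_mul _ hA, Polynomial.roots_multiset_prod _ hS, Polynomial.roots_pow,
    Polynomial.roots_pow, Polynomial.roots_pow, Polynomial.roots_X, Polynomial.roots_X_sub_C,
    Polynomial.roots_X_sub_C]
  simp only [Multiset.count_add, Multiset.count_nsmul, Multiset.count_bind, Multiset.map_map,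
    Function.comp_def, hone]

theorem rootMultiplicity_linePoly_fiber (hm : m ≠ 0) (hn : n ≠ 0) {A : ℂ} (hA : A ≠ 0)
    (a b e : ℕ) {S : Multiset ℂ} (hS : (0 : ℂ) ∉ S) {c : ℂ} (hc : c ≠ 0) {x : ℂ}
    (hx : x ∈ (fiberPoly m n c).roots) :
    (linePoly m n A a b e S).rootMultiplicity x = S.count c := by
  obtain ⟨h1, h2, h3⟩ := fiberPoly_root_ne hm hn hc hx
  rw [rootMultiplicity_linePoly hm hn hA, if_neg h1, if_neg h2, if_neg h3]
  have h4 : ∀ d ∈ S, (fiberPoly m n d).roots.count x = if c = d then 1 else 0 := by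
    intro d hd
    have hd0 : d ≠ 0 := fun h => hS (h ▸ hd)
    split_ifs with h
    · subst h
      exact Multiset.count_eq_one_of_mem (nodup_roots_fiberPoly hm hn hc) hx
    · rw [Multiset.count_eq_zero]
      intro hx'
      rw [mem_roots_fiberPoly hm hn h1] at hx hx'
      exact h (hx.trans hx'.symm)
  rw [Multiset.map_congr rfl h4]
  clear h4 hS
  induction S using Multiset.induction_on with
  | empty => simp
  | cons d S ih =>
    rw [Multiset.map_cons, Multiset.sum_cons, Multiset.count_cons]
    omega

theorem rootMultiplicity_linePoly_special (hm : m ≠ 0) (hn : n ≠ 0) {A : ℂ} (hA : A ≠ 0)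
    (a b e : ℕ) {S : Multiset ℂ} (hS : (0 : ℂ) ∉ S) :
    (linePoly m n A a b e S).rootMultiplicity 0 = a ∧
      (linePoly m n A a b e S).rootMultiplicity (n : ℂ) = b ∧
      (linePoly m n A a b e S).rootMultiplicity (-(m : ℂ)) = e := by
  have hm' : (m : ℂ) ≠ 0 := Nat.cast_ne_zero.2 hm
  have hn' : (n : ℂ) ≠ 0 := Nat.cast_ne_zero.2 hn
  have hmn : (n : ℂ) ≠ -m := by
    intro h1
    have h2 : ((n + m : ℕ) : ℂ) = 0 := by
      push_cast
      linear_combination h1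
    rw [Nat.cast_eq_zero] at h2
    omega
  have key : ∀ x : ℂ, (x = 0 ∨ x = n ∨ x = -m) →
      (S.map fun c => (fiberPoly m n c).roots.count x).sum = 0 := by
    intro x hx
    refine Multiset.sum_eq_zero fun u hu => ?_
    obtain ⟨c, hc, rfl⟩ := Multiset.mem_map.1 hu
    rw [Multiset.count_eq_zero]
    intro h
    have h1 := fiberPoly_root_ne hm hn (fun h => hS (h ▸ hc)) h
    tauto
  refine ⟨?_, ?_, ?_⟩
  · rw [rootMultiplicity_linePoly hm hn hA, key _ (by simp)]
    simp [hm, hn'.symm]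
  · rw [rootMultiplicity_linePoly hm hn hA, key _ (by simp)]
    simp [hn, hmn]
  · rw [rootMultiplicity_linePoly hm hn hA, key _ (by simp)]
    simp [hm, hmn.symm]

/-- The difference of the multiplicities in two multisets. -/
def multDiff (S S' : Multiset ℂ) : ℂ →₀ ℤ :=
  (Multiset.toFinsupp S).mapRange Nat.cast Nat.cast_zero -
    (Multiset.toFinsupp S').mapRange Nat.cast Nat.cast_zero

theorem multDiff_apply (S S' : Multiset ℂ) (c : ℂ) :
    multDiff S S' c = (S.count c : ℤ) - S'.count c := by
  simp [multDiff]

theorem sum_multDiff (S S' : Multiset ℂ) :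
    ((multDiff S S').sum fun _ v => v) = (S.card : ℤ) - S'.card := by
  have h : ∀ T : Multiset ℂ,
      (((Multiset.toFinsupp T).mapRange Nat.cast Nat.cast_zero : ℂ →₀ ℤ).sum fun _ v => v) =
        T.card := by
    intro T
    rw [Finsupp.sum_mapRange_index fun _ => rfl, ← Multiset.toFinsupp_sum_eq, Finsupp.sum,
      Finsupp.sum]
    push_cast
    rfl
  rw [multDiff, Finsupp.sum_sub_index fun _ _ _ => rfl, h, h]

/-- The orders of `f / g` along the tangent line at `(1, 1)` of the `(m + n, m)`-curve. The
exponents at `x = -m` are such that the two numerators have one and the same denominator. -/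
def lineOrder (m n : ℕ) (A A' : ℂ) (a a' b b' : ℕ) (S S' : Multiset ℂ) (x : ℂ) : ℤ :=
  (linePoly m n A a b (a' + b' + (m + n) * S'.card) S).rootMultiplicity x -
    (linePoly m n A' a' b' (a + b + (m + n) * S.card) S').rootMultiplicity x

variable {A A' : ℂ} {a a' b b' : ℕ} {S S' : Multiset ℂ}

theorem lineOrder_special (hm : m ≠ 0) (hn : n ≠ 0) (hA : A ≠ 0) (hA' : A' ≠ 0) (hS : (0 : ℂ) ∉ S)
    (hS' : (0 : ℂ) ∉ S') :
    lineOrder m n A A' a a' b b' S S' 0 = (a : ℤ) - a' ∧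
      lineOrder m n A A' a a' b b' S S' n = (b : ℤ) - b' ∧
      lineOrder m n A A' a a' b b' S S' (-m) =
        ((a' + b' + (m + n) * S'.card : ℕ) : ℤ) - (a + b + (m + n) * S.card : ℕ) := by
  obtain ⟨h1, h2, h3⟩ := rootMultiplicity_linePoly_special hm hn hA a b
    (a' + b' + (m + n) * S'.card) hS
  obtain ⟨h4, h5, h6⟩ := rootMultiplicity_linePoly_special hm hn hA' a' b'
    (a + b + (m + n) * S.card) hS'
  simp only [lineOrder, h1, h2, h3, h4, h5, h6, true_and]

theorem linePoly_mul_comp_eq (hm : m ≠ 0) (hn : n ≠ 0) (hA' : A' ≠ 0) {k : ℂ}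
    (h : IsLineInvariant m n k (quasiProd (m + n) m A a b S) (quasiProd (m + n) m A' a' b' S')) :
    linePoly m n A a b (a' + b' + (m + n) * S'.card) S *
        (linePoly m n A' a' b' (a + b + (m + n) * S.card) S').comp
          (Polynomial.C (-1) * Polynomial.X + Polynomial.C k) =
      (linePoly m n A a b (a' + b' + (m + n) * S'.card) S).comp
          (Polynomial.C (-1) * Polynomial.X + Polynomial.C k) *
        linePoly m n A' a' b' (a + b + (m + n) * S.card) S' := by
  set F := linePoly m n A a b (a' + b' + (m + n) * S'.card) S with hF
  set G := linePoly m n A' a' b' (a + b + (m + n) * S.card) S' with hG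
  have hG0 : G ≠ 0 := linePoly_ne_zero hm hn hA' _ _ _ _
  set r : Polynomial ℂ := Polynomial.C (-1) * Polynomial.X + Polynomial.C k with hr
  have hre : ∀ x, r.eval x = k - x := fun x => by
    simp [hr]
    ring
  have hrr : r.comp r = Polynomial.X := by
    simp [hr]
  have hcomp : ∀ H : Polynomial ℂ, H ≠ 0 → H.comp r ≠ 0 := by
    intro H hH h0
    apply hH
    rw [← Polynomial.comp_X (p := H), ← hrr, ← Polynomial.comp_assoc, h0, Polynomial.zero_comp]
  -- the equation holds outside of the zeros of the polynomial `U`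
  set U : Polynomial ℂ := (Polynomial.X + Polynomial.C (m : ℂ)) * G with hU
  have hU0 : U ≠ 0 := mul_ne_zero (Polynomial.X_add_C_ne_zero _) hG0
  apply mul_left_cancel₀ (mul_ne_zero hU0 (hcomp U hU0))
  apply Polynomial.funext
  intro x
  simp only [Polynomial.eval_mul, Polynomial.eval_comp, hre]
  by_cases hx : U.eval x = 0
  · simp [hx]
  by_cases hx' : U.eval (k - x) = 0
  · simp [hx']
  simp only [hU, Polynomial.eval_mul, Polynomial.eval_add, Polynomial.eval_X, Polynomial.eval_C,
    mul_eq_zero, not_or] at hx hx'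
  have e1 := eval_linePoly m n A a b (a' + b' + (m + n) * S'.card) S hx.1
  have e2 := eval_linePoly m n A a b (a' + b' + (m + n) * S'.card) S hx'.1
  have e3 := eval_linePoly m n A' a' b' (a + b + (m + n) * S.card) S' hx.1
  have e4 := eval_linePoly m n A' a' b' (a + b + (m + n) * S.card) S' hx'.1
  rw [← hF] at e1 e2
  rw [← hG] at e3 e4
  have g1 := hx.2
  have g2 := hx'.2
  rw [e3] at g1
  rw [e4] at g2
  have h5 := h x hx.1 hx'.1 (right_ne_zero_of_mul g1) (right_ne_zero_of_mul g2)
  rw [e1, e2, e3, e4, add_comm (a' + b' + (m + n) * S'.card) (a + b + (m + n) * S.card)]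
  generalize (x + (m : ℂ)) ^ (a + b + (m + n) * S.card + (a' + b' + (m + n) * S'.card)) = u
  generalize (k - x + (m : ℂ)) ^ (a + b + (m + n) * S.card + (a' + b' + (m + n) * S'.card)) = v
  linear_combination (U.eval x * U.eval (k - x) * u * v) * h5

/-- The orders of an invariant quasihomogeneous function form an invariant order. -/
theorem isInvariantOrder_lineOrder (hm : m ≠ 0) (hn : n ≠ 0) (hA : A ≠ 0) (hA' : A' ≠ 0)
    (hS : (0 : ℂ) ∉ S) (hS' : (0 : ℂ) ∉ S') {k : ℂ}
    (h : IsLineInvariant m n k (quasiProd (m + n) m A a b S) (quasiProd (m + n) m A' a' b' S')) :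
    IsInvariantOrder m n k (multDiff S S') (lineOrder m n A A' a a' b b' S S') where
  map_zero := by
    rw [multDiff_apply, Multiset.count_eq_zero.2 hS, Multiset.count_eq_zero.2 hS', sub_self]
  fiber := by
    intro c hc x hx
    rw [lineOrder, multDiff_apply, rootMultiplicity_linePoly_fiber hm hn hA _ _ _ hS hc hx,
      rootMultiplicity_linePoly_fiber hm hn hA' _ _ _ hS' hc hx]
  reflect := by
    intro x
    have h1 := linePoly_mul_comp_eq hm hn hA' h
    have hF := linePoly_ne_zero hm hn hA a b (a' + b' + (m + n) * S'.card) S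
    have hG := linePoly_ne_zero hm hn hA' a' b' (a + b + (m + n) * S.card) S'
    rw [lineOrder, lineOrder]
    generalize linePoly m n A a b (a' + b' + (m + n) * S'.card) S = F at *
    generalize linePoly m n A' a' b' (a + b + (m + n) * S.card) S' = G at *
    have hunit : IsUnit (-1 : ℂ) := isUnit_one.neg
    have hne : ∀ H : Polynomial ℂ, H ≠ 0 →
        H.comp (Polynomial.C (-1) * Polynomial.X + Polynomial.C k) ≠ 0 := by
      intro H hH h0
      have hrr : (Polynomial.C (-1) * Polynomial.X + Polynomial.C k : Polynomial ℂ).comp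
          (Polynomial.C (-1) * Polynomial.X + Polynomial.C k) = Polynomial.X := by simp
      apply hH
      rw [← Polynomial.comp_X (p := H), ← hrr, ← Polynomial.comp_assoc, h0, Polynomial.zero_comp]
    have h2 := congrArg (Polynomial.rootMultiplicity x) h1
    rw [Polynomial.rootMultiplicity_mul (mul_ne_zero hF (hne G hG)),
      Polynomial.rootMultiplicity_mul (mul_ne_zero (hne F hF) hG),
      Polynomial.rootMultiplicity_comp_C_mul_X_add_C _ _ _ _ hunit,
      Polynomial.rootMultiplicity_comp_C_mul_X_add_C _ _ _ _ hunit,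
      show -1 * x + k = k - x by ring] at h2
    omega
  degree := by
    obtain ⟨h1, h2, h3⟩ := lineOrder_special (a := a) (a' := a') (b := b) (b' := b')
      hm hn hA hA' hS hS'
    rw [h1, h2, h3, sum_multDiff]
    push_cast
    ring

end

/-! ### Necessary conditions of integrability -/

theorem IsBilliardIntegral.isLineInvariant {m n : ℕ} (hm : m ≠ 0) {ρ : ℂ}
    {f g : MvPolynomial (Fin 2) ℂ}
    (h : IsBilliardIntegral (m + n) m ρ
      (algebraMap (MvPolynomial (Fin 2) ℂ) RatFun f / algebraMap _ RatFun g)) :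
    IsLineInvariant m n (m * (ρ - 2)) f g :=
  fun _ hx hx' hg hg' => h.eval_linePoint (by omega) hm hx hx' hg hg'

theorem filter_ne_one_add_replicate (S : Multiset ℂ) :
    S.filter (· ≠ 1) + Multiset.replicate (S.count 1) 1 = S := by
  rw [← Multiset.filter_eq', add_comm]
  exact Multiset.filter_add_not _ _

theorem card_filter_ne_one (S : Multiset ℂ) : (S.filter (· ≠ 1)).card + S.count 1 = S.card := by
  conv_rhs => rw [← filter_ne_one_add_replicate S]
  rw [Multiset.card_add, Multiset.card_replicate]

theorem quasiProd_eq_mul_pow (p q : ℕ) (A : ℂ) (a b : ℕ) (S : Multiset ℂ) :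
    quasiProd p q A a b S = quasiProd p q A a b (S.filter (· ≠ 1)) *
      (MvPolynomial.X 1 ^ q - MvPolynomial.C 1 * MvPolynomial.X 0 ^ p) ^ S.count 1 := by
  conv_lhs => rw [← filter_ne_one_add_replicate S]
  simp only [quasiProd, Multiset.map_add, Multiset.prod_add, Multiset.map_replicate,
    Multiset.prod_replicate]
  ring

theorem quasiProd_ne_zero {p : ℕ} (hp : p ≠ 0) (q : ℕ) {A : ℂ} (hA : A ≠ 0) (a b : ℕ)
    (S : Multiset ℂ) : quasiProd p q A a b S ≠ 0 := by
  refine mul_ne_zero (mul_ne_zero (mul_ne_zero ?_ ?_) ?_) ?_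
  · exact (map_ne_zero_iff _ (MvPolynomial.C_injective _ _)).2 hA
  · exact pow_ne_zero _ (MvPolynomial.X_ne_zero _)
  · exact pow_ne_zero _ (MvPolynomial.X_ne_zero _)
  · refine Multiset.prod_ne_zero fun h => ?_
    obtain ⟨c, -, hc⟩ := Multiset.mem_map.1 h
    have h1 := congrArg (evalAt (0, 1)) hc
    simp [evalAt, hp] at h1

theorem quasiProd_div_eq_const {p : ℕ} (hp : p ≠ 0) (q : ℕ) {A A' : ℂ} (hA' : A' ≠ 0)
    (a b : ℕ) (S : Multiset ℂ) :
    algebraMap (MvPolynomial (Fin 2) ℂ) RatFun (quasiProd p q A a b S) /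
      algebraMap _ RatFun (quasiProd p q A' a b S) = algebraMap ℂ RatFun (A / A') := by
  have hinj := IsFractionRing.injective (MvPolynomial (Fin 2) ℂ) RatFun
  rw [div_eq_iff ((map_ne_zero_iff _ hinj).2 (quasiProd_ne_zero hp q hA' a b S)),
    IsScalarTower.algebraMap_apply ℂ (MvPolynomial (Fin 2) ℂ) RatFun, ← map_mul,
    MvPolynomial.algebraMap_eq]
  congr 1
  have h1 : (MvPolynomial.C A : MvPolynomial (Fin 2) ℂ) =
      MvPolynomial.C (A / A') * MvPolynomial.C A' := by
    rw [← map_mul, div_mul_cancel₀ _ hA']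
  simp only [quasiProd, h1]
  ring

/-- For `p ≥ 3` an invariant function of quasihomogeneous degree zero which is finite along the
curve is constant: otherwise its difference with its value at `(1, 1)` is also invariant, but
vanishes on the curve, in contradiction with `IsInvariantOrder.map_one_eq_zero`. -/
theorem eq_C_mul_of_isLineInvariant {m n : ℕ} (hm : m ≠ 0) (hn : n ≠ 0) (hmn : m.Coprime n)
    (h3 : 3 ≤ m + n) {k : ℂ} {f : MvPolynomial (Fin 2) ℂ} {A : ℂ} (hA : A ≠ 0) (a b : ℕ)
    {T : Multiset ℂ} (hT0 : (0 : ℂ) ∉ T) (hT1 : (1 : ℂ) ∉ T)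
    (hf : MvPolynomial.IsWeightedHomogeneous ![m, m + n] f
      (m * a + (m + n) * b + (m + n) * m * T.card))
    (h : IsLineInvariant m n k f (quasiProd (m + n) m A a b T)) :
    ∃ v : ℂ, f = MvPolynomial.C v * quasiProd (m + n) m A a b T := by
  have hcop : (m + n).Coprime m := by simpa using hmn.symm
  have hg1 : evalAt (1, 1) (quasiProd (m + n) m A a b T) ≠ 0 := by
    rw [evalAt_quasiProd]
    simp only [one_pow, mul_one]
    refine mul_ne_zero hA (Multiset.prod_ne_zero fun h => ?_)
    obtain ⟨c, hc, hc1⟩ := Multiset.mem_map.1 h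
    exact hT1 (sub_eq_zero.1 hc1 ▸ hc)
  have hwg := quasiProd_isWeightedHomogeneous (m + n) m A a b T
  obtain ⟨g, hg⟩ : ∃ g, g = quasiProd (m + n) m A a b T := ⟨_, rfl⟩
  rw [← hg] at h hg1 hwg ⊢
  refine ⟨evalAt (1, 1) f / evalAt (1, 1) g, ?_⟩
  by_contra hne
  generalize hv : evalAt (1, 1) f / evalAt (1, 1) g = v at hne
  have hw : IsQuasihomogeneous (m + n) m (f - MvPolynomial.C v * g) := ⟨_, hf.sub (hwg.C_mul v)⟩
  have hline : IsLineInvariant m n k (f - MvPolynomial.C v * g) g := by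
    intro x h1 h2 h3 h4
    have h5 := h x h1 h2 h3 h4
    simp only [evalAt, map_sub, map_mul, MvPolynomial.eval_C] at h5 ⊢
    linear_combination h5
  have hzero : evalAt (1, 1) (f - MvPolynomial.C v * g) = 0 := by
    have h1 : evalAt (1, 1) f = v * evalAt (1, 1) g := by rw [← hv, div_mul_cancel₀ _ hg1]
    simp only [evalAt, map_sub, map_mul, MvPolynomial.eval_C] at h1 ⊢
    rw [h1, sub_self]
  obtain ⟨B, i, j, U, hB, hU, hfU⟩ := exists_eq_quasiProd hm hcop (sub_ne_zero.2 hne) hw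
  rw [hfU, hg] at hline
  rw [hfU] at hzero
  have hM := (isInvariantOrder_lineOrder hm hn hB hA hU hT0 hline).map_one_eq_zero hm hn hmn h3
  rw [multDiff_apply, Multiset.count_eq_zero.2 hT1, Nat.cast_zero, sub_zero, Nat.cast_eq_zero,
    Multiset.count_eq_zero] at hM
  apply hM
  rw [evalAt_quasiProd] at hzero
  simp only [one_pow, mul_one, mul_eq_zero, hB, false_or, Multiset.prod_eq_zero_iff,
    Multiset.mem_map] at hzero
  obtain ⟨c, hc, hc1⟩ := hzero
  rwa [sub_eq_zero.1 hc1]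

/-- For `p ≥ 3` there are no integrals: by `IsInvariantOrder.map_one_eq_zero` an integral has order
zero along the curve, and by `IsInvariantOrder.ord_eq_zero` it has quasihomogeneous degree zero. -/
theorem not_quasihomogeneouslyIntegrable {m n : ℕ} (hm : m ≠ 0) (hn : n ≠ 0) (hmn : m.Coprime n)
    (h3 : 3 ≤ m + n) (ρ : ℂ) : ¬ QuasihomogeneouslyIntegrable (m + n) m ρ := by
  rintro ⟨R, hconst, ⟨f, g, hf, hg, hg0, rfl⟩, hint⟩
  have hcop : (m + n).Coprime m := by simpa using hmn.symm
  have hinj := IsFractionRing.injective (MvPolynomial (Fin 2) ℂ) RatFun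
  have hp0 : m + n ≠ 0 := by omega
  have hne : m ≠ n := by
    rintro rfl
    rw [Nat.coprime_self] at hmn
    omega
  have hf0 : f ≠ 0 := by
    rintro rfl
    exact hconst 0 (by simp)
  obtain ⟨A, a, b, S, hA, hS, rfl⟩ := exists_eq_quasiProd hm hcop hf0 hf
  obtain ⟨A', a', b', S', hA', hS', rfl⟩ := exists_eq_quasiProd hm hcop hg0 hg
  have ho := isInvariantOrder_lineOrder hm hn hA hA' hS hS' (hint.isLineInvariant hm)
  have hM1 := ho.map_one_eq_zero hm hn hmn h3
  obtain ⟨hb, he⟩ := ho.ord_eq_zero hm hn hne hM1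
  obtain ⟨-, e2, e3⟩ := lineOrder_special (a := a) (a' := a') (b := b) (b' := b')
    hm hn hA hA' hS hS'
  rw [e2] at hb
  rw [e3] at he
  rw [multDiff_apply] at hM1
  have hcount : S.count 1 = S'.count 1 := by omega
  obtain rfl : b = b' := by omega
  have hdeg : a + (m + n) * S.card = a' + (m + n) * S'.card := by omega
  rw [← card_filter_ne_one S, ← card_filter_ne_one S', hcount] at hdeg
  -- cancellation of the powers of `w ^ q - z ^ p`
  have hpow : (MvPolynomial.X 1 ^ m - MvPolynomial.C 1 * MvPolynomial.X 0 ^ (m + n) :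
      MvPolynomial (Fin 2) ℂ) ^ S'.count 1 ≠ 0 := by
    rw [quasiProd_eq_mul_pow] at hg0
    exact right_ne_zero_of_mul hg0
  rw [quasiProd_eq_mul_pow _ _ A, quasiProd_eq_mul_pow _ _ A', hcount, map_mul, map_mul,
    mul_div_mul_right _ _ ((map_ne_zero_iff _ hinj).2 hpow)] at hint hconst
  have hw : MvPolynomial.IsWeightedHomogeneous ![m, m + n]
      (quasiProd (m + n) m A a b (S.filter (· ≠ 1)))
      (m * a' + (m + n) * b + (m + n) * m * (S'.filter (· ≠ 1)).card) := by
    have h := quasiProd_isWeightedHomogeneous (m + n) m A a b (S.filter (· ≠ 1))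
    have h2 : m * a + (m + n) * b + (m + n) * m * (S.filter (· ≠ 1)).card =
        m * a' + (m + n) * b + (m + n) * m * (S'.filter (· ≠ 1)).card := by
      linear_combination m * hdeg
    rwa [h2] at h
  obtain ⟨v, hv⟩ := eq_C_mul_of_isLineInvariant hm hn hmn h3 hA' a' b
    (fun h => hS' (Multiset.mem_filter.1 h).1) (by simp) hw
    (hint.isLineInvariant hm)
  apply hconst v
  rw [hv, map_mul, mul_div_cancel_right₀ _ ((map_ne_zero_iff _ hinj).2
    (quasiProd_ne_zero hp0 m hA' a' b _)), IsScalarTower.algebraMap_apply ℂ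
    (MvPolynomial (Fin 2) ℂ) RatFun, MvPolynomial.algebraMap_eq]

/-- On a tangent line of a conic the pencil of the curves `w = c z ^ 2` induces the involution
`x ↦ -x`. Together with the reflection `x ↦ k - x` it generates translations by multiples of `k`,
and a finite orbit has to end at the points `1`, `-1`, where the tangent line meets the two
components `w = 0` and the line at infinity of a degenerate conic of the pencil, since only these
two curves may have different orders in one fibre. -/
theorem IsInvariantOrder.reflection_eq {k : ℂ} {M : ℂ →₀ ℤ} {ord : ℂ → ℤ}
    (h : IsInvariantOrder 1 1 k M ord) {x : ℂ} (hx : ord x ≠ 0) :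
    k = 0 ∨ ∃ j : ℕ, 1 ≤ j ∧ (k = 2 / j ∨ k = -(2 / j)) := by
  by_cases hk : k = 0
  · exact Or.inl hk
  right
  have hneg : ∀ y : ℂ, y ≠ 1 → y ≠ -1 → ord (-y) = ord y := by
    intro y h1 h2
    by_cases hy : y = 0
    · simp [hy]
    have hc : (y - (1 : ℕ)) ^ 1 * (y + (1 : ℕ)) ^ 1 / y ^ (1 + 1) ≠ 0 := by
      refine div_ne_zero (mul_ne_zero (pow_ne_zero _ ?_) (pow_ne_zero _ ?_)) (pow_ne_zero _ hy)
      · rw [Nat.cast_one]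
        exact sub_ne_zero.2 h1
      · rw [Nat.cast_one]
        exact fun h => h2 (eq_neg_of_add_eq_zero_left h)
    rw [h.fiber _ hc y ((mem_roots_fiberPoly one_ne_zero one_ne_zero hy).2 rfl),
      h.fiber _ hc (-y) ((mem_roots_fiberPoly one_ne_zero one_ne_zero (neg_ne_zero.2 hy)).2 ?_)]
    push_cast
    ring
  have key : ∀ y : ℂ, ord y = ord x → ∃ j : ℕ, y + j * k = 1 ∨ y + j * k = -1 := by
    intro y hy
    by_contra! hall
    have h1 : ∀ j : ℕ, ord (y + j * k) = ord x := by
      intro j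
      induction j with
      | zero => simpa using hy
      | succ j ih =>
        rw [← ih, ← hneg _ (hall j).1 (hall j).2, ← h.reflect]
        congr 1
        push_cast
        ring
    have hinj : Function.Injective fun j : ℕ => y + j * k := by
      intro i j hij
      have h2 : (i : ℂ) * k = j * k := add_left_cancel hij
      exact_mod_cast mul_right_cancel₀ hk h2
    exact (Set.infinite_of_injective_forall_mem hinj
      (s := (levelSet 1 1 M ord (ord x) : Set ℂ))
      fun j => (h.mem_levelSet one_ne_zero one_ne_zero hx _).2 (h1 j)) (Finset.finite_toSet _)
  obtain ⟨i, hi⟩ := key x rfl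
  obtain ⟨j, hj⟩ := key (k - x) (h.reflect x)
  have hij : ((i + j + 1 : ℕ) : ℂ) ≠ 0 := Nat.cast_ne_zero.2 (by omega)
  have hsum : ((i + j + 1 : ℕ) : ℂ) * k ≠ 0 := mul_ne_zero hij hk
  refine ⟨i + j + 1, by omega, ?_⟩
  have e : ((i + j + 1 : ℕ) : ℂ) * k = (x + i * k) + (k - x + j * k) := by
    push_cast
    ring
  rw [e] at hsum
  rcases hi with hi | hi <;> rcases hj with hj | hj <;> rw [hi, hj] at e hsum
  · left
    rw [eq_div_iff hij, mul_comm, e]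
    norm_num
  · simp at hsum
  · simp at hsum
  · right
    rw [← neg_div, eq_div_iff hij, mul_comm, e]
    norm_num

/-- A nonconstant function has a zero or a pole with a finite coordinate on the tangent line. -/
theorem exists_lineOrder_ne_zero {A A' : ℂ} {a a' b b' : ℕ} {S S' : Multiset ℂ} {k : ℂ}
    (hA : A ≠ 0) (hA' : A' ≠ 0) (hS : (0 : ℂ) ∉ S) (hS' : (0 : ℂ) ∉ S')
    (ho : IsInvariantOrder 1 1 k (multDiff S S') (lineOrder 1 1 A A' a a' b b' S S'))
    (h : IsNonconstant
      (algebraMap (MvPolynomial (Fin 2) ℂ) RatFun (quasiProd (1 + 1) 1 A a b S) /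
        algebraMap _ RatFun (quasiProd (1 + 1) 1 A' a' b' S'))) :
    ∃ x, lineOrder 1 1 A A' a a' b b' S S' x ≠ 0 := by
  by_contra! hall
  obtain ⟨e1, e2, e3⟩ := lineOrder_special (a := a) (a' := a') (b := b) (b' := b')
    one_ne_zero one_ne_zero hA hA' hS hS'
  rw [hall] at e1 e2 e3
  obtain rfl : a = a' := by omega
  obtain rfl : b = b' := by omega
  have hM : ∀ c, c ≠ 1 → S.count c = S'.count c := by
    intro c hc1
    by_cases hc : c = 0
    · rw [hc, Multiset.count_eq_zero.2 hS, Multiset.count_eq_zero.2 hS']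
    have h2 : 0 < (fiberPoly 1 1 c).roots.card := by
      rw [(roots_fiberPoly one_ne_zero one_ne_zero hc1).1]
      norm_num
    obtain ⟨y, hy⟩ := Multiset.card_pos_iff_exists_mem.1 h2
    have h3 := ho.fiber c hc y hy
    rw [hall, multDiff_apply] at h3
    omega
  have hcard : S.card = S'.card := by omega
  have hSS : S = S' := by
    have hfil : S.filter (· ≠ 1) = S'.filter (· ≠ 1) := by
      ext c
      rw [Multiset.count_filter, Multiset.count_filter]
      split_ifs with hc
      · exact hM c hc
      · rfl
    have h1 := card_filter_ne_one S
    have h2 := card_filter_ne_one S'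
    rw [hfil] at h1
    have h3 : S.count 1 = S'.count 1 := by omega
    rw [← filter_ne_one_add_replicate S, ← filter_ne_one_add_replicate S', hfil, h3]
  subst hSS
  exact h _ (quasiProd_div_eq_const (by norm_num) 1 hA' a b S)

theorem mem_residues_of_integrable {ρ : ℂ} (h : QuasihomogeneouslyIntegrable 2 1 ρ) :
    ρ ∈ residues := by
  obtain ⟨R, hconst, ⟨f, g, hf, hg, hg0, rfl⟩, hint⟩ := h
  have hf0 : f ≠ 0 := by
    rintro rfl
    exact hconst 0 (by simp)
  obtain ⟨A, a, b, S, hA, hS, rfl⟩ :=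
    exists_eq_quasiProd one_ne_zero (Nat.coprime_one_right 2) hf0 hf
  obtain ⟨A', a', b', S', hA', hS', rfl⟩ :=
    exists_eq_quasiProd one_ne_zero (Nat.coprime_one_right 2) hg0 hg
  have ho := isInvariantOrder_lineOrder (n := 1) one_ne_zero one_ne_zero hA hA' hS hS'
    (IsBilliardIntegral.isLineInvariant one_ne_zero hint)
  obtain ⟨x, hx⟩ := exists_lineOrder_ne_zero hA hA' hS hS' ho hconst
  have hk := ho.reflection_eq hx
  rw [Nat.cast_one, one_mul] at hk
  rcases hk with hk | ⟨j, hj, hk⟩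
  · left
    simp [sub_eq_zero.1 hk]
  · have hρ : ρ = 2 + (ρ - 2) := by ring
    by_cases hj3 : 3 ≤ j
    · right
      refine ⟨j, hj3, ?_⟩
      rcases hk with hk | hk
      · left
        rw [← hk]
        exact hρ
      · right
        rw [sub_eq_add_neg, ← hk]
        exact hρ
    · left
      simp only [Set.mem_insert_iff, Set.mem_singleton_iff]
      obtain rfl | rfl : j = 1 ∨ j = 2 := by omega
      · rcases hk with hk | hk <;> rw [hk] at hρ <;> norm_num at hρ <;> simp [hρ]
      · rcases hk with hk | hk <;> rw [hk] at hρ <;> norm_num at hρ <;> simp [hρ]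

/-! ### A reflection identity -/

theorem prod_Icc_one_eq_prod_range (f : ℕ → ℂ) (N : ℕ) :
    ∏ j ∈ Finset.Icc 1 N, f j = ∏ j ∈ Finset.range N, f (j + 1) := by
  induction N with
  | zero => simp
  | succ N ih => rw [Finset.prod_Icc_succ_top (by omega), ih, Finset.prod_range_succ]

/-- As a function of `X`, the product of `X + K - 2 i` over `0 ≤ i < K` has the zeros
`-K, 2 - K, …, K - 2`, which are symmetric with respect to `-1`. -/
theorem prod_progression_reflect (K : ℕ) (X : ℂ) :
    ∏ i ∈ Finset.range K, (-2 - X + K - 2 * (i : ℂ)) =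
      (-1) ^ K * ∏ i ∈ Finset.range K, (X + K - 2 * (i : ℂ)) := by
  have hK : (-1 : ℂ) ^ K = ∏ _i ∈ Finset.range K, (-1 : ℂ) := by simp
  rw [← Finset.prod_range_reflect, hK, ← Finset.prod_mul_distrib]
  refine Finset.prod_congr rfl fun i hi => ?_
  have h : i < K := by simpa using hi
  rw [Nat.sub_sub, Nat.cast_sub (by omega)]
  push_cast
  ring

/-- The product of `X ^ 2 - (K - 2 j) ^ 2` over `1 ≤ j ≤ N`. -/
def squareProd (N : ℕ) (K X : ℂ) : ℂ := ∏ j ∈ Finset.Icc 1 N, (X ^ 2 - (K - 2 * (j : ℂ)) ^ 2)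

theorem squareProd_neg (N : ℕ) (K X : ℂ) : squareProd N K (-X) = squareProd N K X := by
  simp [squareProd]

theorem squareProd_eq (N : ℕ) (K X : ℂ) :
    squareProd N K X = (∏ i ∈ Finset.range N, (X + K - 2 * ((i + 1 : ℕ) : ℂ))) *
      ∏ i ∈ Finset.range N, (X - K + 2 * ((i + 1 : ℕ) : ℂ)) := by
  rw [squareProd, prod_Icc_one_eq_prod_range, ← Finset.prod_mul_distrib]
  refine Finset.prod_congr rfl fun i _ => ?_
  ring

theorem progression_odd (N : ℕ) (X : ℂ) :
    ∏ i ∈ Finset.range (2 * N + 1), (X + ((2 * N + 1 : ℕ) : ℂ) - 2 * (i : ℂ)) =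
      (X + (2 * N + 1)) * squareProd N (2 * N + 1) X := by
  rw [Finset.prod_range_succ', two_mul N, Finset.prod_range_add, squareProd_eq,
    ← Finset.prod_range_reflect (fun i => X - (2 * (N : ℂ) + 1) + 2 * ((i + 1 : ℕ) : ℂ))]
  rw [Finset.prod_congr rfl (g := fun i => X + (2 * (N : ℂ) + 1) - 2 * ((i + 1 : ℕ) : ℂ))
    fun i _ => by push_cast; ring]
  rw [Finset.prod_congr rfl (f := fun i => X + ((N + N + 1 : ℕ) : ℂ) - 2 * ((N + i + 1 : ℕ) : ℂ))
    (g := fun i => X - (2 * (N : ℂ) + 1) + 2 * ((N - 1 - i + 1 : ℕ) : ℂ)) fun i hi => ?_]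
  · push_cast
    ring
  · have h : i < N := by simpa using hi
    rw [show N - 1 - i + 1 = N - i by omega, Nat.cast_sub h.le]
    push_cast
    ring

theorem progression_even (N : ℕ) (X : ℂ) :
    ∏ i ∈ Finset.range (2 * N + 2), (X + ((2 * N + 2 : ℕ) : ℂ) - 2 * (i : ℂ)) =
      X * (X + (2 * N + 2)) * squareProd N (2 * N + 2) X := by
  rw [Finset.prod_range_succ', show 2 * N + 1 = N + (1 + N) by ring, Finset.prod_range_add,
    Finset.prod_range_add, Finset.prod_range_one, squareProd_eq,
    ← Finset.prod_range_reflect (fun i => X - (2 * (N : ℂ) + 2) + 2 * ((i + 1 : ℕ) : ℂ))]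
  rw [Finset.prod_congr rfl (g := fun i => X + (2 * (N : ℂ) + 2) - 2 * ((i + 1 : ℕ) : ℂ))
    fun i _ => by push_cast; ring]
  rw [Finset.prod_congr rfl
    (f := fun i => X + ((2 * N + 2 : ℕ) : ℂ) - 2 * ((N + (1 + i) + 1 : ℕ) : ℂ))
    (g := fun i => X - (2 * (N : ℂ) + 2) + 2 * ((N - 1 - i + 1 : ℕ) : ℂ)) fun i hi => ?_]
  · push_cast
    ring
  · have h : i < N := by simpa using hi
    rw [show N - 1 - i + 1 = N - i by omega, Nat.cast_sub h.le]
    push_cast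
    ring

/-- For `K = 2 N + 1` the factors of `(X + K) squareProd N K X` form the progression of
`prod_progression_reflect`. -/
theorem squareProd_reflect_odd (N : ℕ) (X : ℂ) :
    (-2 - X + (2 * N + 1)) * squareProd N (2 * N + 1) (-2 - X) =
      -((X + (2 * N + 1)) * squareProd N (2 * N + 1) X) := by
  rw [← progression_odd, ← progression_odd, prod_progression_reflect, pow_succ, pow_mul]
  simp

/-- For `K = 2 N + 2` the progression of `prod_progression_reflect` contains also the factor `X`. -/
theorem squareProd_reflect_even (N : ℕ) (X : ℂ) :
    (-2 - X) * (-2 - X + (2 * N + 2)) * squareProd N (2 * N + 2) (-2 - X) =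
      X * (X + (2 * N + 2)) * squareProd N (2 * N + 2) X := by
  rw [← progression_even, ← progression_even, prod_progression_reflect,
    show 2 * N + 2 = 2 * (N + 1) by ring, pow_mul]
  simp

theorem squareProd_reflect_odd' (N : ℕ) (X : ℂ) :
    (2 - X - (2 * N + 1)) * squareProd N (2 * N + 1) (2 - X) =
      -((X - (2 * N + 1)) * squareProd N (2 * N + 1) X) := by
  have h := squareProd_reflect_odd N (-X)
  rw [squareProd_neg, show -2 - -X = -(2 - X) by ring, squareProd_neg] at h
  linear_combination -h

theorem squareProd_reflect_even' (N : ℕ) (X : ℂ) :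
    (2 - X) * (2 - X - (2 * N + 2)) * squareProd N (2 * N + 2) (2 - X) =
      X * (X - (2 * N + 2)) * squareProd N (2 * N + 2) X := by
  have h := squareProd_reflect_even N (-X)
  rw [squareProd_neg, show -2 - -X = -(2 - X) by ring, squareProd_neg] at h
  linear_combination h

/-! ### The integrals of the `(2, 1; ρ)`-billiards -/

/-- The polynomial `w - c z ^ 2`. -/
def conicPoly (c : ℂ) : MvPolynomial (Fin 2) ℂ :=
  MvPolynomial.X 1 - MvPolynomial.C c * MvPolynomial.X 0 ^ 2

/-- The denominator `z ^ α w ^ β ∏ (w - c_j z ^ 2) ^ γ`. -/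
def tableDenom (α β γ N : ℕ) (c : ℕ → ℂ) : MvPolynomial (Fin 2) ℂ :=
  MvPolynomial.X 0 ^ α * MvPolynomial.X 1 ^ β * ∏ j ∈ Finset.Icc 1 N, conicPoly (c j) ^ γ

theorem evalAt_conicPoly (x : ℂ × ℂ) (c : ℂ) : evalAt x (conicPoly c) = x.2 - c * x.1 ^ 2 := by
  simp [evalAt, conicPoly]

theorem evalAt_tableDenom (x : ℂ × ℂ) (α β γ N : ℕ) (c : ℕ → ℂ) :
    evalAt x (tableDenom α β γ N c) =
      x.1 ^ α * x.2 ^ β * ∏ j ∈ Finset.Icc 1 N, (x.2 - c j * x.1 ^ 2) ^ γ := by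
  simp [evalAt, tableDenom, conicPoly]

theorem conicPoly_isWeightedHomogeneous (c : ℂ) :
    MvPolynomial.IsWeightedHomogeneous ![1, 2] (conicPoly c) 2 := by
  have hX0 : MvPolynomial.IsWeightedHomogeneous ![1, 2] (MvPolynomial.X 0 : MvPolynomial _ ℂ) 1 :=
    MvPolynomial.isWeightedHomogeneous_X ℂ ![1, 2] 0
  have hX1 : MvPolynomial.IsWeightedHomogeneous ![1, 2] (MvPolynomial.X 1 : MvPolynomial _ ℂ) 2 :=
    MvPolynomial.isWeightedHomogeneous_X ℂ ![1, 2] 1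
  exact hX1.sub (by simpa using (hX0.pow 2).C_mul c)

theorem tableDenom_isQuasihomogeneous (α β γ N : ℕ) (c : ℕ → ℂ) :
    IsQuasihomogeneous 2 1 (tableDenom α β γ N c) := by
  have hX0 : MvPolynomial.IsWeightedHomogeneous ![1, 2] (MvPolynomial.X 0 : MvPolynomial _ ℂ) 1 :=
    MvPolynomial.isWeightedHomogeneous_X ℂ ![1, 2] 0
  have hX1 : MvPolynomial.IsWeightedHomogeneous ![1, 2] (MvPolynomial.X 1 : MvPolynomial _ ℂ) 2 :=
    MvPolynomial.isWeightedHomogeneous_X ℂ ![1, 2] 1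
  exact ⟨_, ((hX0.pow α).mul (hX1.pow β)).mul (MvPolynomial.IsWeightedHomogeneous.prod _ _ _
    fun j _ => (conicPoly_isWeightedHomogeneous (c j)).pow γ)⟩

theorem mem_puncturedCurve_two_one {P : ℂ × ℂ} :
    P ∈ puncturedCurve 2 1 ↔ P.1 ≠ 0 ∧ P.2 = P.1 ^ 2 := by
  constructor
  · intro h
    exact ⟨(ne_zero_of_mem two_ne_zero one_ne_zero h).1, by simpa using h.1⟩
  · rintro ⟨h1, h2⟩
    refine ⟨by simpa using h2, fun h => h1 ?_⟩
    rw [h]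

/-- A criterion for `(w - z ^ 2) ^ L / (z ^ α w ^ β ∏ (w - c_j z ^ 2) ^ γ)` to be an integral. In
the coordinate of `linePoint` the numerator is a constant times `(x + 1) ^ (-2 L)`. So the function
is invariant as soon as the denominator times `(x + 1) ^ (2 L)` is invariant, and this is, up to a
constant, the polynomial in `hQ`. -/
theorem isQuasihomogeneousIntegral_of_reflect {L α β γ N δ : ℕ} {c : ℕ → ℂ} {ρ : ℂ} (hL : L ≠ 0)
    (hδ : δ + α + β + 2 * γ * N = 2 * L) (hc : ∀ j ∈ Finset.Icc 1 N, c j ≠ 1)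
    (hQ : ∀ x : ℂ, (ρ - 2 - x) ^ α * (ρ - 2 - x - 1) ^ β * (ρ - 2 - x + 1) ^ δ *
        (∏ j ∈ Finset.Icc 1 N, ((1 - c j) * (ρ - 2 - x) ^ 2 - 1)) ^ γ =
      x ^ α * (x - 1) ^ β * (x + 1) ^ δ * (∏ j ∈ Finset.Icc 1 N, ((1 - c j) * x ^ 2 - 1)) ^ γ) :
    IsQuasihomogeneousIntegral 2 1 ρ (algebraMap (MvPolynomial (Fin 2) ℂ) RatFun (conicPoly 1 ^ L) /
      algebraMap _ RatFun (tableDenom α β γ N c)) := by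
  have hinj := IsFractionRing.injective (MvPolynomial (Fin 2) ℂ) RatFun
  have h11 : evalAt (1, 1) (tableDenom α β γ N c) ≠ 0 := by
    rw [evalAt_tableDenom]
    simp only [one_pow, mul_one, one_mul]
    exact Finset.prod_ne_zero_iff.2 fun j hj => pow_ne_zero _ (sub_ne_zero.2 (hc j hj).symm)
  have hG : tableDenom α β γ N c ≠ 0 := by
    intro h
    rw [h] at h11
    simp [evalAt] at h11
  have hconic : ∀ P ∈ puncturedCurve 2 1, ∀ x : ℂ, x + 1 ≠ 0 → ∀ a : ℂ,
      (linePoint 2 1 P x).2 - a * (linePoint 2 1 P x).1 ^ 2 =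
        P.1 ^ 2 / (x + 1) ^ 2 * ((1 - a) * x ^ 2 - 1) := by
    intro P hP x hx a
    obtain ⟨-, h⟩ := mem_puncturedCurve_two_one.1 hP
    simp only [linePoint, h, Nat.cast_one, Nat.cast_ofNat]
    field_simp
    ring
  have hden : ∀ P ∈ puncturedCurve 2 1, ∀ x : ℂ, x + 1 ≠ 0 →
      (x + 1) ^ (2 * L) * evalAt (linePoint 2 1 P x) (tableDenom α β γ N c) =
        P.1 ^ α * P.2 ^ β * ((P.1 ^ 2) ^ γ) ^ N * (x ^ α * (x - 1) ^ β * (x + 1) ^ δ *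
          (∏ j ∈ Finset.Icc 1 N, ((1 - c j) * x ^ 2 - 1)) ^ γ) := by
    intro P hP x hx
    rw [evalAt_tableDenom, Finset.prod_pow, Finset.prod_congr rfl fun j _ => hconic P hP x hx (c j),
      Finset.prod_mul_distrib, Finset.prod_const, Nat.card_Icc, Nat.add_sub_cancel]
    generalize ∏ j ∈ Finset.Icc 1 N, ((1 - c j) * x ^ 2 - 1) = u
    simp only [linePoint, Nat.cast_one, Nat.cast_ofNat, ← hδ]
    rw [show x - (2 - 1) = x - 1 by ring, pow_add, pow_add, pow_add, mul_pow P.1, mul_pow P.2,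
      div_pow, div_pow, mul_pow _ u, div_pow]
    rw [div_pow]
    have e2 : (x + 1) ^ (2 * γ * N) = (((x + 1) ^ 2) ^ N) ^ γ := by
      rw [← pow_mul, ← pow_mul]
      congr 1
      ring
    have e3 : ((P.1 ^ 2) ^ N) ^ γ = ((P.1 ^ 2) ^ γ) ^ N := by
      rw [← pow_mul, ← pow_mul, ← pow_mul, ← pow_mul]
      congr 1
      ring
    rw [e2, e3]
    generalize hw : (((x + 1) ^ 2) ^ N) ^ γ = W
    have hW : W ≠ 0 := hw ▸ pow_ne_zero _ (pow_ne_zero _ (pow_ne_zero _ hx))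
    field_simp
  refine ⟨?_, ⟨conicPoly 1 ^ L, tableDenom α β γ N c, ?_, tableDenom_isQuasihomogeneous α β γ N c,
    hG, rfl⟩, isBilliardIntegral_of_linePoint two_ne_zero one_ne_zero hG ?_ ?_⟩
  · intro v hv
    rw [div_eq_iff ((map_ne_zero_iff _ hinj).2 hG),
      IsScalarTower.algebraMap_apply ℂ (MvPolynomial (Fin 2) ℂ) RatFun, ← map_mul,
      MvPolynomial.algebraMap_eq] at hv
    have hv' := hinj hv
    have h1 : evalAt (1, 1) (conicPoly 1 ^ L) = v * evalAt (1, 1) (tableDenom α β γ N c) := by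
      simpa [evalAt] using congrArg (evalAt (1, 1)) hv'
    have h2 : evalAt (1, 1) (conicPoly 1 ^ L) = 0 := by
      simp [evalAt, conicPoly, hL]
    have h3 : v = 0 := by
      rw [h2, eq_comm, mul_eq_zero] at h1
      exact h1.resolve_right h11
    have h4 := congrArg (evalAt (0, 1)) hv'
    simp [evalAt, conicPoly, h3] at h4
  · exact ⟨_, (conicPoly_isWeightedHomogeneous 1).pow L⟩
  · intro P hP
    have hfin : ((Polynomial.X ^ α * (Polynomial.X - Polynomial.C 1) ^ β *
        (Polynomial.X - Polynomial.C (-1)) ^ δ * (∏ j ∈ Finset.Icc 1 N,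
          (Polynomial.C (1 - c j) * Polynomial.X ^ 2 - 1)) ^ γ : Polynomial ℂ).rootSet ℂ).Finite :=
      Polynomial.rootSet_finite _ _
    refine hfin.subset ?_
    rintro x ⟨hx, hx'⟩
    rw [Nat.cast_one] at hx
    have h1 := hden P hP x hx
    obtain ⟨h2, h3⟩ := mem_puncturedCurve_two_one.1 hP
    have h4 : P.2 ≠ 0 := h3 ▸ pow_ne_zero _ h2
    rw [hx', mul_zero, eq_comm, mul_eq_zero, or_iff_right (mul_ne_zero (mul_ne_zero
      (pow_ne_zero _ h2) (pow_ne_zero _ h4)) (pow_ne_zero _ (pow_ne_zero _ (pow_ne_zero _ h2))))]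
      at h1
    rw [Polynomial.mem_rootSet]
    refine ⟨?_, ?_⟩
    · refine mul_ne_zero (mul_ne_zero (mul_ne_zero (pow_ne_zero _ Polynomial.X_ne_zero)
        (pow_ne_zero _ (Polynomial.X_sub_C_ne_zero _)))
        (pow_ne_zero _ (Polynomial.X_sub_C_ne_zero _))) (pow_ne_zero _
        (Finset.prod_ne_zero_iff.2 fun j _ h => ?_))
      have h5 := congrArg (Polynomial.eval 0) h
      simp at h5
    · simpa [Polynomial.eval_prod] using h1
  · intro P hP x hx hy hg hg'
    rw [Nat.cast_one] at hx
    rw [Nat.cast_one, one_mul] at hy hg' ⊢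
    have h1 := hden P hP x hx
    have h2 := hden P hP _ hy
    rw [hQ, ← h1] at h2
    have hnum : ∀ y : ℂ, y + 1 ≠ 0 → evalAt (linePoint 2 1 P y) (conicPoly 1 ^ L) =
        (-P.1 ^ 2) ^ L / (y + 1) ^ (2 * L) := by
      intro y hy
      have h3 := hconic P hP y hy 1
      rw [← evalAt_conicPoly] at h3
      rw [evalAt, map_pow, ← evalAt, h3, pow_mul, ← div_pow (-P.1 ^ 2), sub_self, zero_mul,
        zero_sub, mul_neg_one, neg_div]
    rw [hnum x hx, hnum _ hy]
    have e1 := pow_ne_zero (2 * L) hx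
    have e2 := pow_ne_zero (2 * L) hy
    field_simp
    linear_combination (-P.1 ^ 2) ^ L * h2

/-! ### The table -/

/-- The index set of the table of integrals: the residue `2`, and the residues `2 ± 2 / K` with
`K = 2 N + 1` (`oddMinus`, `oddPlus`) or `K = 2 N + 2` (`evenMinus`, `evenPlus`). -/
inductive TableIndex
  | two
  | oddMinus (N : ℕ)
  | oddPlus (N : ℕ)
  | evenMinus (N : ℕ)
  | evenPlus (N : ℕ)

/-- The function `(w - z ^ 2) ^ L / (z ^ α w ^ β ∏ (w - c_j z ^ 2) ^ γ)`. -/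
def tableFrac (L α β γ N : ℕ) (c : ℕ → ℂ) : RatFun :=
  algebraMap (MvPolynomial (Fin 2) ℂ) RatFun (conicPoly 1 ^ L) /
    algebraMap _ RatFun (tableDenom α β γ N c)

namespace TableIndex

/-- The integer `s` such that the row belongs to the residue `2 + 2 / s`. The residue `2` is
obtained from `s = 0`, where `2 / s = 0` by convention. -/
def slope : TableIndex → ℤ
  | two => 0
  | oddMinus N => -(2 * N + 1)
  | oddPlus N => 2 * N + 1
  | evenMinus N => -(2 * N + 2)
  | evenPlus N => 2 * N + 2

/-- The residue of a row of the table. -/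
def residue (i : TableIndex) : ℂ := 2 + 2 / (i.slope : ℂ)

/-- The function in a row of the table. For `N = 0` the four families contain `R_0`, `R_4`, `R_1`
and `R_3`. -/
def function : TableIndex → RatFun
  | two => tableFrac 1 0 1 0 0 0
  | oddMinus N => tableFrac (2 * N + 1) 0 0 2 N (cOdd N)
  | oddPlus N => tableFrac (2 * N + 1) 0 2 2 N (cOdd N)
  | evenMinus N => tableFrac (N + 1) 1 0 1 N (cEven N)
  | evenPlus N => tableFrac (N + 1) 1 1 1 N (cEven N)

theorem slope_injective : Function.Injective slope := by
  intro i j h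
  cases i <;> cases j <;> simp only [slope] at h <;>
    first | rfl | (exfalso; omega) | (congr 1; omega)

theorem residue_injective : Function.Injective residue := by
  intro i j h
  apply slope_injective
  simpa [residue, div_eq_mul_inv] using h

end TableIndex

theorem conicFun_eq (c : ℂ) :
    conicFun c = algebraMap (MvPolynomial (Fin 2) ℂ) RatFun (conicPoly c) := by
  rw [conicFun, conicPoly, map_sub, map_mul, map_pow,
    IsScalarTower.algebraMap_apply ℂ (MvPolynomial (Fin 2) ℂ) RatFun, MvPolynomial.algebraMap_eq]
  rfl

theorem conicFun_one : conicFun 1 = wCoord - zCoord ^ 2 := by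
  rw [conicFun, map_one, one_mul]

theorem tableFrac_eq (L α β γ N : ℕ) (c : ℕ → ℂ) :
    tableFrac L α β γ N c = (wCoord - zCoord ^ 2) ^ L /
      (zCoord ^ α * wCoord ^ β * ∏ j ∈ Finset.Icc 1 N, conicFun (c j) ^ γ) := by
  rw [tableFrac, ← conicFun_one, conicFun_eq, map_pow, tableDenom, map_mul, map_mul, map_pow,
    map_pow, map_prod]
  congr 2
  refine Finset.prod_congr rfl fun j _ => ?_
  rw [conicFun_eq, map_pow]

theorem isTableIntegral_iff {ρ : ℂ} {R : RatFun} :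
    IsTableIntegral ρ R ↔ ∃ i : TableIndex, ρ = i.residue ∧ R = i.function := by
  constructor
  · rintro (⟨rfl, rfl⟩ | ⟨rfl, rfl⟩ | ⟨rfl, rfl⟩ | ⟨rfl, rfl⟩ | ⟨rfl, rfl⟩ | ⟨N, -, rfl, rfl⟩ |
      ⟨N, -, rfl, rfl⟩ | ⟨N, -, rfl, rfl⟩ | ⟨N, -, rfl, rfl⟩)
    · refine ⟨.oddMinus 0, ?_, ?_⟩
      · norm_num [TableIndex.residue, TableIndex.slope]
      · simp [TableIndex.function, tableFrac_eq]
    · refine ⟨.evenMinus 0, ?_, ?_⟩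
      · norm_num [TableIndex.residue, TableIndex.slope]
      · simp [TableIndex.function, tableFrac_eq]
    · refine ⟨.two, ?_, ?_⟩
      · norm_num [TableIndex.residue, TableIndex.slope]
      · simp [TableIndex.function, tableFrac_eq]
    · refine ⟨.evenPlus 0, ?_, ?_⟩
      · norm_num [TableIndex.residue, TableIndex.slope]
      · simp [TableIndex.function, tableFrac_eq]
    · refine ⟨.oddPlus 0, ?_, ?_⟩
      · norm_num [TableIndex.residue, TableIndex.slope]
      · simp [TableIndex.function, tableFrac_eq]
    · refine ⟨.oddMinus N, ?_, ?_⟩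
      · simp only [TableIndex.residue, TableIndex.slope]
        push_cast
        rw [div_neg, ← sub_eq_add_neg]
      · simp [TableIndex.function, tableFrac_eq]
    · refine ⟨.oddPlus N, ?_, ?_⟩
      · simp [TableIndex.residue, TableIndex.slope]
      · simp [TableIndex.function, tableFrac_eq]
    · refine ⟨.evenMinus N, ?_, ?_⟩
      · have hN : (N : ℂ) + 1 ≠ 0 := Nat.cast_add_one_ne_zero N
        simp only [TableIndex.residue, TableIndex.slope]
        push_cast
        rw [div_neg, ← sub_eq_add_neg]
        congr 1
        field_simp
      · simp [TableIndex.function, tableFrac_eq]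
    · refine ⟨.evenPlus N, ?_, ?_⟩
      · have hN : (N : ℂ) + 1 ≠ 0 := Nat.cast_add_one_ne_zero N
        simp only [TableIndex.residue, TableIndex.slope]
        push_cast
        congr 1
        field_simp
      · simp [TableIndex.function, tableFrac_eq]
  · rintro ⟨i, rfl, rfl⟩
    cases i with
    | two =>
      refine .inr (.inr (.inl ⟨?_, ?_⟩))
      · norm_num [TableIndex.residue, TableIndex.slope]
      · simp [TableIndex.function, tableFrac_eq]
    | oddMinus N =>
      rcases N.eq_zero_or_pos with rfl | hN
      · refine .inl ⟨?_, ?_⟩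
        · norm_num [TableIndex.residue, TableIndex.slope]
        · simp [TableIndex.function, tableFrac_eq]
      · refine .inr (.inr (.inr (.inr (.inr (.inl ⟨N, hN, ?_, ?_⟩)))))
        · simp only [TableIndex.residue, TableIndex.slope]
          push_cast
          rw [div_neg, ← sub_eq_add_neg]
        · simp [TableIndex.function, tableFrac_eq]
    | oddPlus N =>
      rcases N.eq_zero_or_pos with rfl | hN
      · refine .inr (.inr (.inr (.inr (.inl ⟨?_, ?_⟩))))
        · norm_num [TableIndex.residue, TableIndex.slope]
        · simp [TableIndex.function, tableFrac_eq]
      · refine .inr (.inr (.inr (.inr (.inr (.inr (.inl ⟨N, hN, ?_, ?_⟩))))))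
        · simp [TableIndex.residue, TableIndex.slope]
        · simp [TableIndex.function, tableFrac_eq]
    | evenMinus N =>
      rcases N.eq_zero_or_pos with rfl | hN
      · refine .inr (.inl ⟨?_, ?_⟩)
        · norm_num [TableIndex.residue, TableIndex.slope]
        · simp [TableIndex.function, tableFrac_eq]
      · refine .inr (.inr (.inr (.inr (.inr (.inr (.inr (.inl ⟨N, hN, ?_, ?_⟩)))))))
        · have hN : (N : ℂ) + 1 ≠ 0 := Nat.cast_add_one_ne_zero N
          simp only [TableIndex.residue, TableIndex.slope]
          push_cast
          rw [div_neg, ← sub_eq_add_neg]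
          congr 1
          field_simp
        · simp [TableIndex.function, tableFrac_eq]
    | evenPlus N =>
      rcases N.eq_zero_or_pos with rfl | hN
      · refine .inr (.inr (.inr (.inl ⟨?_, ?_⟩)))
        · norm_num [TableIndex.residue, TableIndex.slope]
        · simp [TableIndex.function, tableFrac_eq]
      · refine .inr (.inr (.inr (.inr (.inr (.inr (.inr (.inr ⟨N, hN, ?_, ?_⟩)))))))
        · have hN : (N : ℂ) + 1 ≠ 0 := Nat.cast_add_one_ne_zero N
          simp only [TableIndex.residue, TableIndex.slope]
          push_cast
          congr 1
          field_simp
        · simp [TableIndex.function, tableFrac_eq]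

theorem exists_residue_eq {ρ : ℂ} (hρ : ρ ∈ residues) : ∃ i : TableIndex, ρ = i.residue := by
  rcases hρ with h | ⟨k, hk, h⟩
  · simp only [Set.mem_insert_iff, Set.mem_singleton_iff] at h
    rcases h with rfl | rfl | rfl | rfl | rfl
    · exact ⟨.oddMinus 0, by norm_num [TableIndex.residue, TableIndex.slope]⟩
    · exact ⟨.evenMinus 0, by norm_num [TableIndex.residue, TableIndex.slope]⟩
    · exact ⟨.two, by norm_num [TableIndex.residue, TableIndex.slope]⟩
    · exact ⟨.evenPlus 0, by norm_num [TableIndex.residue, TableIndex.slope]⟩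
    · exact ⟨.oddPlus 0, by norm_num [TableIndex.residue, TableIndex.slope]⟩
  · rcases Nat.even_or_odd' k with ⟨M, rfl | rfl⟩
    · obtain ⟨N, rfl⟩ : ∃ N, M = N + 1 := ⟨M - 1, by omega⟩
      rcases h with rfl | rfl
      · exact ⟨.evenPlus N, by simp [TableIndex.residue, TableIndex.slope, mul_add]⟩
      · refine ⟨.evenMinus N, ?_⟩
        simp only [TableIndex.residue, TableIndex.slope]
        push_cast
        rw [div_neg, ← sub_eq_add_neg, mul_add, mul_one]
    · rcases h with rfl | rfl
      · exact ⟨.oddPlus M, by simp [TableIndex.residue, TableIndex.slope]⟩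
      · refine ⟨.oddMinus M, ?_⟩
        simp only [TableIndex.residue, TableIndex.slope]
        push_cast
        rw [div_neg, ← sub_eq_add_neg]

theorem existsUnique_isTableIntegral {ρ : ℂ} (hρ : ρ ∈ residues) :
    ∃! R : RatFun, IsTableIntegral ρ R := by
  obtain ⟨i, rfl⟩ := exists_residue_eq hρ
  refine ⟨i.function, isTableIntegral_iff.2 ⟨i, rfl, rfl⟩, fun R hR => ?_⟩
  obtain ⟨j, hj, rfl⟩ := isTableIntegral_iff.1 hR
  rw [TableIndex.residue_injective hj]

theorem odd_sub_ne_zero (N j : ℕ) : 2 * (N : ℂ) + 1 - 2 * j ≠ 0 := by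
  have h : (2 * (N : ℤ) + 1 - 2 * j) ≠ 0 := by omega
  exact_mod_cast h

theorem even_sub_ne_zero {N j : ℕ} (hj : j ∈ Finset.Icc 1 N) : 2 * (N : ℂ) + 2 - 2 * j ≠ 0 := by
  have h : (2 * (N : ℤ) + 2 - 2 * j) ≠ 0 := by
    have := Finset.mem_Icc.1 hj
    omega
  exact_mod_cast h

theorem one_sub_cOdd (N j : ℕ) :
    1 - cOdd N j = (2 * (N : ℂ) + 1) ^ 2 / (2 * (N : ℂ) + 1 - 2 * j) ^ 2 := by
  have h := odd_sub_ne_zero N j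
  rw [cOdd, eq_div_iff (pow_ne_zero 2 h), sub_mul, div_mul_cancel₀ _ (pow_ne_zero 2 h)]
  ring

theorem one_sub_cEven {N j : ℕ} (hj : j ∈ Finset.Icc 1 N) :
    1 - cEven N j = (2 * (N : ℂ) + 2) ^ 2 / (2 * (N : ℂ) + 2 - 2 * j) ^ 2 := by
  have h := even_sub_ne_zero hj
  have h' : (N : ℂ) + 1 - j ≠ 0 := fun h' => h (by linear_combination 2 * h')
  rw [cEven, show 2 * (N : ℂ) + 2 - 2 * j = 2 * (N + 1 - j) by ring]
  field_simp
  ring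

theorem cOdd_ne_one (N j : ℕ) : cOdd N j ≠ 1 := by
  intro h
  have h1 := one_sub_cOdd N j
  rw [h, sub_self, eq_comm, div_eq_zero_iff, or_iff_left (pow_ne_zero _ (odd_sub_ne_zero N j))]
    at h1
  have h2 : (2 * (N : ℂ) + 1) ≠ 0 := by exact_mod_cast Nat.succ_ne_zero (2 * N)
  exact pow_ne_zero 2 h2 h1

theorem cEven_ne_one {N j : ℕ} (hj : j ∈ Finset.Icc 1 N) : cEven N j ≠ 1 := by
  intro h
  have h1 := one_sub_cEven hj
  rw [h, sub_self, eq_comm, div_eq_zero_iff, or_iff_left (pow_ne_zero _ (even_sub_ne_zero hj))]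
    at h1
  have h2 : (2 * (N : ℂ) + 2) ≠ 0 := by exact_mod_cast Nat.succ_ne_zero (2 * N + 1)
  exact pow_ne_zero 2 h2 h1

/-- If `1 - c_j = K ^ 2 / (K - 2 j) ^ 2`, the factors of the denominator on a tangent line are, up
to constants, the factors of `squareProd` at `K x`. -/
theorem prod_eq_squareProd {N : ℕ} {K : ℂ} {c : ℕ → ℂ}
    (hK : ∀ j ∈ Finset.Icc 1 N, K - 2 * (j : ℂ) ≠ 0)
    (hc : ∀ j ∈ Finset.Icc 1 N, 1 - c j = K ^ 2 / (K - 2 * (j : ℂ)) ^ 2) (x : ℂ) :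
    ∏ j ∈ Finset.Icc 1 N, ((1 - c j) * x ^ 2 - 1) =
      squareProd N K (K * x) / ∏ j ∈ Finset.Icc 1 N, (K - 2 * (j : ℂ)) ^ 2 := by
  rw [squareProd, ← Finset.prod_div_distrib]
  refine Finset.prod_congr rfl fun j hj => ?_
  have h := hK j hj
  rw [hc j hj]
  field_simp

/-- In each row `ρ - 2 = ±2 / K`, and in the coordinate `X = K x` the criterion
`isQuasihomogeneousIntegral_of_reflect` becomes one of the identities `squareProd_reflect_*`. -/
theorem TableIndex.isQuasihomogeneousIntegral (i : TableIndex) :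
    IsQuasihomogeneousIntegral 2 1 i.residue i.function := by
  cases i with
  | two =>
    -- on a tangent line the denominator is `x ^ 2 - 1`, up to a constant and a power of `x + 1`
    refine isQuasihomogeneousIntegral_of_reflect (δ := 1) one_ne_zero rfl (by simp) fun x => ?_
    simp only [residue, slope, Int.cast_zero, div_zero]
    simp
    ring
  | oddMinus N =>
    refine isQuasihomogeneousIntegral_of_reflect (δ := 2) (Nat.succ_ne_zero _) (by ring)
      (fun j _ => cOdd_ne_one N j) fun x => ?_
    have hK : 2 * (N : ℂ) + 1 ≠ 0 := by exact_mod_cast Nat.succ_ne_zero (2 * N)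
    have e : (TableIndex.oddMinus N).residue - 2 - x =
        (-2 - (2 * (N : ℂ) + 1) * x) / (2 * (N : ℂ) + 1) := by
      simp only [residue, slope]
      push_cast
      rw [div_neg]
      field_simp
      ring
    rw [e, prod_eq_squareProd (fun j _ => odd_sub_ne_zero N j) (fun j _ => one_sub_cOdd N j),
      prod_eq_squareProd (fun j _ => odd_sub_ne_zero N j) (fun j _ => one_sub_cOdd N j),
      mul_div_cancel₀ _ hK]
    have h := squareProd_reflect_odd N ((2 * (N : ℂ) + 1) * x)
    generalize (∏ j ∈ Finset.Icc 1 N, (2 * (N : ℂ) + 1 - 2 * (j : ℂ)) ^ 2) = D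
    generalize squareProd N (2 * (N : ℂ) + 1) ((2 * (N : ℂ) + 1) * x) = S at h ⊢
    generalize squareProd N (2 * (N : ℂ) + 1) (-2 - (2 * (N : ℂ) + 1) * x) = S' at h ⊢
    generalize 2 * (N : ℂ) + 1 = K at h hK ⊢
    have e1 : (-2 - K * x) / K + 1 = (-2 - K * x + K) / K := by field_simp
    have e2 : x + 1 = (K * x + K) / K := by field_simp
    rw [e1, e2]
    linear_combination ((-2 - K * x + K) * S' - (K * x + K) * S) / (K * D) ^ 2 * h
  | oddPlus N =>
    refine isQuasihomogeneousIntegral_of_reflect (δ := 0) (Nat.succ_ne_zero _) (by ring)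
      (fun j _ => cOdd_ne_one N j) fun x => ?_
    have hK : 2 * (N : ℂ) + 1 ≠ 0 := by exact_mod_cast Nat.succ_ne_zero (2 * N)
    have e : (TableIndex.oddPlus N).residue - 2 - x =
        (2 - (2 * (N : ℂ) + 1) * x) / (2 * (N : ℂ) + 1) := by
      simp only [residue, slope]
      push_cast
      field_simp
      ring
    rw [e, prod_eq_squareProd (fun j _ => odd_sub_ne_zero N j) (fun j _ => one_sub_cOdd N j),
      prod_eq_squareProd (fun j _ => odd_sub_ne_zero N j) (fun j _ => one_sub_cOdd N j),
      mul_div_cancel₀ _ hK]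
    have h := squareProd_reflect_odd' N ((2 * (N : ℂ) + 1) * x)
    generalize (∏ j ∈ Finset.Icc 1 N, (2 * (N : ℂ) + 1 - 2 * (j : ℂ)) ^ 2) = D
    generalize squareProd N (2 * (N : ℂ) + 1) ((2 * (N : ℂ) + 1) * x) = S at h ⊢
    generalize squareProd N (2 * (N : ℂ) + 1) (2 - (2 * (N : ℂ) + 1) * x) = S' at h ⊢
    generalize 2 * (N : ℂ) + 1 = K at h hK ⊢
    have e1 : (2 - K * x) / K - 1 = (2 - K * x - K) / K := by field_simp
    have e2 : x - 1 = (K * x - K) / K := by field_simp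
    rw [e1, e2]
    linear_combination ((2 - K * x - K) * S' - (K * x - K) * S) / (K * D) ^ 2 * h
  | evenMinus N =>
    refine isQuasihomogeneousIntegral_of_reflect (δ := 1) (Nat.succ_ne_zero _) (by ring)
      (fun j hj => cEven_ne_one hj) fun x => ?_
    have hK : 2 * (N : ℂ) + 2 ≠ 0 := by exact_mod_cast Nat.succ_ne_zero (2 * N + 1)
    have e : (TableIndex.evenMinus N).residue - 2 - x =
        (-2 - (2 * (N : ℂ) + 2) * x) / (2 * (N : ℂ) + 2) := by
      simp only [residue, slope]
      push_cast
      rw [div_neg]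
      field_simp
      ring
    rw [e, prod_eq_squareProd (fun j hj => even_sub_ne_zero hj) (fun j hj => one_sub_cEven hj),
      prod_eq_squareProd (fun j hj => even_sub_ne_zero hj) (fun j hj => one_sub_cEven hj),
      mul_div_cancel₀ _ hK]
    have h := squareProd_reflect_even N ((2 * (N : ℂ) + 2) * x)
    generalize (∏ j ∈ Finset.Icc 1 N, (2 * (N : ℂ) + 2 - 2 * (j : ℂ)) ^ 2) = D
    generalize squareProd N (2 * (N : ℂ) + 2) ((2 * (N : ℂ) + 2) * x) = S at h ⊢
    generalize squareProd N (2 * (N : ℂ) + 2) (-2 - (2 * (N : ℂ) + 2) * x) = S' at h ⊢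
    generalize 2 * (N : ℂ) + 2 = K at h hK ⊢
    have e1 : (-2 - K * x) / K + 1 = (-2 - K * x + K) / K := by field_simp
    have e2 : x + 1 = (K * x + K) / K := by field_simp
    have e3 : x = K * x / K := by field_simp
    rw [e1, e2]
    -- the factor `x` of the right-hand side, in the coordinate `K x`
    nth_rw 4 [e3]
    linear_combination 1 / (K ^ 2 * D) * h
  | evenPlus N =>
    refine isQuasihomogeneousIntegral_of_reflect (δ := 0) (Nat.succ_ne_zero _) (by ring)
      (fun j hj => cEven_ne_one hj) fun x => ?_
    have hK : 2 * (N : ℂ) + 2 ≠ 0 := by exact_mod_cast Nat.succ_ne_zero (2 * N + 1)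
    have e : (TableIndex.evenPlus N).residue - 2 - x =
        (2 - (2 * (N : ℂ) + 2) * x) / (2 * (N : ℂ) + 2) := by
      simp only [residue, slope]
      push_cast
      field_simp
      ring
    rw [e, prod_eq_squareProd (fun j hj => even_sub_ne_zero hj) (fun j hj => one_sub_cEven hj),
      prod_eq_squareProd (fun j hj => even_sub_ne_zero hj) (fun j hj => one_sub_cEven hj),
      mul_div_cancel₀ _ hK]
    have h := squareProd_reflect_even' N ((2 * (N : ℂ) + 2) * x)
    generalize (∏ j ∈ Finset.Icc 1 N, (2 * (N : ℂ) + 2 - 2 * (j : ℂ)) ^ 2) = D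
    generalize squareProd N (2 * (N : ℂ) + 2) ((2 * (N : ℂ) + 2) * x) = S at h ⊢
    generalize squareProd N (2 * (N : ℂ) + 2) (2 - (2 * (N : ℂ) + 2) * x) = S' at h ⊢
    generalize 2 * (N : ℂ) + 2 = K at h hK ⊢
    have e1 : (2 - K * x) / K - 1 = (2 - K * x - K) / K := by field_simp
    have e2 : x - 1 = (K * x - K) / K := by field_simp
    have e3 : x = K * x / K := by field_simp
    rw [e1, e2]
    -- the factor `x` of the right-hand side, in the coordinate `K x`
    nth_rw 4 [e3]
    linear_combination 1 / (K ^ 2 * D) * h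

/-! ### The variable change on points and tangent lines -/

theorem changeAffine_changeAffine {x : ℂ × ℂ} (hx : x.2 ≠ 0) :
    changeAffine (changeAffine x) = x := by
  ext <;> simp [changeAffine, hx]

theorem changeAffine_mem {P : ℂ × ℂ} (hP : P ∈ puncturedCurve 2 1) :
    changeAffine P ∈ puncturedCurve 2 1 := by
  rw [mem_puncturedCurve_two_one] at hP ⊢
  obtain ⟨h1, h2⟩ := hP
  simp only [changeAffine, h2]
  refine ⟨div_ne_zero h1 (pow_ne_zero 2 h1), ?_⟩
  field_simp

theorem bijOn_changeAffine :
    Set.BijOn changeAffine (puncturedCurve 2 1) (puncturedCurve 2 1) := by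
  have h : ∀ P ∈ puncturedCurve 2 1, changeAffine (changeAffine P) = P := fun P hP =>
    changeAffine_changeAffine (ne_zero_of_mem two_ne_zero one_ne_zero hP).2
  exact Set.InvOn.bijOn ⟨h, h⟩ (fun _ => changeAffine_mem) fun _ => changeAffine_mem

theorem changeVector_ne_zero {v : Fin 3 → ℂ} (hv : v ≠ 0) : ![v 0, v 2, v 1] ≠ 0 := by
  intro h
  apply hv
  ext i
  fin_cases i
  · exact congrFun h 0
  · exact congrFun h 2
  · exact congrFun h 1

theorem changeProj_mk (v : Fin 3 → ℂ) (hv : v ≠ 0) :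
    changeProj (Projectivization.mk ℂ v hv) =
      Projectivization.mk ℂ ![v 0, v 2, v 1] (changeVector_ne_zero hv) := by
  rw [changeProj, Projectivization.map_mk]
  congr 1
  ext i
  fin_cases i <;> simp [LinearEquiv.funCongrLeft, LinearMap.funLeft, Equiv.swap_apply_def]

theorem changeProj_changeProj (x : CP2) : changeProj (changeProj x) = x := by
  induction x using Projectivization.ind with
  | h v hv =>
    rw [changeProj_mk, changeProj_mk]
    congr 1
    ext i
    fin_cases i <;> rfl

theorem changeProj_mem_tangentLine {P : ℂ × ℂ} (hP : P ∈ puncturedCurve 2 1) {x : CP2}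
    (hx : x ∈ tangentLine 2 1 P) : changeProj x ∈ tangentLine 2 1 (changeAffine P) := by
  induction x using Projectivization.ind with
  | h v hv =>
    rw [changeProj_mk, mem_tangentLine_mk]
    rw [mem_tangentLine_mk] at hx
    obtain ⟨h1, h2⟩ := mem_puncturedCurve_two_one.1 hP
    simp only [changeAffine, h2] at hx ⊢
    simp at hx ⊢
    field_simp
    linear_combination hx

theorem image_changeProj_tangentLine {P : ℂ × ℂ} (hP : P ∈ puncturedCurve 2 1) :
    changeProj '' tangentLine 2 1 P = tangentLine 2 1 (changeAffine P) := by
  ext y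
  constructor
  · rintro ⟨x, hx, rfl⟩
    exact changeProj_mem_tangentLine hP hx
  · intro hy
    refine ⟨changeProj y, ?_, changeProj_changeProj y⟩
    have h := changeProj_mem_tangentLine (changeAffine_mem hP) hy
    rwa [changeAffine_changeAffine (ne_zero_of_mem two_ne_zero one_ne_zero hP).2] at h

/-- On a tangent line to the conic, the variable change acts as `ζ ↦ ζ / (2 ζ - 1)`, which is
`η_2`. -/
theorem zeta_changeProj {P : ℂ × ℂ} (hP : P ∈ puncturedCurve 2 1) {x : CP2}
    (hx : x ∈ tangentLine 2 1 P) :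
    zeta (changeAffine P) (changeProj x) = eta 2 (zeta P x) := by
  induction x using Projectivization.ind with
  | h v hv =>
    obtain ⟨h1, h2⟩ := mem_puncturedCurve_two_one.1 hP
    rw [mem_tangentLine_mk] at hx
    simp only [h2] at hx
    simp at hx
    have hx' : v 1 = 2 * P.1 * v 0 - P.1 ^ 2 * v 2 := by linear_combination hx
    rw [changeProj_mk, zeta_mk, zeta_mk]
    simp only [changeAffine, h2, Matrix.cons_val_zero, Matrix.cons_val]
    by_cases h : v 2 = 0
    · have h0 : v 0 ≠ 0 := by
        intro h0
        apply hv
        ext i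
        fin_cases i
        · exact h0
        · simp [hx', h0, h]
        · exact h
      have h3 : 2 * P.1 * v 0 ≠ 0 := by simp [h0, h1]
      rw [hx', h]
      simp only [mul_zero, sub_zero, h3, if_false, if_true]
      simp only [eta, two_ne_zero, if_false, OnePoint.coe_eq_coe]
      field_simp
      norm_num
    · have e : 2 * (v 0 / v 2 / P.1) - (2 - 1) = v 1 / (v 2 * P.1 ^ 2) := by
        rw [hx']
        field_simp
        ring
      simp only [h, if_false, eta, e]
      by_cases h3 : v 1 = 0
      · simp [h3]
      · have h4 : v 1 / (v 2 * P.1 ^ 2) ≠ 0 := by simp [h1, h, h3]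
        simp only [h3, h4, if_false, OnePoint.coe_eq_coe]
        field_simp
        ring

/-- The point of the Riemann sphere with homogeneous coordinates `[a : b]`. -/
def spherePoint (a b : ℂ) : OnePoint ℂ := if b = 0 then ∞ else ((a / b : ℂ) : OnePoint ℂ)

theorem eta_spherePoint (ρ : ℂ) {a b : ℂ} (h : a ≠ 0 ∨ b ≠ 0) :
    eta ρ (spherePoint a b) =
      spherePoint ((ρ - 1) * a - (ρ - 2) * b) (ρ * a - (ρ - 1) * b) := by
  by_cases hb : b = 0
  · have ha : a ≠ 0 := h.resolve_right (not_not.2 hb)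
    by_cases hρ : ρ = 0
    · simp [spherePoint, hb, eta, hρ]
    · simp [spherePoint, hb, eta, hρ, ha, mul_div_mul_right]
  · have e₁ : ρ * (a / b) - (ρ - 1) = (ρ * a - (ρ - 1) * b) / b := by field_simp
    have e₂ : (ρ - 1) * (a / b) - (ρ - 2) = ((ρ - 1) * a - (ρ - 2) * b) / b := by field_simp
    simp only [spherePoint, hb, if_false, eta, e₁, e₂, div_eq_zero_iff, or_false,
      div_div_div_cancel_right₀ hb]

/-- The matrix of `η_ρ` has determinant `-1`. -/
theorem eta_coords_ne_zero (ρ : ℂ) {a b : ℂ} (h : a ≠ 0 ∨ b ≠ 0) :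
    (ρ - 1) * a - (ρ - 2) * b ≠ 0 ∨ ρ * a - (ρ - 1) * b ≠ 0 := by
  by_contra! h'
  obtain ⟨h₁, h₂⟩ := h'
  have ha : a = 0 := by linear_combination (ρ - 1) * h₁ - (ρ - 2) * h₂
  have hb : b = 0 := by linear_combination ρ * h₁ - (ρ - 1) * h₂
  exact h.elim (· ha) (· hb)

theorem eta_two_eta (ρ : ℂ) (ζ : OnePoint ℂ) : eta (4 - ρ) (eta 2 ζ) = eta 2 (eta ρ ζ) := by
  obtain ⟨a, b, h, rfl⟩ : ∃ a b : ℂ, (a ≠ 0 ∨ b ≠ 0) ∧ ζ = spherePoint a b := by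
    induction ζ using OnePoint.rec with
    | infty => exact ⟨1, 0, by simp, by simp [spherePoint]⟩
    | coe ζ => exact ⟨ζ, 1, by simp, by simp [spherePoint]⟩
  rw [eta_spherePoint _ h, eta_spherePoint _ h, eta_spherePoint _ (eta_coords_ne_zero _ h),
    eta_spherePoint _ (eta_coords_ne_zero _ h)]
  congr 1 <;> ring

theorem billiardMap_changeProj_iff {P : ℂ × ℂ} (hP : P ∈ puncturedCurve 2 1) (ρ : ℂ) (x y : CP2) :
    BilliardMap 2 1 ρ P x y ↔
      BilliardMap 2 1 (4 - ρ) (changeAffine P) (changeProj x) (changeProj y) := by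
  have key : ∀ {P : ℂ × ℂ}, P ∈ puncturedCurve 2 1 → ∀ {ρ : ℂ} {x y : CP2},
      BilliardMap 2 1 ρ P x y →
        BilliardMap 2 1 (4 - ρ) (changeAffine P) (changeProj x) (changeProj y) := by
    rintro P hP ρ x y ⟨hx, hy, h⟩
    refine ⟨changeProj_mem_tangentLine hP hx, changeProj_mem_tangentLine hP hy, ?_⟩
    rw [zeta_changeProj hP hx, zeta_changeProj hP hy, h, eta_two_eta]
  refine ⟨key hP, fun h => ?_⟩
  have h' := key (changeAffine_mem hP) h
  rwa [changeAffine_changeAffine (ne_zero_of_mem two_ne_zero one_ne_zero hP).2,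
    changeProj_changeProj, changeProj_changeProj, sub_sub_cancel] at h'

/-! ### The variable change on rational functions -/

theorem wCoord_ne_zero : wCoord ≠ 0 :=
  (map_ne_zero_iff _ (IsFractionRing.injective (MvPolynomial (Fin 2) ℂ) RatFun)).2
    (MvPolynomial.X_ne_zero 1)

/-- The substitution `(z, w) ↦ (z / w, 1 / w)` into polynomials. -/
def changePoly : MvPolynomial (Fin 2) ℂ →ₐ[ℂ] RatFun :=
  MvPolynomial.aeval ![zCoord / wCoord, 1 / wCoord]

/-- The denominator of `f (z / w, 1 / w)` is a power of `w`, and the values of the numerator are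
those of `f` at the transformed points, up to a power of `w`. -/
theorem exists_changePoly_mul_eq (f : MvPolynomial (Fin 2) ℂ) :
    ∃ (D : ℕ) (g : MvPolynomial (Fin 2) ℂ),
      changePoly f * wCoord ^ D = algebraMap (MvPolynomial (Fin 2) ℂ) RatFun g ∧
        ∀ x : ℂ × ℂ, x.2 ≠ 0 → evalAt x g = x.2 ^ D * evalAt (changeAffine x) f := by
  have hw := wCoord_ne_zero
  induction f using MvPolynomial.induction_on with
  | C a =>
    refine ⟨0, MvPolynomial.C a, ?_, fun x _ => by simp [evalAt]⟩
    rw [pow_zero, mul_one, changePoly, MvPolynomial.aeval_C,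
      IsScalarTower.algebraMap_apply ℂ (MvPolynomial (Fin 2) ℂ) RatFun, MvPolynomial.algebraMap_eq]
  | add f₁ f₂ h₁ h₂ =>
    obtain ⟨D₁, g₁, h₁, h₁'⟩ := h₁
    obtain ⟨D₂, g₂, h₂, h₂'⟩ := h₂
    refine ⟨D₁ + D₂, g₁ * MvPolynomial.X 1 ^ D₂ + g₂ * MvPolynomial.X 1 ^ D₁, ?_, fun x hx => ?_⟩
    · rw [map_add, map_add, map_mul, map_mul, ← h₁, ← h₂, map_pow, map_pow, pow_add]
      change _ = _ * wCoord ^ D₂ + _ * wCoord ^ D₁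
      ring
    · have e₁ := h₁' x hx
      have e₂ := h₂' x hx
      simp only [evalAt, map_add, map_mul, map_pow, MvPolynomial.eval_X] at e₁ e₂ ⊢
      rw [e₁, e₂]
      simp
      ring
  | mul_X f n h =>
    obtain ⟨D, g, h, h'⟩ := h
    have key : ∃ k : MvPolynomial (Fin 2) ℂ,
        changePoly (MvPolynomial.X n) * wCoord = algebraMap (MvPolynomial (Fin 2) ℂ) RatFun k ∧
        ∀ x : ℂ × ℂ, x.2 ≠ 0 → evalAt x k = x.2 * evalAt (changeAffine x) (MvPolynomial.X n) := by
      fin_cases n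
      · refine ⟨MvPolynomial.X 0, ?_, fun x hx => ?_⟩
        · simp [changePoly, hw]
          rfl
        · simp [evalAt, changeAffine]
          field_simp
      · refine ⟨1, ?_, fun x hx => ?_⟩
        · simp [changePoly, hw]
        · simp [evalAt, changeAffine, hx]
    obtain ⟨k, hk, hk'⟩ := key
    refine ⟨D + 1, g * k, ?_, fun x hx => ?_⟩
    · rw [map_mul, map_mul, ← h, ← hk, pow_succ]
      ring
    · have e₁ := h' x hx
      have e₂ := hk' x hx
      simp only [evalAt, map_mul] at e₁ e₂ ⊢
      rw [e₁, e₂, pow_succ]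
      ring

theorem changePoly_injective : Function.Injective changePoly := by
  rw [injective_iff_map_eq_zero]
  intro f hf
  obtain ⟨D, g, hg, hg'⟩ := exists_changePoly_mul_eq f
  rw [hf, zero_mul, eq_comm, map_eq_zero_iff _
    (IsFractionRing.injective (MvPolynomial (Fin 2) ℂ) RatFun)] at hg
  -- `f` vanishes where `w ≠ 0`, hence `w f` vanishes everywhere.
  have h : f * MvPolynomial.X 1 = 0 := by
    refine MvPolynomial.funext fun v => ?_
    rw [map_zero, map_mul, MvPolynomial.eval_X, mul_eq_zero, or_iff_not_imp_right]
    intro hv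
    have hv' : (changeAffine (v 0, v 1)).2 ≠ 0 := one_div_ne_zero hv
    have h1 := hg' _ hv'
    have h0 : evalAt (changeAffine (v 0, v 1)) 0 = 0 := map_zero _
    rw [hg, h0, changeAffine_changeAffine hv, eq_comm, mul_eq_zero, or_iff_right
      (pow_ne_zero _ hv'), evalAt] at h1
    rwa [show ![(v 0, v 1).1, (v 0, v 1).2] = v by ext i; fin_cases i <;> rfl] at h1
  exact (mul_eq_zero.1 h).resolve_right (MvPolynomial.X_ne_zero 1)

/-- The substitution `(z, w) ↦ (z / w, 1 / w)` into rational functions. -/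
def changeHom : RatFun →ₐ[ℂ] RatFun := IsFractionRing.liftAlgHom changePoly_injective

theorem changeHom_algebraMap (f : MvPolynomial (Fin 2) ℂ) :
    changeHom (algebraMap (MvPolynomial (Fin 2) ℂ) RatFun f) = changePoly f :=
  IsFractionRing.lift_algebraMap changePoly_injective f

theorem changeHom_zCoord : changeHom zCoord = zCoord / wCoord := by
  rw [zCoord, changeHom_algebraMap, changePoly, MvPolynomial.aeval_X]
  rfl

theorem changeHom_wCoord : changeHom wCoord = 1 / wCoord := by
  rw [wCoord, changeHom_algebraMap, changePoly, MvPolynomial.aeval_X]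
  rfl

theorem changeHom_changeHom (R : RatFun) : changeHom (changeHom R) = R := by
  have hw := wCoord_ne_zero
  have h : ∀ f : MvPolynomial (Fin 2) ℂ,
      changeHom (changePoly f) = algebraMap (MvPolynomial (Fin 2) ℂ) RatFun f := by
    intro f
    have h' : changeHom.comp changePoly = Algebra.algHom ℂ (MvPolynomial (Fin 2) ℂ) RatFun := by
      refine MvPolynomial.algHom_ext fun i => ?_
      fin_cases i
      · simp only [changePoly, AlgHom.comp_apply, MvPolynomial.aeval_X]
        change changeHom (zCoord / wCoord) = zCoord
        rw [map_div₀, changeHom_zCoord, changeHom_wCoord]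
        field_simp
      · simp only [changePoly, AlgHom.comp_apply, MvPolynomial.aeval_X]
        change changeHom (1 / wCoord) = wCoord
        rw [map_div₀, map_one, changeHom_wCoord, one_div_one_div]
    exact DFunLike.congr_fun h' f
  obtain ⟨f, g, -, rfl⟩ := IsFractionRing.div_surjective (A := MvPolynomial (Fin 2) ℂ) R
  rw [map_div₀, map_div₀, changeHom_algebraMap, changeHom_algebraMap, h, h]

/-- The automorphism `(z, w) ↦ (z / w, 1 / w)` of the field of rational functions. -/
def changeEquiv : RatFun ≃ₐ[ℂ] RatFun :=
  AlgEquiv.ofAlgHom changeHom changeHom (AlgHom.ext changeHom_changeHom)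
    (AlgHom.ext changeHom_changeHom)

theorem changeHom_conicFun (c : ℂ) : changeHom (conicFun c) = conicFun c / wCoord ^ 2 := by
  have hw := wCoord_ne_zero
  rw [conicFun, map_sub, map_mul, map_pow, changeHom_zCoord, changeHom_wCoord, AlgHom.commutes]
  field_simp

/-- The variable change replaces the power `w ^ β` in the denominator of a function of the table by
`w ^ β'`, where `β + β'` is determined by the other exponents. -/
theorem changeHom_tableFrac {L α β β' γ N : ℕ} (c : ℕ → ℂ)
    (h : β + β' + α + 2 * γ * N = 2 * L) :
    changeHom (tableFrac L α β γ N c) = tableFrac L α β' γ N c := by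
  have hw := wCoord_ne_zero
  rw [tableFrac_eq, tableFrac_eq, ← conicFun_one, map_div₀, map_mul, map_mul, map_pow, map_pow,
    map_pow, map_prod, changeHom_conicFun, changeHom_zCoord, changeHom_wCoord]
  simp only [map_pow, changeHom_conicFun, div_pow, Finset.prod_div_distrib, Finset.prod_const,
    Nat.card_Icc, Nat.add_sub_cancel, one_pow]
  generalize ∏ j ∈ Finset.Icc 1 N, conicFun (c j) ^ γ = u
  have e : (wCoord ^ 2) ^ L = wCoord ^ β * wCoord ^ β' * wCoord ^ α * ((wCoord ^ 2) ^ γ) ^ N := by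
    rw [← pow_mul, ← h, ← pow_mul, ← pow_mul, pow_add, pow_add, pow_add,
      mul_assoc 2]
  rw [e]
  generalize hv : ((wCoord ^ 2) ^ γ) ^ N = v
  have hv0 : v ≠ 0 := hv ▸ pow_ne_zero _ (pow_ne_zero _ (pow_ne_zero _ hw))
  field_simp

theorem isTableIntegral_changeEquiv {ρ : ℂ} {R : RatFun} (h : IsTableIntegral ρ R) :
    IsTableIntegral (4 - ρ) (changeEquiv R) := by
  change IsTableIntegral (4 - ρ) (changeHom R)
  rw [isTableIntegral_iff] at h ⊢
  obtain ⟨i, rfl, rfl⟩ := h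
  have hres : ∀ i j : TableIndex, j.slope = -i.slope → 4 - i.residue = j.residue := by
    intro i j hij
    rw [TableIndex.residue, TableIndex.residue, hij, Int.cast_neg, div_neg]
    ring
  cases i with
  | two => exact ⟨.two, hres _ _ rfl, changeHom_tableFrac _ rfl⟩
  | oddMinus N => exact ⟨.oddPlus N, hres _ _ (neg_neg _).symm, changeHom_tableFrac _ (by ring)⟩
  | oddPlus N => exact ⟨.oddMinus N, hres _ _ rfl, changeHom_tableFrac _ (by ring)⟩
  | evenMinus N => exact ⟨.evenPlus N, hres _ _ (neg_neg _).symm, changeHom_tableFrac _ (by ring)⟩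
  | evenPlus N => exact ⟨.evenMinus N, hres _ _ rfl, changeHom_tableFrac _ (by ring)⟩

theorem quasihomogeneouslyIntegrable_iff {p q : ℕ} (hq : 1 ≤ q) (hqp : q < p)
    (hpq : Nat.Coprime p q) (ρ : ℂ) :
    QuasihomogeneouslyIntegrable p q ρ ↔ p = 2 ∧ q = 1 ∧ ρ ∈ residues := by
  constructor
  · intro h
    by_cases h3 : 3 ≤ p
    · obtain ⟨n, rfl⟩ := Nat.exists_eq_add_of_lt hqp
      exact absurd h (not_quasihomogeneouslyIntegrable (m := q) (n := n + 1) (by omega) (by omega)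
        (by simpa [add_assoc, Nat.coprime_comm] using hpq) (by omega) ρ)
    · obtain rfl : p = 2 := by omega
      obtain rfl : q = 1 := by omega
      exact ⟨rfl, rfl, mem_residues_of_integrable h⟩
  · rintro ⟨rfl, rfl, h⟩
    obtain ⟨i, rfl⟩ := exists_residue_eq h
    exact ⟨_, i.isQuasihomogeneousIntegral⟩

end QuasiBilliard

end

open QuasiBilliard in
theorem theorem4p1 :
    -- the classification of the integrable billiards
    (∀ p q : ℕ, 1 ≤ q → q < p → Nat.Coprime p q → ∀ ρ : ℂ,
      (QuasihomogeneouslyIntegrable p q ρ ↔ p = 2 ∧ q = 1 ∧ ρ ∈ residues)) ∧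
    -- the table assigns one function to each residue in the list, and this is an integral
    (∀ ρ ∈ residues, ∃! R : RatFun, IsTableIntegral ρ R) ∧
    (∀ ρ ∈ residues, ∀ R : RatFun, IsTableIntegral ρ R → IsQuasihomogeneousIntegral 2 1 ρ R) ∧
    -- the variable change transforms the billiard with residue ρ to that with residue 4 - ρ
    (Set.BijOn changeAffine (puncturedCurve 2 1) (puncturedCurve 2 1) ∧
      ∀ P ∈ puncturedCurve 2 1,
        changeProj (affinePoint P) = affinePoint (changeAffine P) ∧
        changeProj '' tangentLine 2 1 P = tangentLine 2 1 (changeAffine P) ∧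
        ∀ (ρ : ℂ) (x y : CP2), BilliardMap 2 1 ρ P x y ↔
          BilliardMap 2 1 (4 - ρ) (changeAffine P) (changeProj x) (changeProj y)) ∧
    -- the variable change interchanges the integrals of the table
    (∃ Φ : RatFun ≃ₐ[ℂ] RatFun, Φ zCoord = zCoord / wCoord ∧ Φ wCoord = 1 / wCoord ∧
      ∀ ρ ∈ residues, ∀ R : RatFun, IsTableIntegral ρ R → IsTableIntegral (4 - ρ) (Φ R)) := by
  refine ⟨fun p q hq hqp hpq ρ => quasihomogeneouslyIntegrable_iff hq hqp hpq ρ,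
    fun ρ hρ => existsUnique_isTableIntegral hρ, ?_, ⟨bijOn_changeAffine, fun P hP =>
    ⟨changeProj_affinePoint P (ne_zero_of_mem two_ne_zero one_ne_zero hP).2,
      image_changeProj_tangentLine hP, billiardMap_changeProj_iff hP⟩⟩,
    changeEquiv, changeHom_zCoord, changeHom_wCoord, fun ρ _ R => isTableIntegral_changeEquiv⟩
  intro ρ _ R hR
  obtain ⟨i, rfl, rfl⟩ := isTableIntegral_iff.1 hR
  exact i.isQuasihomogeneousIntegral
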